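/- Let $M=(M_j)_{j\ge 0}$ be a sequence of positive real numbers with $M_0=1$, let $0<\alpha\le 1$, and assume $\lim_{j\to\infty}\bigl(j^{(1-\alpha)j}M_j\bigr)^{1/j}=\infty$ (with $0^0:=1$). Let $S_\alpha=\{z\in\mathbb C\setminus\{0\}:|\arg z|<\alpha\pi/2\}$, and let $\mathcal A_{\{M\}}(S_\alpha)$ be the class of holomorphic functions $f$ on $S_\alpha$ for which there are $C,h>0$ with $|f^{(j)}(z)|\le C h^jM_j$ for all $z\in S_\alpha$ and $j\ge 0$. Put $$M^{(\alpha)}_j:=j^{(\alpha-1)j}\,\bigl(i^{(1-\alpha)i}M_i\bigr)^{\mathrm{lc}}_j ,$$ where $G^{\mathrm{lc}}$ is the largest log-convex sequence $L$ of positive numbers ($L_j^2\le L_{j-1}L_{j+1}$ for $j\ge1$) with $L\le G$ termwise. For a sequence $N$ write $\check N_j:=N_j/j!$. Then the following are equivalent: (a) $M^{(\alpha)}$ is root almost increasing (rai): there is $C>0$ with $(\check M^{(\alpha)}_j)^{1/j}\le C(\check M^{(\alpha)}_k)^{1/k}$ for all $1\le j\le k$. (b) $\mathcal A_{\{M\}}(S_\alpha)$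 is holomorphically closed: if $f\in\mathcal A_{\{M\}}(S_\alpha)$, $U\subseteq\mathbb C$ is open with $\overline{f(S_\alpha)}\subseteq U$, and $g$ is holomorphic on $U$, then $g\circ f\in\mathcal A_{\{M\}}(S_\alpha)$. (c) $\mathcal A_{\{M\}}(S_\alpha)$ is inverse-closed: if $f\in\mathcal A_{\{M\}}(S_\alpha)$ and $\inf_{z\in S_\alpha}|f(z)|>0$, then $1/f\in\mathcal A_{\{M\}}(S_\alpha)$. If moreover $\liminf_{j\to\infty}(M_j/j!)^{1/j}>0$ and $M^{(\alpha)}$ satisfies (dc), i.e. there is $D\ge1$ with $M^{(\alpha)}_{j+1}\le D^{j+1}M^{(\alpha)}_j$ for all $j\ge 0$, then (a), (b), (c) are also equivalent to each of the following: (d) $\mathcal A_{\{M\}}(S_\alpha)$ is closed under composition: if $f\in\mathcal A_{\{M\}}(S_\alpha)$, $U\subseteq\mathbb C$ is open with $\overline{f(S_\alpha)}\subseteq U$, and $g$ is holomorphic on $U$ such that for every compact $K\subset U$ there are $C,h>0$ with $|g^{(j)}(z)|\le Ch^jM_j$ for all $z\in K$, $j\ge0$, then $g\circ f\in\mathcal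 A_{\{M\}}(S_\alpha)$. (e) $M^{(\alpha)}$ has the Faà di Bruno property (FdB): there are $C,h\ge1$ with $\check M^{(\alpha),\circ}_k\le C h^k\check M^{(\alpha)}_k$ for all $k\ge 0$, where $\check M^{(\alpha),\circ}_0:=1$ and, for $k\ge1$, $\check M^{(\alpha),\circ}_k:=\max\{\check M^{(\alpha)}_\ell\,\check M^{(\alpha)}_{j_1}\cdots\check M^{(\alpha)}_{j_\ell}:\ \ell\ge1,\ j_i\ge 1,\ j_1+\dots+j_\ell=k\}$. -/

import Mathlib

noncomputable section

namespace Ultrahol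

open Filter

/-! Conditions on sequences `M : ℕ → ℝ` of positive real numbers. -/

/-- `M` is log-convex: `M_j ^ 2 ≤ M_{j-1} M_{j+1}` for all `j ≥ 1`. -/
def LogConvex (M : ℕ → ℝ) : Prop :=
  ∀ j : ℕ, M (j + 1) ^ 2 ≤ M j * M (j + 2)

/-- `M_j / j!`. -/
def check (M : ℕ → ℝ) (j : ℕ) : ℝ := M j / (j.factorial : ℝ)

/-- The sequence `j ^ (a j)`, with the convention `0 ^ 0 = 1`. -/
def gevrey (a : ℝ) (j : ℕ) : ℝ := (j : ℝ) ^ (a * (j : ℝ))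

/-- The positive log-convex sequences that lie below `G`. -/
def logConvexBelow (G : ℕ → ℝ) : Set (ℕ → ℝ) :=
  {L | (∀ j, 0 < L j) ∧ LogConvex L ∧ ∀ j, L j ≤ G j}

/-- The log-convex minorant of `G`: the largest log-convex sequence below `G`, taken as the
termwise supremum of all of them (see `isGreatest_lcMinorant`). -/
def lcMinorant (G : ℕ → ℝ) (j : ℕ) : ℝ :=
  ⨆ L : logConvexBelow G, (L : ℕ → ℝ) j

/-- `G_j ^ (1/j) → ∞`. -/
def RootsTendToInfinity (G : ℕ → ℝ) : Prop :=
  Tendsto (fun j : ℕ => G j ^ (1 / (j : ℝ))) atTop atTop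

/-- If `G` is positive and `G_j ^ (1/j) → ∞`, then `lcMinorant G` is a positive log-convex
sequence below `G`, and every positive log-convex sequence below `G` lies below it. -/
theorem isGreatest_lcMinorant (G : ℕ → ℝ) (hG : ∀ j, 0 < G j) (hlim : RootsTendToInfinity G) :
    IsGreatest (logConvexBelow G) (lcMinorant G) := by
  have hbdd : ∀ j, BddAbove (Set.range fun L : logConvexBelow G => (L : ℕ → ℝ) j) := by
    intro j
    refine ⟨G j, ?_⟩
    rintro _ ⟨L, rfl⟩
    exact L.2.2.2 j
  have hle : ∀ L ∈ logConvexBelow G, ∀ j, L j ≤ lcMinorant G j := fun L hL j =>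
    le_ciSup (hbdd j) ⟨L, hL⟩
  have hne : ∃ c : ℝ, 0 < c ∧ ∀ j, c ≤ G j := by
    have h1 : ∀ᶠ j : ℕ in atTop, 1 ≤ G j := by
      filter_upwards [hlim.eventually_ge_atTop 1, eventually_gt_atTop 0] with j hj hj0
      by_contra hcon
      have : G j ^ (1 / (j : ℝ)) < 1 :=
        Real.rpow_lt_one (hG j).le (not_le.1 hcon) (by positivity)
      linarith
    obtain ⟨N, hN⟩ := eventually_atTop.1 h1
    obtain ⟨i, -, hi⟩ := Finset.exists_min_image (Finset.range (N + 1)) G ⟨0, by simp⟩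
    refine ⟨min 1 (G i), lt_min one_pos (hG i), fun j => ?_⟩
    rcases le_total N j with h | h
    · exact (min_le_left _ _).trans (hN j h)
    · exact (min_le_right _ _).trans (hi j (by simp; omega))
  obtain ⟨c, hc, hcG⟩ := hne
  have hcmem : (fun _ => c) ∈ logConvexBelow G :=
    ⟨fun _ => hc, fun _ => (sq c).le, hcG⟩
  have : Nonempty (logConvexBelow G) := ⟨⟨_, hcmem⟩⟩
  have hpos : ∀ j, 0 < lcMinorant G j := fun j => hc.trans_le (hle _ hcmem j)
  refine ⟨⟨hpos, fun j => ?_, fun j => ciSup_le fun L => L.2.2.2 j⟩, fun L hL j => hle L hL j⟩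
  have hs : lcMinorant G (j + 1) ≤ √(lcMinorant G j * lcMinorant G (j + 2)) := by
    refine ciSup_le fun L => Real.le_sqrt_of_sq_le ((L.2.2.1 j).trans ?_)
    exact mul_le_mul (hle L L.2 j) (hle L L.2 (j + 2)) (L.2.1 _).le (hpos j).le
  calc lcMinorant G (j + 1) ^ 2
      ≤ √(lcMinorant G j * lcMinorant G (j + 2)) ^ 2 := by
        have := (hpos (j + 1)).le
        gcongr
    _ = _ := Real.sq_sqrt (mul_nonneg (hpos _).le (hpos _).le)

/-- The sequence `j ^ ((α - 1) j) * (j ^ ((1 - α) j) M_j) ^ lc`. -/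
def regularized (α : ℝ) (M : ℕ → ℝ) (j : ℕ) : ℝ :=
  gevrey (α - 1) j * lcMinorant (fun i => gevrey (1 - α) i * M i) j

/-- Root almost increasing: `(M_j / j!) ^ (1/j) ≤ C (M_k / k!) ^ (1/k)` for `1 ≤ j ≤ k`. -/
def RootAlmostIncreasing (M : ℕ → ℝ) : Prop :=
  ∃ C : ℝ, 0 < C ∧ ∀ j k : ℕ, 1 ≤ j → j ≤ k →
    check M j ^ (1 / (j : ℝ)) ≤ C * check M k ^ (1 / (k : ℝ))

/-- Derivation closedness: `M_{j+1} ≤ D ^ (j+1) M_j`. -/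
def DerivationClosed (M : ℕ → ℝ) : Prop :=
  ∃ D : ℝ, 1 ≤ D ∧ ∀ j : ℕ, M (j + 1) ≤ D ^ (j + 1) * M j

/-- For `k ≥ 1`, the maximum of `a_ℓ a_{j_1} ⋯ a_{j_ℓ}` over all `j_1, …, j_ℓ ≥ 1` with sum `k`;
the value at `k = 0` is `1`. -/
def circ (a : ℕ → ℝ) (k : ℕ) : ℝ :=
  if k = 0 then 1 else ⨆ c : Composition k, a c.length * ∏ i, a (c.blocksFun i)

/-- The Faà di Bruno property. -/
def FaaDiBruno (M : ℕ → ℝ) : Prop :=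
  ∃ C : ℝ, 1 ≤ C ∧ ∃ h : ℝ, 1 ≤ h ∧ ∀ j : ℕ, circ (check M) j ≤ C * h ^ j * check M j

/-! Classes of holomorphic functions. A function on a subset of `ℂ` is given by a function on `ℂ`
of which only the values on that (open) subset matter. -/

/-- The unbounded open sector of opening `α π` bisected by the positive real axis
(used for `0 < α ≤ 1`). -/
def sector (α : ℝ) : Set ℂ :=
  {z | z ≠ 0 ∧ |z.arg| < α * Real.pi / 2}

/-- The ultraholomorphic class of Roumieu type: holomorphic `f` on the open set `S` with
`|f^(j)(z)| ≤ C h ^ j M_j` for some `C` and some `h > 0`, all `z ∈ S` and all `j`. -/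
def roumieuClass (M : ℕ → ℝ) (S : Set ℂ) : Set (ℂ → ℂ) :=
  {f | DifferentiableOn ℂ f S ∧ ∃ h : ℝ, 0 < h ∧ ∃ C : ℝ, ∀ z ∈ S, ∀ j : ℕ,
    ‖iteratedDeriv j f z‖ ≤ C * (h ^ j * M j)}

/-- The local class on an open set `U`: holomorphic `g` on `U` that satisfy on each compact
`K ⊆ U` a bound `|g^(j)(z)| ≤ C h ^ j M_j` with `C` and `h > 0` depending on `K`. -/
def localRoumieuClass (M : ℕ → ℝ) (U : Set ℂ) : Set (ℂ → ℂ) :=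
  {g | DifferentiableOn ℂ g U ∧ ∀ K : Set ℂ, IsCompact K → K ⊆ U →
    ∃ h : ℝ, 0 < h ∧ ∃ C : ℝ, ∀ z ∈ K, ∀ j : ℕ,
      ‖iteratedDeriv j g z‖ ≤ C * (h ^ j * M j)}

/-- `g ∘ f` stays in the class whenever `f` is in the class and `g` is holomorphic on an open set
that contains the closure of the range of `f`. -/
def HolomorphicallyClosed (M : ℕ → ℝ) (S : Set ℂ) : Prop :=
  ∀ f ∈ roumieuClass M S, ∀ U : Set ℂ, IsOpen U → closure (f '' S) ⊆ U →
    ∀ g : ℂ → ℂ, DifferentiableOn ℂ g U → g ∘ f ∈ roumieuClass M S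

/-- `1 / f` stays in the class whenever `f` is in the class and `inf_{z ∈ S} |f(z)| > 0`. -/
def InverseClosed (M : ℕ → ℝ) (S : Set ℂ) : Prop :=
  ∀ f ∈ roumieuClass M S, (∃ δ : ℝ, 0 < δ ∧ ∀ z ∈ S, δ ≤ ‖f z‖) →
    (fun z => 1 / f z) ∈ roumieuClass M S

/-- `g ∘ f` stays in the class whenever `f` is in the class and `g` is in the local class on an
open set that contains the closure of the range of `f`. -/
def CompositionClosed (M : ℕ → ℝ) (S : Set ℂ) : Prop :=
  ∀ f ∈ roumieuClass M S, ∀ U : Set ℂ, IsOpen U → closure (f '' S) ⊆ U →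
    ∀ g ∈ localRoumieuClass M U, g ∘ f ∈ roumieuClass M S

/-- `liminf (M_j / j!) ^ (1/j) > 0`, the lower limit being taken in the extended reals, where it
may be `∞`. -/
def PositiveCheckLiminf (M : ℕ → ℝ) : Prop :=
  0 < liminf (fun j : ℕ => ((check M j ^ (1 / (j : ℝ)) : ℝ) : EReal)) atTop

end Ultrahol

end

/-!
Write `κ = 1 - α`, `S = sector α` and `N = regularized α M`, so that `N_j = j ^ (-κ j) L_j` where
`L` is the log-convex minorant of `j ^ (κ j) M_j`.

*The classes of `M` and `N` coincide* (`roumieuClass_regularized`). For a function `f` with bounded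
derivatives on `S`, the polynomial `∑ f^(p+i)(z) u ^ i`, `i < q - p`, is a difference of two Laplace
integrals along a ray of the sector, hence is controlled by bounds of `f^(p)` and `f^(q)` for all
`u` outside a cone of opening `κ π` (`norm_sum_iteratedDeriv_le`). The Phragmén–Lindelöf principle
inside the cone and the Cauchy estimates bound its coefficients (`exists_norm_coeff_le`). This is an
interpolation inequality for derivatives (`exists_norm_iteratedDeriv_le`), by which a bound of
`f^(j)` at the indices where the minorant touches `j ^ (κ j) M_j` implies a bound by `N_j` at the
indices in between. So `M` may be replaced by `N`.

*Root almost increasing weights give holomorphic closedness*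
(`RootAlmostIncreasing.comp_mem_roumieuClass`). The derivative of order `k` of `g ∘ f` at `z` does
not change when `f` is replaced by its Taylor polynomial of degree `k` at `z`. The condition on `N`
makes this polynomial nearly constant on a disc of radius comparable to `(N_k / k!) ^ (-1 / k)`, and
the Cauchy estimate for the composition on this disc is the required bound. Holomorphic
closedness contains inverse-closedness, with `g w = 1 / w`.

*Inverse-closedness makes the weights root almost increasing.* The entire function
`∑ (-z) ^ n / Γ ((1 + κ) n + 3)` has derivatives of order `j` on `S` of size `j ^ (-κ j)` up to a
geometric factor (`norm_iteratedDeriv_mlFun_le`, by Hankel's formula), and they attain this size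
with the sign `(-1) ^ j` at the vertex `0`. Superposing its dilates produces `f` in the class of `N`
with `(-1) ^ j f^(j)(0)` at least `N_j` up to a geometric factor (`exists_extremal`). For a
large constant `c`, all terms of the Leibniz recursion for the derivatives of `1 / (c - f)` at the
vertex have the same sign. Hence each of them is bounded by the derivative of `1 / (c - f)`, which
gives `(N_j / j!) ^ l ≤ H ^ (jl) N_{jl} / (jl)!` (`InverseClosed.pow_le`). As the roots of `L`
increase, this inequality implies that `N` is root almost increasing
(`rootAlmostIncreasing_of_pow_le`).

*Composition and the Faà di Bruno property.* If `M_j / j!` is bounded below by a geometric sequence,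
then the local class contains all holomorphic functions by the Cauchy estimates
(`mem_localRoumieuClass`), so composition closedness and holomorphic closedness agree. The lower
bound passes to `N`, and then the Faà di Bruno property, for compositions of `jl` into `l` equal
parts, implies the power inequality above (`FaaDiBruno.pow_le`). Conversely, for root almost
increasing `N` with (dc) every product in the Faà di Bruno property is bounded by `N_k / k!` up
to a geometric factor (`RootAlmostIncreasing.faaDiBruno`).
-/

noncomputable section

namespace Ultrahol

open Filter

/-! ### The log-convex minorant -/

section Minorant

variable {G : ℕ → ℝ}

theorem lcMinorant_pos (hG : ∀ j, 0 < G j) (hlim : RootsTendToInfinity G) (j : ℕ) :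
    0 < lcMinorant G j :=
  (isGreatest_lcMinorant G hG hlim).1.1 j

theorem lcMinorant_logConvex (hG : ∀ j, 0 < G j) (hlim : RootsTendToInfinity G) :
    LogConvex (lcMinorant G) :=
  (isGreatest_lcMinorant G hG hlim).1.2.1

theorem lcMinorant_le (hG : ∀ j, 0 < G j) (hlim : RootsTendToInfinity G) (j : ℕ) :
    lcMinorant G j ≤ G j :=
  (isGreatest_lcMinorant G hG hlim).1.2.2 j

theorem le_lcMinorant (hG : ∀ j, 0 < G j) (hlim : RootsTendToInfinity G) {L : ℕ → ℝ}
    (hL : L ∈ logConvexBelow G) (j : ℕ) : L j ≤ lcMinorant G j :=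
  (isGreatest_lcMinorant G hG hlim).2 hL j

/-- One entry of a log-convex sequence may be raised as long as log-convexity at that entry
survives: the conditions at the neighbouring entries only become weaker. -/
theorem update_mem_logConvexBelow {L : ℕ → ℝ} (hL : L ∈ logConvexBelow G) {k : ℕ} {x : ℝ}
    (hx : L k ≤ x) (hxG : x ≤ G k) (hconv : ∀ i, k = i + 1 → x ^ 2 ≤ L i * L (i + 2)) :
    Function.update L k x ∈ logConvexBelow G := by
  obtain ⟨hpos, hlc, hle⟩ := hL
  have hge : ∀ j, L j ≤ Function.update L k x j := by
    intro j
    rcases eq_or_ne j k with rfl | h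
    · simpa using hx
    · simp [h]
  refine ⟨fun j => (hpos j).trans_le (hge j), fun j => ?_, fun j => ?_⟩
  · have hmul : L j * L (j + 2) ≤ Function.update L k x j * Function.update L k x (j + 2) :=
      mul_le_mul (hge _) (hge _) (hpos _).le ((hpos _).le.trans (hge _))
    refine le_trans ?_ hmul
    rcases eq_or_ne (j + 1) k with rfl | h
    · simpa using hconv j rfl
    · simpa [h] using hlc j
  · rcases eq_or_ne j k with rfl | h
    · simpa using hxG
    · simpa [h] using hle j

theorem lcMinorant_zero (hG : ∀ j, 0 < G j) (hlim : RootsTendToInfinity G) :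
    lcMinorant G 0 = G 0 := by
  refine le_antisymm (lcMinorant_le hG hlim 0) ?_
  have := le_lcMinorant hG hlim (update_mem_logConvexBelow (isGreatest_lcMinorant G hG hlim).1
    (lcMinorant_le hG hlim 0) le_rfl (fun i hi => by omega)) 0
  simpa using this

/-- By maximality, the minorant either touches the sequence or is log-affine at each index. -/
theorem lcMinorant_eq_or_sq_eq (hG : ∀ j, 0 < G j) (hlim : RootsTendToInfinity G) (i : ℕ) :
    lcMinorant G (i + 1) = G (i + 1) ∨
      lcMinorant G (i + 1) ^ 2 = lcMinorant G i * lcMinorant G (i + 2) := by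
  set L := lcMinorant G with hLdef
  have hp : ∀ j, 0 < L j := lcMinorant_pos hG hlim
  have hs : L (i + 1) ≤ √(L i * L (i + 2)) :=
    Real.le_sqrt_of_sq_le (lcMinorant_logConvex hG hlim i)
  have hsq : √(L i * L (i + 2)) ^ 2 = L i * L (i + 2) :=
    Real.sq_sqrt (mul_nonneg (hp _).le (hp _).le)
  have hle := le_lcMinorant hG hlim (update_mem_logConvexBelow (k := i + 1)
    (x := min (G (i + 1)) √(L i * L (i + 2))) (isGreatest_lcMinorant G hG hlim).1
    (le_min (lcMinorant_le hG hlim _) hs) (min_le_left _ _) (fun j hj => by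
      obtain rfl : i = j := by omega
      have : 0 ≤ min (G (i + 1)) √(L i * L (i + 2)) := le_min (hG _).le (Real.sqrt_nonneg _)
      exact (pow_le_pow_left₀ this (min_le_right _ _) 2).trans hsq.le)) (i + 1)
  rw [Function.update_self, min_le_iff] at hle
  rcases hle with h | h
  · exact Or.inl (le_antisymm (lcMinorant_le hG hlim _) h)
  · right
    rw [← hsq, le_antisymm hs h]

/-- The minorant touches the sequence at arbitrarily large indices: a geometric sequence with a
large ratio, scaled to touch `G` from below, does so far to the right. -/
theorem exists_lcMinorant_eq_gt (hG : ∀ j, 0 < G j) (hlim : RootsTendToInfinity G) (j : ℕ) :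
    ∃ q, j < q ∧ lcMinorant G q = G q := by
  obtain ⟨t, ht1, ht⟩ : ∃ t : ℝ, 1 ≤ t ∧ ∀ n ≤ j, G (j + 1) < t * G n := by
    obtain ⟨i, -, hi⟩ := Finset.exists_min_image (Finset.range (j + 1)) G ⟨0, by simp⟩
    refine ⟨max 1 (G (j + 1) / G i + 1), le_max_left _ _, fun n hn => ?_⟩
    have h1 : G i ≤ G n := hi n (by simp; omega)
    calc G (j + 1) < (G (j + 1) / G i + 1) * G i := by
          have := hG i
          field_simp
          linarith
      _ ≤ max 1 (G (j + 1) / G i + 1) * G n :=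
          mul_le_mul (le_max_right _ _) h1 (hG i).le (by positivity)
  have ht0 : 0 < t := by linarith
  have htend : Tendsto (fun n : ℕ => G n / t ^ n) cofinite atTop := by
    rw [Nat.cofinite_eq_atTop]
    refine tendsto_atTop_mono' atTop ?_ (tendsto_pow_atTop_atTop_of_one_lt (one_lt_two (α := ℝ)))
    filter_upwards [hlim.eventually_ge_atTop (2 * t), eventually_gt_atTop 0] with n hn hn0
    rw [le_div_iff₀ (by positivity), ← mul_pow]
    have := pow_le_pow_left₀ (by positivity) hn n
    rwa [one_div, Real.rpow_inv_natCast_pow (hG n).le hn0.ne'] at this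
  obtain ⟨q, hq⟩ := htend.exists_forall_le
  have hqj : j < q := by
    by_contra hcon
    have hcon : q ≤ j := not_lt.1 hcon
    have h1 := hq (j + 1)
    rw [div_le_div_iff₀ (by positivity) (by positivity)] at h1
    have h2 : t ^ q * t ≤ t ^ (j + 1) := by
      rw [← pow_succ]; exact pow_le_pow_right₀ ht1 (by omega)
    have h3 := mul_le_mul_of_nonneg_left h2 (hG q).le
    have h4 := mul_lt_mul_of_pos_right (ht q hcon) (pow_pos ht0 q)
    nlinarith
  have hmem : (fun n => G q / t ^ q * t ^ n) ∈ logConvexBelow G := by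
    refine ⟨fun n => by have := hG q; positivity, fun n => le_of_eq (by ring), fun n => ?_⟩
    have := hq n
    rwa [le_div_iff₀ (by positivity)] at this
  refine ⟨q, hqj, le_antisymm (lcMinorant_le hG hlim q) ?_⟩
  have := le_lcMinorant hG hlim hmem q
  simpa [div_mul_cancel₀ _ (pow_pos ht0 q).ne'] using this

/-- Every index is either a touching index of the minorant or lies strictly between two touching
indices between which the minorant is log-affine. -/
theorem exists_logAffine_lcMinorant (hG : ∀ j, 0 < G j) (hlim : RootsTendToInfinity G) (j : ℕ) :
    lcMinorant G j = G j ∨ ∃ p q : ℕ, p < j ∧ j < q ∧ ∃ δ : ℝ,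
      Real.log (lcMinorant G j) = Real.log (G p) + (j - p : ℝ) * δ ∧
      Real.log (G q) = Real.log (G p) + (q - p : ℝ) * δ := by
  classical
  by_cases hj : lcMinorant G j = G j
  · exact Or.inl hj
  right
  set L := lcMinorant G with hLdef
  have hp : ∀ j, 0 < L j := lcMinorant_pos hG hlim
  set P : ℕ → Prop := fun i => L i = G i
  have hP0 : P 0 := lcMinorant_zero hG hlim
  have hex : ∃ q, j ≤ q ∧ P q := by
    obtain ⟨q, hq, h⟩ := exists_lcMinorant_eq_gt hG hlim j
    exact ⟨q, hq.le, h⟩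
  obtain ⟨hjq, hPq⟩ := Nat.find_spec hex
  set q := Nat.find hex
  have hPp : P (Nat.findGreatest P j) := Nat.findGreatest_spec (Nat.zero_le j) hP0
  have hpj : Nat.findGreatest P j ≤ j := Nat.findGreatest_le j
  have hgr : ∀ i, Nat.findGreatest P j < i → i ≤ j → ¬ P i := fun i h1 h2 =>
    Nat.findGreatest_is_greatest h1 h2
  generalize Nat.findGreatest P j = p at *
  have hpj : p < j := lt_of_le_of_ne hpj (by rintro rfl; exact hj hPp)
  have hjq : j < q := lt_of_le_of_ne hjq (by intro h; rw [← h] at hPq; exact hj hPq)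
  have hnot : ∀ i, p < i → i < q → ¬ P i := by
    intro i h1 h2 h3
    rcases le_total i j with h | h
    · exact hgr i h1 h h3
    · exact Nat.find_min hex h2 ⟨h, h3⟩
  have haff : ∀ n, p + n < q → Real.log (L (p + n)) =
        Real.log (L p) + n * (Real.log (L (p + 1)) - Real.log (L p)) ∧
      Real.log (L (p + n + 1)) =
        Real.log (L p) + (n + 1) * (Real.log (L (p + 1)) - Real.log (L p)) := by
    intro n
    induction n with
    | zero => intro _; simp
    | succ n ih =>
      intro hn
      obtain ⟨h1, h2⟩ := ih (by omega)
      have h3 := (lcMinorant_eq_or_sq_eq hG hlim (p + n)).resolve_left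
        (hnot _ (by omega) (by omega))
      have h4 := congrArg Real.log h3
      rw [Real.log_pow, Real.log_mul (hp _).ne' (hp _).ne'] at h4
      rw [← hLdef] at h4
      push_cast at h4 ⊢
      refine ⟨h2, ?_⟩
      have : p + (n + 1) + 1 = p + n + 2 := by ring
      rw [this]
      linarith
  refine ⟨p, q, hpj, hjq, Real.log (L (p + 1)) - Real.log (L p), ?_, ?_⟩
  · have := (haff (j - p) (by omega)).1
    rw [Nat.add_sub_cancel' hpj.le, Nat.cast_sub hpj.le] at this
    rwa [← hPp]
  · have := (haff (q - 1 - p) (by omega)).2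
    rw [show p + (q - 1 - p) + 1 = q by omega] at this
    rw [← hPp, ← hPq, this]
    congr 2
    have : ((q - 1 - p : ℕ) : ℝ) + 1 = ((q - p : ℕ) : ℝ) := by
      exact_mod_cast (by omega : q - 1 - p + 1 = q - p)
    rw [this, Nat.cast_sub (by omega)]

end Minorant

/-! ### Gevrey factors -/

theorem gevrey_pos (a : ℝ) (j : ℕ) : 0 < gevrey a j := by
  rcases Nat.eq_zero_or_pos j with rfl | h
  · simp [gevrey]
  · exact Real.rpow_pos_of_pos (by exact_mod_cast h) _

@[simp] theorem gevrey_zero (a : ℝ) : gevrey a 0 = 1 := by simp [gevrey]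

theorem log_gevrey (a : ℝ) (j : ℕ) : Real.log (gevrey a j) = a * (j * Real.log j) := by
  rcases Nat.eq_zero_or_pos j with rfl | h
  · simp
  · rw [gevrey, Real.log_rpow (by exact_mod_cast h)]; ring

theorem gevrey_neg_mul (a : ℝ) (j : ℕ) : gevrey (-a) j * gevrey a j = 1 := by
  apply Real.eq_one_of_pos_of_log_eq_zero
  · exact mul_pos (gevrey_pos _ _) (gevrey_pos _ _)
  · rw [Real.log_mul (gevrey_pos _ _).ne' (gevrey_pos _ _).ne', log_gevrey, log_gevrey]; ring

/-- The entropy estimate that makes the Gevrey factors compatible with log-affine interpolation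
between the indices `p` and `q`. -/
theorem mul_log_half_le {p q j : ℝ} (hp : 0 ≤ p) (hpj : p < j) (hjq : j < q) :
    j * Real.log (j / 2) ≤ (q - j) / (q - p) * (p * Real.log p) +
      (j - p) / (q - p) * (q * Real.log q) + (j - p) * Real.log ((j - p) / (q - p)) := by
  set s := (j - p) / (q - p) with hs
  have hqp : 0 < q - p := by linarith
  have hs0 : 0 < s := div_pos (by linarith) hqp
  have hs1 : s < 1 := (div_lt_one hqp).2 (by linarith)
  have h1s : (q - j) / (q - p) = 1 - s := by rw [hs]; field_simp; ring
  have hjs : j - p = s * (q - p) := by rw [hs]; field_simp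
  have hq : 0 < q := by linarith
  rw [h1s, hjs]
  have ha : (1 - s) * p * Real.log ((1 - s) * p) ≤ (1 - s) * (p * Real.log p) := by
    rcases hp.eq_or_lt with rfl | hp
    · simp
    · rw [Real.log_mul (by linarith) hp.ne']
      have := Real.log_nonpos (by linarith : 0 ≤ 1 - s) (by linarith)
      have : 0 ≤ (1 - s) * p := by nlinarith
      nlinarith
  have hb : s * q * Real.log (s * q) ≤ s * (q * Real.log q) + s * (q - p) * Real.log s := by
    rw [Real.log_mul hs0.ne' hq.ne']
    have h1 := Real.log_nonpos hs0.le hs1.le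
    have h2 : 0 ≤ s * p := by positivity
    nlinarith
  have hconv := Real.convexOn_mul_log.2 (x := (1 - s) * p) (y := s * q)
    (Set.mem_Ici.2 (by nlinarith)) (Set.mem_Ici.2 (by positivity))
    (by norm_num : (0 : ℝ) ≤ 1 / 2) (by norm_num : (0 : ℝ) ≤ 1 / 2) (by norm_num)
  have hj : j = (1 - s) * p + s * q := by linarith
  simp only [smul_eq_mul] at hconv
  rw [show 1 / 2 * ((1 - s) * p) + 1 / 2 * (s * q) = j / 2 by rw [hj]; ring] at hconv
  linarith

/-! ### Weight sequences: root almost increasing, power bounds, Faà di Bruno -/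

theorem check_pos {N : ℕ → ℝ} (hN : ∀ j, 0 < N j) (j : ℕ) : 0 < check N j :=
  div_pos (hN j) (by exact_mod_cast j.factorial_pos)

theorem log_factorial_le (n : ℕ) : Real.log n.factorial ≤ n * Real.log n := by
  rw [← Real.log_pow]
  exact Real.log_le_log (by exact_mod_cast n.factorial_pos) (by exact_mod_cast n.factorial_le_pow)

theorem le_log_factorial (n : ℕ) : n * Real.log n - n ≤ Real.log n.factorial := by
  rcases Nat.eq_zero_or_pos n with rfl | hn
  · simp
  have hn' : (0 : ℝ) < n := by exact_mod_cast hn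
  have hf : (0 : ℝ) < n.factorial := by exact_mod_cast n.factorial_pos
  have h := Real.log_le_log (by positivity) (Real.pow_div_factorial_le_exp (n : ℝ) hn'.le n)
  rw [Real.log_exp, Real.log_div (by positivity) hf.ne', Real.log_pow] at h
  linarith

/-- The roots of a log-convex sequence with initial value `1` increase. -/
theorem LogConvex.mul_log_le_mul_log {L : ℕ → ℝ} (hpos : ∀ j, 0 < L j) (hL : LogConvex L)
    (h0 : L 0 = 1) {j k : ℕ} (hj : 1 ≤ j) (hjk : j ≤ k) :
    Real.log (L j) / j ≤ Real.log (L k) / k := by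
  have hstep : ∀ n : ℕ, (n + 1 : ℝ) * Real.log (L n) ≤ n * Real.log (L (n + 1)) := by
    intro n
    induction n with
    | zero => simp [h0]
    | succ n ih =>
      have h := Real.log_le_log (pow_pos (hpos _) 2) (hL n)
      rw [Real.log_pow, Real.log_mul (hpos _).ne' (hpos _).ne'] at h
      push_cast at h ⊢
      have := mul_le_mul_of_nonneg_left h (by positivity : (0 : ℝ) ≤ n + 1)
      linarith
  induction k, hjk using Nat.le_induction with
  | base => rfl
  | succ k hk ih =>
    refine ih.trans ?_
    have hk' : (0 : ℝ) < k := by exact_mod_cast (by omega : 0 < k)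
    rw [div_le_div_iff₀ hk' (by positivity)]
    have := hstep k
    push_cast
    linarith

/-- A sequence `N_j = j ^ (-κ j) L_j` with `L` log-convex is root almost increasing as soon as the
powers of `N_j / j!` are controlled by `N_{jl} / (jl)!`: the roots of `L` increase, so passing from
a multiple `jl` of `j` to an index between `jl` and `2jl` costs a constant factor only. -/
theorem rootAlmostIncreasing_of_pow_le {κ : ℝ} (hκ : 0 ≤ κ) {L N : ℕ → ℝ} (hpos : ∀ j, 0 < L j)
    (hL : LogConvex L) (h0 : L 0 = 1) (hN : ∀ j, N j = gevrey (-κ) j * L j) {H : ℝ} (hH : 0 < H)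
    (hpow : ∀ j l : ℕ, 1 ≤ j → 1 ≤ l → check N j ^ l ≤ H ^ (j * l) * check N (j * l)) :
    RootAlmostIncreasing N := by
  have hNpos : ∀ j, 0 < N j := fun j => by
    rw [hN]; exact mul_pos (gevrey_pos _ _) (hpos _)
  have hlog : ∀ n : ℕ, Real.log (check N n) =
      -κ * (n * Real.log n) + Real.log (L n) - Real.log n.factorial := by
    intro n
    rw [check, Real.log_div (hNpos n).ne' (by exact_mod_cast n.factorial_ne_zero), hN,
      Real.log_mul (gevrey_pos _ _).ne' (hpos _).ne', log_gevrey]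
  refine ⟨Real.exp (Real.log H + 1 + (κ + 1) * Real.log 2), Real.exp_pos _, fun j k hj hjk => ?_⟩
  have hcj := check_pos hNpos j
  have hck := check_pos hNpos k
  rw [Real.rpow_def_of_pos hcj, Real.rpow_def_of_pos hck, ← Real.exp_add, Real.exp_le_exp]
  -- compare `j` with the largest multiple `j * l` of `j` below `k`; then `k ≤ 2 * (j * l)`
  set l := k / j with hl
  have hl1 : 1 ≤ l := (Nat.one_le_div_iff (by omega)).2 hjk
  have hkk : j * l ≤ k := Nat.mul_div_le k j
  have hk2 : k ≤ 2 * (j * l) := by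
    have h1 := Nat.lt_mul_div_succ k (show 0 < j by omega)
    have h2 : j ≤ j * l := Nat.le_mul_of_pos_right j hl1
    rw [← hl] at h1
    nlinarith
  have hj' : (0 : ℝ) < j := by exact_mod_cast hj
  have hl' : (0 : ℝ) < l := by exact_mod_cast hl1
  have hmain := Real.log_le_log (pow_pos hcj l) (hpow j l hj hl1)
  rw [Real.log_mul (by positivity) (check_pos hNpos _).ne', Real.log_pow, Real.log_pow] at hmain
  have hmono := hL.mul_log_le_mul_log hpos h0 (Nat.mul_pos hj hl1) hkk
  set n := j * l with hn
  have hn0 : 0 < n := Nat.mul_pos hj hl1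
  have hn' : (0 : ℝ) < n := by exact_mod_cast hn0
  have hk' : (0 : ℝ) < k := by exact_mod_cast hn0.trans_le hkk
  have hcast : (n : ℝ) = j * l := by rw [hn]; push_cast; ring
  have e1 : Real.log (check N j) * (1 / j) ≤ Real.log H + Real.log (check N n) / n := by
    have : Real.log (check N j) * (1 / j) = l * Real.log (check N j) / n := by
      rw [hcast]; field_simp
    rw [this, add_div' _ _ _ hn'.ne', div_le_div_iff_of_pos_right hn']
    linarith
  have e2 : Real.log (check N n) / n ≤
      Real.log (L n) / n - (κ + 1) * Real.log n + 1 := by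
    rw [hlog, div_le_iff₀ hn']
    have := le_log_factorial n
    have h3 : (Real.log (L n) / n - (κ + 1) * Real.log n + 1) * n =
      Real.log (L n) - (κ + 1) * (n * Real.log n) + n := by field_simp
    rw [h3]; linarith
  have e3 : Real.log (L k) / k - (κ + 1) * Real.log k ≤ Real.log (check N k) * (1 / k) := by
    rw [hlog, mul_one_div, le_div_iff₀ hk']
    have := log_factorial_le k
    have h3 : (Real.log (L k) / k - (κ + 1) * Real.log k) * k =
      Real.log (L k) - (κ + 1) * (k * Real.log k) := by field_simp
    rw [h3]; linarith
  have e4 : Real.log k ≤ Real.log 2 + Real.log n := by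
    rw [← Real.log_mul (by norm_num) hn'.ne']
    exact Real.log_le_log hk' (by exact_mod_cast hk2)
  have e5 := mul_le_mul_of_nonneg_left e4 (by linarith : 0 ≤ κ + 1)
  linarith

/-- For root almost increasing weights, the entries `N_m / m!` up to the index `k` lie below a
geometric sequence `X ^ m` whose entry at `k` exceeds `N_k / k!` by the factor `C ^ k` only. -/
theorem RootAlmostIncreasing.exists_pow {N : ℕ → ℝ} (hpos : ∀ j, 0 < N j) (h0 : N 0 = 1)
    (h : RootAlmostIncreasing N) : ∃ C : ℝ, 1 ≤ C ∧ ∀ k : ℕ, ∃ X : ℝ, 0 < X ∧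
      X ^ k = C ^ k * check N k ∧ ∀ m ≤ k, check N m ≤ X ^ m := by
  obtain ⟨C, hC, h⟩ := h
  refine ⟨max 1 C, le_max_left _ _, fun k => ?_⟩
  have hc0 : check N 0 = 1 := by simp [check, h0]
  rcases Nat.eq_zero_or_pos k with rfl | hk
  · refine ⟨1, one_pos, by simp [hc0], fun m hm => ?_⟩
    obtain rfl : m = 0 := by omega
    simp [hc0]
  have hck := check_pos hpos k
  have hr : 0 < check N k ^ (1 / (k : ℝ)) := Real.rpow_pos_of_pos hck _
  refine ⟨max 1 C * check N k ^ (1 / (k : ℝ)), by positivity, ?_, fun m hm => ?_⟩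
  · rw [mul_pow, one_div, Real.rpow_inv_natCast_pow hck.le hk.ne']
  rcases Nat.eq_zero_or_pos m with rfl | hm0
  · simp [hc0]
  calc check N m = (check N m ^ (1 / (m : ℝ))) ^ m := by
        rw [one_div, Real.rpow_inv_natCast_pow (check_pos hpos m).le hm0.ne']
    _ ≤ _ := by
        refine pow_le_pow_left₀ (Real.rpow_nonneg (check_pos hpos m).le _) ?_ m
        exact (h m k hm0 hm).trans (mul_le_mul_of_nonneg_right (le_max_right _ _) hr.le)

theorem prod_pow_blocksFun {k : ℕ} (c : Composition k) (X : ℝ) :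
    ∏ i, X ^ c.blocksFun i = X ^ k := by
  rw [Finset.prod_pow_eq_pow_sum, c.sum_blocksFun]

/-- Derivation closedness trades the additional factor `N_ℓ / ℓ!` of the Faà di Bruno property for
a lowering of each of the `ℓ` block sizes by one. -/
theorem RootAlmostIncreasing.faaDiBruno {N : ℕ → ℝ} (hpos : ∀ j, 0 < N j) (h0 : N 0 = 1)
    (h : RootAlmostIncreasing N) (hdc : DerivationClosed N) : FaaDiBruno N := by
  obtain ⟨C, hC, hX⟩ := h.exists_pow hpos h0
  obtain ⟨D, hD, hdc⟩ := hdc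
  have hcheck : ∀ j, 1 ≤ j → check N j ≤ D ^ j * check N (j - 1) := by
    intro j hj
    obtain ⟨j, rfl⟩ : ∃ i, j = i + 1 := ⟨j - 1, by omega⟩
    have h1 : (0 : ℝ) < j.factorial := by exact_mod_cast j.factorial_pos
    have h2 : (j.factorial : ℝ) ≤ (j + 1).factorial := by
      exact_mod_cast Nat.factorial_le (Nat.le_succ j)
    have h3 : 0 ≤ D ^ (j + 1) * N j := by have := hpos j; positivity
    calc check N (j + 1) ≤ (D ^ (j + 1) * N j) / (j + 1).factorial :=
          div_le_div_of_nonneg_right (hdc j) (h1.le.trans h2)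
      _ ≤ (D ^ (j + 1) * N j) / j.factorial := div_le_div_of_nonneg_left h3 h1 h2
      _ = _ := by simp [check, mul_div_assoc]
  refine ⟨1, le_rfl, D * C, one_le_mul_of_one_le_of_one_le hD hC, fun k => ?_⟩
  rw [circ, one_mul]
  split_ifs with hk
  · subst hk; simp [check, h0]
  obtain ⟨X, hX0, hXk, hXm⟩ := hX k
  have : Nonempty (Composition k) := ⟨Composition.ones k⟩
  refine ciSup_le fun c => ?_
  have hprod : ∏ i, check N (c.blocksFun i) ≤
      ∏ i, (D ^ c.blocksFun i * X ^ (c.blocksFun i - 1)) := by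
    refine Finset.prod_le_prod (fun i _ => (check_pos hpos _).le) fun i _ => ?_
    have h1 := c.one_le_blocksFun i
    refine (hcheck _ h1).trans (mul_le_mul_of_nonneg_left (hXm _ ?_) (by positivity))
    exact (Nat.sub_le _ _).trans (c.blocksFun_le i)
  have hXX : X ^ c.length * ∏ i, X ^ (c.blocksFun i - 1) = X ^ k := by
    rw [← prod_pow_blocksFun c X, ← Fin.prod_const, ← Finset.prod_mul_distrib]
    refine Finset.prod_congr rfl fun i _ => ?_
    rw [← pow_succ', Nat.sub_add_cancel (c.one_le_blocksFun i)]
  calc check N c.length * ∏ i, check N (c.blocksFun i)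
      ≤ X ^ c.length * ∏ i, (D ^ c.blocksFun i * X ^ (c.blocksFun i - 1)) :=
        mul_le_mul (hXm _ c.length_le) hprod
          (Finset.prod_nonneg fun i _ => (check_pos hpos _).le) (by positivity)
    _ = D ^ k * (X ^ c.length * ∏ i, X ^ (c.blocksFun i - 1)) := by
        rw [Finset.prod_mul_distrib, prod_pow_blocksFun]; ring
    _ = _ := by rw [hXX, hXk, mul_pow]; ring

/-- The composition of `j * l` into `l` blocks of size `j`. -/
def replicateComposition (j l : ℕ) (hj : 0 < j) : Composition (j * l) where
  blocks := List.replicate l j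
  blocks_pos := fun {i} hi => by rw [List.eq_of_mem_replicate hi]; exact hj
  blocks_sum := by simp [mul_comm]

/-- The Faà di Bruno property is tested on the composition of `j * l` into `l` equal blocks; the
lower bound removes the factor `N_l / l!`. -/
theorem FaaDiBruno.pow_le {N : ℕ → ℝ} (hpos : ∀ j, 0 < N j) (h : FaaDiBruno N) {c₀ c : ℝ}
    (hc₀ : 0 < c₀) (hc : 0 < c) (hlow : ∀ j, c₀ * c ^ j ≤ check N j) :
    ∃ H : ℝ, 0 < H ∧
      ∀ j l : ℕ, 1 ≤ j → 1 ≤ l → check N j ^ l ≤ H ^ (j * l) * check N (j * l) := by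
  obtain ⟨C, hC, h, hh, hF⟩ := h
  refine ⟨max 1 (C / c₀) * max 1 c⁻¹ * h, by positivity, fun j l hj hl => ?_⟩
  have hk : j * l ≠ 0 := (Nat.mul_pos hj hl).ne'
  have hF := hF (j * l)
  rw [circ, if_neg hk] at hF
  have hle := (le_ciSup (Set.finite_range fun c : Composition (j * l) =>
    check N c.length * ∏ i, check N (c.blocksFun i)).bddAbove
    (replicateComposition j l hj)).trans hF
  have hlen : (replicateComposition j l hj).length = l := by
    simp [Composition.length, replicateComposition]
  have hbl : ∀ i, (replicateComposition j l hj).blocksFun i = j := by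
    intro i
    exact List.eq_of_mem_replicate (List.get_mem (List.replicate l j) i)
  simp only [hbl, Finset.prod_const, Finset.card_univ, Fintype.card_fin] at hle
  rw [hlen] at hle
  have hcl : 0 < c₀ * c ^ l := by positivity
  have h1 : c₀ * c ^ l * check N j ^ l ≤ C * h ^ (j * l) * check N (j * l) :=
    (mul_le_mul_of_nonneg_right (hlow l) (pow_nonneg (check_pos hpos j).le l)).trans hle
  have h2 : check N j ^ l ≤ C / c₀ * (c⁻¹) ^ l * h ^ (j * l) * check N (j * l) := by
    have : C / c₀ * (c⁻¹) ^ l * h ^ (j * l) * check N (j * l) =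
        (C * h ^ (j * l) * check N (j * l)) / (c₀ * c ^ l) := by
      rw [inv_pow]; field_simp
    rw [this, le_div_iff₀ hcl]; linarith
  refine h2.trans (mul_le_mul_of_nonneg_right ?_ (check_pos hpos _).le)
  rw [mul_pow, mul_pow]
  refine mul_le_mul_of_nonneg_right (mul_le_mul ?_ ?_ (by positivity) (by positivity))
    (by positivity)
  · exact (le_max_right 1 _).trans (le_self_pow₀ (le_max_left _ _) hk)
  · calc c⁻¹ ^ l ≤ max 1 c⁻¹ ^ l := pow_le_pow_left₀ (by positivity) (le_max_right _ _) l
      _ ≤ _ := pow_le_pow_right₀ (le_max_left _ _) (Nat.le_mul_of_pos_left l hj)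

/-! ### The regularized sequence -/

section Regularized

variable {M : ℕ → ℝ} {α : ℝ}

theorem gevrey_mul_pos (hpos : ∀ j, 0 < M j) (j : ℕ) : 0 < gevrey (1 - α) j * M j :=
  mul_pos (gevrey_pos _ _) (hpos j)

theorem regularized_pos (hpos : ∀ j, 0 < M j)
    (hlim : RootsTendToInfinity (fun j => gevrey (1 - α) j * M j)) (j : ℕ) :
    0 < regularized α M j :=
  mul_pos (gevrey_pos _ _) (lcMinorant_pos (gevrey_mul_pos hpos) hlim j)

theorem regularized_zero (hpos : ∀ j, 0 < M j) (hM0 : M 0 = 1)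
    (hlim : RootsTendToInfinity (fun j => gevrey (1 - α) j * M j)) : regularized α M 0 = 1 := by
  rw [regularized, lcMinorant_zero (gevrey_mul_pos hpos) hlim]
  simp [hM0]

theorem regularized_le (hpos : ∀ j, 0 < M j)
    (hlim : RootsTendToInfinity (fun j => gevrey (1 - α) j * M j)) (j : ℕ) :
    regularized α M j ≤ M j := by
  calc regularized α M j ≤ gevrey (α - 1) j * (gevrey (1 - α) j * M j) :=
        mul_le_mul_of_nonneg_left (lcMinorant_le (gevrey_mul_pos hpos) hlim j) (gevrey_pos _ _).le
    _ = (gevrey (-(1 - α)) j * gevrey (1 - α) j) * M j := by rw [neg_sub]; ring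
    _ = M j := by rw [gevrey_neg_mul, one_mul]

theorem logConvex_gevrey {a : ℝ} (ha : 0 ≤ a) : LogConvex (gevrey a) := by
  intro j
  have hp := gevrey_pos a
  rw [← Real.log_le_log_iff (pow_pos (hp _) 2) (mul_pos (hp _) (hp _)), Real.log_pow,
    Real.log_mul (hp _).ne' (hp _).ne', log_gevrey, log_gevrey, log_gevrey]
  have hconv := Real.convexOn_mul_log.2 (x := (j : ℝ)) (y := ((j + 2 : ℕ) : ℝ))
    (Set.mem_Ici.2 (by positivity)) (Set.mem_Ici.2 (by positivity))
    (by norm_num : (0 : ℝ) ≤ 1 / 2) (by norm_num : (0 : ℝ) ≤ 1 / 2) (by norm_num)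
  simp only [smul_eq_mul] at hconv
  rw [show 1 / 2 * (j : ℝ) + 1 / 2 * ((j + 2 : ℕ) : ℝ) = ((j + 1 : ℕ) : ℝ) by push_cast; ring]
    at hconv
  have := mul_le_mul_of_nonneg_left hconv ha
  push_cast at this ⊢
  linarith

theorem PositiveCheckLiminf.exists_le (hpos : ∀ j, 0 < M j) (h : PositiveCheckLiminf M) :
    ∃ c₀ c : ℝ, 0 < c₀ ∧ 0 < c ∧ ∀ j, c₀ * c ^ j ≤ check M j := by
  obtain ⟨r, hr0, hr⟩ := EReal.lt_iff_exists_real_btwn.1 h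
  have hr0 : 0 < r := by exact_mod_cast hr0
  have hev := eventually_lt_of_lt_liminf hr
  obtain ⟨J, hJ⟩ := eventually_atTop.1 hev
  obtain ⟨i, -, hi⟩ := Finset.exists_min_image (Finset.range (J + 1))
    (fun j => check M j / r ^ j) ⟨0, by simp⟩
  have hpi : 0 < check M i / r ^ i := div_pos (check_pos hpos i) (by positivity)
  refine ⟨min 1 (check M i / r ^ i), r, lt_min one_pos hpi, hr0, fun j => ?_⟩
  rcases le_or_gt j J with hj | hj
  · have := (min_le_right 1 _).trans (hi j (by simp; omega))
    rwa [le_div_iff₀ (by positivity)] at this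
  · have h1 : r < check M j ^ (1 / (j : ℝ)) := by exact_mod_cast hJ j hj.le
    have h2 := pow_le_pow_left₀ hr0.le h1.le j
    rw [one_div, Real.rpow_inv_natCast_pow (check_pos hpos j).le (by omega)] at h2
    calc min 1 (check M i / r ^ i) * r ^ j ≤ 1 * r ^ j :=
          mul_le_mul_of_nonneg_right (min_le_left _ _) (by positivity)
      _ ≤ _ := by rwa [one_mul]

/-- A lower bound `c₀ c ^ j j!` of `M` passes to the regularized sequence, because
`c₀ c ^ j j! j ^ ((1 - α) j)` is log-convex. -/
theorem le_check_regularized (hpos : ∀ j, 0 < M j) (hα1 : α ≤ 1)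
    (hlim : RootsTendToInfinity (fun j => gevrey (1 - α) j * M j)) {c₀ c : ℝ} (hc₀ : 0 < c₀)
    (hc : 0 < c) (hlow : ∀ j, c₀ * c ^ j ≤ check M j) (j : ℕ) :
    c₀ * c ^ j ≤ check (regularized α M) j := by
  have hf : ∀ n : ℕ, (0 : ℝ) < n.factorial := fun n => by exact_mod_cast n.factorial_pos
  have hmem : (fun n : ℕ => c₀ * c ^ n * n.factorial * gevrey (1 - α) n) ∈
      logConvexBelow (fun j => gevrey (1 - α) j * M j) := by
    refine ⟨fun n => mul_pos (mul_pos (by positivity) (hf n)) (gevrey_pos _ _), fun n => ?_,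
      fun n => ?_⟩
    · have h1 : ((n + 1).factorial : ℝ) ^ 2 ≤ n.factorial * (n + 2).factorial := by
        rw [Nat.factorial_succ (n + 1), Nat.factorial_succ n]
        push_cast
        have := hf n
        have : (0 : ℝ) ≤ (n.factorial : ℝ) ^ 2 := by positivity
        nlinarith
      have h2 := logConvex_gevrey (sub_nonneg.2 hα1) n
      calc (c₀ * c ^ (n + 1) * (n + 1).factorial * gevrey (1 - α) (n + 1)) ^ 2
          = (c₀ ^ 2 * (c ^ (n + 1)) ^ 2) *
              (((n + 1).factorial : ℝ) ^ 2 * gevrey (1 - α) (n + 1) ^ 2) := by ring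
        _ ≤ (c₀ ^ 2 * (c ^ (n + 1)) ^ 2) * ((n.factorial * (n + 2).factorial) *
              (gevrey (1 - α) n * gevrey (1 - α) (n + 2))) := by
            refine mul_le_mul_of_nonneg_left (mul_le_mul h1 h2 (by positivity) ?_) (by positivity)
            exact mul_nonneg (hf _).le (hf _).le
        _ = _ := by ring
    · have := hlow n
      rw [check, le_div_iff₀ (hf n)] at this
      have := mul_le_mul_of_nonneg_right this (gevrey_pos (1 - α) n).le
      simpa [mul_comm] using this
  have hle := le_lcMinorant (gevrey_mul_pos hpos) hlim hmem j
  rw [check, le_div_iff₀ (hf j), regularized]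
  calc c₀ * c ^ j * j.factorial
      = (gevrey (-(1 - α)) j * gevrey (1 - α) j) * (c₀ * c ^ j * j.factorial) := by
        rw [gevrey_neg_mul, one_mul]
    _ = gevrey (α - 1) j * (c₀ * c ^ j * j.factorial * gevrey (1 - α) j) := by rw [neg_sub]; ring
    _ ≤ _ := mul_le_mul_of_nonneg_left hle (gevrey_pos _ _).le

end Regularized

/-! ### Polynomials bounded outside a cone -/

open Complex in
theorem re_mul_exp (w : ℂ) (θ : ℝ) :
    (w * exp (θ * I)).re = ‖w‖ * Real.cos (w.arg + θ) := by
  conv_lhs => rw [← norm_mul_exp_arg_mul_I w]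
  rw [mul_assoc, ← Complex.exp_add, ← add_mul, ← ofReal_add, re_ofReal_mul, exp_ofReal_mul_I_re]

open Complex in
theorem re_cpow_mul_exp (v : ℂ) (κ θ : ℝ) :
    (v ^ (κ : ℂ) * exp (θ * I)).re = ‖v‖ ^ κ * Real.cos (κ * v.arg + θ) := by
  have h : v ^ (κ : ℂ) = ((‖v‖ ^ κ : ℝ) : ℂ) * exp ((κ * v.arg : ℝ) * I) := by
    rw [cpow_ofReal, exp_mul_I, mul_comm κ]; push_cast; ring
  rw [h, mul_assoc, ← Complex.exp_add, ← add_mul, ← ofReal_add, re_ofReal_mul,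
    exp_ofReal_mul_I_re]

theorem iteratedDeriv_polynomial_eval (P : Polynomial ℂ) (n : ℕ) :
    iteratedDeriv n (fun u => P.eval u) = fun u => (Polynomial.derivative^[n] P).eval u := by
  induction n with
  | zero => simp
  | succ n ih =>
    rw [iteratedDeriv_succ, ih]
    funext u
    rw [Polynomial.deriv, Function.iterate_succ_apply']

/-- Cauchy's estimate for the coefficients of a polynomial. -/
theorem norm_coeff_le_div_pow (P : Polynomial ℂ) {R C : ℝ} (hR : 0 < R)
    (h : ∀ u : ℂ, ‖u‖ = R → ‖P.eval u‖ ≤ C) (i : ℕ) : ‖P.coeff i‖ ≤ C / R ^ i := by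
  have h1 := Complex.norm_iteratedDeriv_le_of_forall_mem_sphere_norm_le (c := 0) (R := R) (C := C)
    (f := fun u => P.eval u) i hR (P.differentiable.diffContOnCl)
    (fun z hz => h z (by simpa using hz))
  rw [iteratedDeriv_polynomial_eval] at h1
  simp only [← Polynomial.coeff_zero_eq_eval_zero, Polynomial.coeff_iterate_derivative, zero_add,
    Nat.descFactorial_self, nsmul_eq_mul, norm_mul, Complex.norm_natCast] at h1
  have hf : (0 : ℝ) < i.factorial := by exact_mod_cast i.factorial_pos
  rw [mul_div_assoc] at h1
  exact le_of_mul_le_mul_left h1 hf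

/-- A polynomial bounded on the lateral boundary of a convex cone of opening `κ π` with vertex
near the origin grows at most like `exp (‖v‖)`, `v = w ^ (1 / κ)`, at the point `w` of the cone.
The cone is opened up to the right half-plane by `w = v ^ κ`, the vertex being at `cos (κ π / 2)`;
the factor `(1 + v / m) ^ m` absorbs the degree of the polynomial and is at most `exp ‖v‖`, so
that the principle of Phragmén and Lindelöf applies to the quotient. -/
theorem norm_eval_sub_cpow_le {κ : ℝ} (hκ0 : 0 < κ) (hκ1 : κ < 1) {m : ℕ} (hm : 1 ≤ m)
    (P : Polynomial ℂ) (hdeg : P.natDegree < m)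
    (hP : ∀ u : ℂ, ∀ θ : ℝ, |θ| ≤ (1 - κ) * Real.pi / 2 →
      0 < (u * Complex.exp (θ * Complex.I)).re →
      ‖P.eval u‖ ≤ ‖u‖ / (u * Complex.exp (θ * Complex.I)).re *
        (1 + (‖u‖ / (m : ℝ) ^ κ) ^ m)) {v : ℂ} (hv : 0 ≤ v.re) :
    ‖P.eval (Real.cos (κ * Real.pi / 2) - v ^ (κ : ℂ))‖ ≤
      2 / (Real.cos (κ * Real.pi / 2) * Real.cos ((1 - κ) * Real.pi / 2)) *
        ((1 + ‖v‖) * Real.exp ‖v‖) := by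
  have hπ := Real.pi_pos
  set d := Real.cos (κ * Real.pi / 2) with hd
  set e := Real.cos ((1 - κ) * Real.pi / 2) with he
  have hd0 : 0 < d := Real.cos_pos_of_mem_Ioo ⟨by nlinarith, by nlinarith⟩
  have hd1 : d ≤ 1 := Real.cos_le_one _
  have he0 : 0 < e := Real.cos_pos_of_mem_Ioo ⟨by nlinarith, by nlinarith⟩
  have hm' : (1 : ℝ) ≤ m := by exact_mod_cast hm
  have hm0 : (0 : ℝ) < m := by linarith
  have hmκ : 1 ≤ (m : ℝ) ^ κ := Real.one_le_rpow hm' hκ0.le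
  -- the denominators are bounded below on the closed right half-plane
  have hden1 : ∀ z : ℂ, 0 ≤ z.re → max 1 ‖z‖ ≤ ‖1 + z‖ := by
    intro z hz
    refine max_le ?_ ?_
    · refine le_trans ?_ (Complex.re_le_norm _)
      simp [hz]
    · rw [Complex.norm_def, Complex.norm_def]
      refine Real.sqrt_le_sqrt ?_
      simp only [Complex.normSq_apply, Complex.add_re, Complex.one_re, Complex.add_im,
        Complex.one_im]
      nlinarith
  have hdivre : ∀ z : ℂ, 0 ≤ z.re → 0 ≤ (z / m).re := by
    intro z hz
    rw [Complex.div_natCast_re]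
    positivity
  have hden2 : ∀ z : ℂ, 0 ≤ z.re → max 1 (‖z‖ / m) ≤ ‖1 + z / m‖ := by
    intro z hz
    have := hden1 (z / m) (hdivre z hz)
    rwa [norm_div, Complex.norm_natCast] at this
  have hne1 : ∀ z : ℂ, 0 ≤ z.re → 1 + z ≠ 0 := fun z hz h => by
    have := (le_max_left _ _).trans (hden1 z hz); rw [h, norm_zero] at this; linarith
  set F : ℂ → ℂ := fun v => P.eval (d - v ^ (κ : ℂ)) / ((1 + v) * (1 + v / m) ^ m) with hF
  have hdc : DiffContOnCl ℂ F {z | 0 < z.re} := by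
    have hnz : ∀ z : ℂ, 0 ≤ z.re → (1 + z) * (1 + z / m) ^ m ≠ 0 := fun z hz =>
      mul_ne_zero (hne1 z hz) (pow_ne_zero _ (hne1 _ (hdivre z hz)))
    refine ⟨fun z hz => ?_, ?_⟩
    · refine DifferentiableAt.differentiableWithinAt ?_
      refine DifferentiableAt.div ?_ (by fun_prop) (hnz z (le_of_lt hz))
      refine (P.differentiable _).comp z ?_
      refine DifferentiableAt.const_sub ?_ _
      exact differentiableAt_id.cpow_const (Or.inl hz)
    · rw [Complex.closure_setOfPred_lt_re]
      intro z hz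
      refine ContinuousAt.continuousWithinAt ?_
      refine ContinuousAt.div ?_ (by fun_prop) (hnz z hz)
      refine P.continuous.continuousAt.comp (f := fun v : ℂ => (d : ℂ) - v ^ (κ : ℂ)) ?_
      exact continuousAt_const.sub
        (Complex.continuousAt_cpow_const_of_re_pos (Or.inl hz) (by simpa using hκ0))
  -- the quotient is bounded on the half-plane, with a bound depending on the polynomial
  obtain ⟨K, hK⟩ : ∃ K : ℝ, ∀ z : ℂ, 0 ≤ z.re → ‖F z‖ ≤ K := by
    refine ⟨(∑ i ∈ Finset.range m, ‖P.coeff i‖) * (2 * m) ^ m, fun z hz => ?_⟩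
    set X := max 1 ‖z‖ with hX
    have hX1 : 1 ≤ X := le_max_left _ _
    have hu : ‖(d : ℂ) - z ^ (κ : ℂ)‖ ≤ 2 * X := by
      refine (norm_sub_le _ _).trans ?_
      rw [Complex.norm_cpow_real, Complex.norm_real, Real.norm_of_nonneg hd0.le]
      have : ‖z‖ ^ κ ≤ X := by
        refine (Real.rpow_le_rpow (norm_nonneg _) (le_max_right 1 ‖z‖) hκ0.le).trans ?_
        exact Real.rpow_le_self_of_one_le hX1 hκ1.le
      linarith
    have hnum : ‖P.eval (d - z ^ (κ : ℂ))‖ ≤ (∑ i ∈ Finset.range m, ‖P.coeff i‖) * (2 * X) ^ m := by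
      rw [Polynomial.eval_eq_sum_range' hdeg, Finset.sum_mul]
      refine (norm_sum_le _ _).trans (Finset.sum_le_sum fun i hi => ?_)
      rw [norm_mul, norm_pow]
      refine mul_le_mul_of_nonneg_left ?_ (norm_nonneg _)
      refine (pow_le_pow_left₀ (norm_nonneg _) hu i).trans ?_
      exact pow_le_pow_right₀ (by linarith) (Finset.mem_range.1 hi).le
    have hden : (X / m) ^ m ≤ ‖(1 + z) * (1 + z / m) ^ m‖ := by
      rw [norm_mul, norm_pow]
      have h1 : X / m ≤ ‖1 + z / m‖ := by
        refine le_trans ?_ (hden2 z hz)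
        rw [div_le_iff₀ hm0]
        refine max_le ?_ ?_
        · exact hm'.trans (le_mul_of_one_le_left hm0.le (le_max_left _ _))
        · rw [← div_le_iff₀ hm0]; exact le_max_right _ _
      calc (X / m) ^ m ≤ ‖1 + z / m‖ ^ m := pow_le_pow_left₀ (by positivity) h1 m
        _ ≤ _ := le_mul_of_one_le_left (by positivity) ((le_max_left _ _).trans (hden1 z hz))
    rw [hF]
    simp only
    rw [norm_div, div_le_iff₀ (lt_of_lt_of_le (by positivity) hden)]
    refine hnum.trans ?_
    have hS : 0 ≤ ∑ i ∈ Finset.range m, ‖P.coeff i‖ := Finset.sum_nonneg fun i _ => norm_nonneg _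
    calc _ = (∑ i ∈ Finset.range m, ‖P.coeff i‖) * (2 * m) ^ m * (X / m) ^ m := by
          rw [mul_assoc, ← mul_pow]; congr 2; field_simp
      _ ≤ _ := mul_le_mul_of_nonneg_left hden (by positivity)
  -- on the imaginary axis `u = d - z ^ κ` lies on the lateral boundary of the cone, and for the
  -- extreme direction `θ` on the same side the real part of `u * exp (i θ)` is constant
  have him : ∀ y : ℝ, ‖F (y * Complex.I)‖ ≤ 2 / (d * e) := by
    intro y
    have hre : 0 ≤ ((y : ℂ) * Complex.I).re := by simp
    set z : ℂ := y * Complex.I with hz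
    set s := ‖z‖ ^ κ with hs
    have hs0 : 0 ≤ s := by positivity
    set u : ℂ := d - z ^ (κ : ℂ) with hu
    obtain ⟨θ, hθ, hre_u, hreθ⟩ : ∃ θ : ℝ, |θ| ≤ (1 - κ) * Real.pi / 2 ∧
        (u * Complex.exp (θ * Complex.I)).re = d * e ∧ (z ^ (κ : ℂ)).re = s * d := by
      have habs : |(1 - κ) * Real.pi / 2| = (1 - κ) * Real.pi / 2 :=
        abs_of_nonneg (by nlinarith)
      have hgen : ∀ θ : ℝ, (u * Complex.exp (θ * Complex.I)).re =
          d * Real.cos θ - s * Real.cos (κ * z.arg + θ) := by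
        intro θ
        rw [hu, sub_mul, Complex.sub_re, re_cpow_mul_exp, Complex.re_ofReal_mul,
          Complex.exp_ofReal_mul_I_re]
      have hre0 : (z ^ (κ : ℂ)).re = s * Real.cos (κ * z.arg) := by
        have := re_cpow_mul_exp z κ 0
        simpa using this
      rcases lt_trichotomy y 0 with hy | hy | hy
      · have harg : z.arg = -(Real.pi / 2) := by
          rw [Complex.arg_eq_neg_pi_div_two_iff]; simp [hz, hy]
        refine ⟨-((1 - κ) * Real.pi / 2), by rw [abs_neg, habs], ?_, ?_⟩
        · rw [hgen, harg, Real.cos_neg, ← he,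
            show κ * -(Real.pi / 2) + -((1 - κ) * Real.pi / 2) = -(Real.pi / 2) by ring]
          simp
        · rw [hre0, harg, show κ * -(Real.pi / 2) = -(κ * Real.pi / 2) by ring, Real.cos_neg]
      · have hs' : s = 0 := by rw [hs, hz, hy]; simp [Real.zero_rpow hκ0.ne']
        refine ⟨(1 - κ) * Real.pi / 2, habs.le, ?_, ?_⟩
        · rw [hgen, hs', ← he]; ring
        · rw [hre0, hs']; ring
      · have harg : z.arg = Real.pi / 2 := by
          rw [Complex.arg_eq_pi_div_two_iff]; simp [hz, hy]
        refine ⟨(1 - κ) * Real.pi / 2, habs.le, ?_, ?_⟩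
        · rw [hgen, harg, ← he,
            show κ * (Real.pi / 2) + (1 - κ) * Real.pi / 2 = Real.pi / 2 by ring]
          simp
        · rw [hre0, harg, show κ * (Real.pi / 2) = κ * Real.pi / 2 by ring]
    have hunorm : ‖u‖ ≤ max 1 s := by
      have h1 : ‖u‖ ^ 2 = d ^ 2 - 2 * d * (s * d) + s ^ 2 := by
        have h2 : ‖z ^ (κ : ℂ)‖ ^ 2 = s ^ 2 := by rw [Complex.norm_cpow_real]
        rw [← Complex.normSq_eq_norm_sq, Complex.normSq_apply] at h2 ⊢
        rw [hu, Complex.sub_re, Complex.sub_im, Complex.ofReal_re, Complex.ofReal_im, hreθ]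
        rw [hreθ] at h2
        linarith
      have hdd : d ^ 2 ≤ 1 := by nlinarith
      have hsq : ‖u‖ ^ 2 ≤ max 1 s ^ 2 := by
        rw [h1]
        rcases le_total (1 / 2) s with h | h
        · calc d ^ 2 - 2 * d * (s * d) + s ^ 2 ≤ s ^ 2 := by nlinarith [sq_nonneg d]
            _ ≤ _ := pow_le_pow_left₀ hs0 (le_max_right _ _) 2
        · calc d ^ 2 - 2 * d * (s * d) + s ^ 2 ≤ 1 ^ 2 := by nlinarith [sq_nonneg d]
            _ ≤ _ := pow_le_pow_left₀ zero_le_one (le_max_left _ _) 2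
      exact le_of_sq_le_sq hsq (by positivity)
    have hden : max 1 s * max 1 (s / (m : ℝ) ^ κ) ^ m ≤ ‖(1 + z) * (1 + z / m) ^ m‖ := by
      have hrp : ∀ t : ℝ, 0 ≤ t → max 1 (t ^ κ) ≤ max 1 t := by
        intro t ht
        rcases le_total t 1 with h | h
        · rw [max_eq_left (Real.rpow_le_one ht h hκ0.le)]; exact le_max_left _ _
        · exact max_le_max le_rfl (Real.rpow_le_self_of_one_le h hκ1.le)
      rw [norm_mul, norm_pow]
      refine mul_le_mul ((hrp _ (norm_nonneg _)).trans (hden1 z hre)) ?_ (by positivity)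
        (norm_nonneg _)
      refine pow_le_pow_left₀ (by positivity) ?_ m
      rw [hs, ← Real.div_rpow (norm_nonneg _) hm0.le]
      exact (hrp _ (by positivity)).trans (hden2 z hre)
    have hnum : ‖P.eval u‖ ≤ 2 / (d * e) * (max 1 s * max 1 (s / (m : ℝ) ^ κ) ^ m) := by
      have h1 := hP u θ hθ (by rw [hre_u]; positivity)
      rw [hre_u] at h1
      have h2 : ‖u‖ / (m : ℝ) ^ κ ≤ max 1 (s / (m : ℝ) ^ κ) := by
        rw [div_le_iff₀ (by linarith)]
        refine hunorm.trans (max_le ?_ ?_)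
        · exact hmκ.trans (le_mul_of_one_le_left (by linarith) (le_max_left _ _))
        · rw [← div_le_iff₀ (by linarith)]; exact le_max_right _ _
      have h3 : (‖u‖ / (m : ℝ) ^ κ) ^ m ≤ max 1 (s / (m : ℝ) ^ κ) ^ m :=
        pow_le_pow_left₀ (by positivity) h2 m
      have h4 : (1 : ℝ) ≤ max 1 (s / (m : ℝ) ^ κ) ^ m := one_le_pow₀ (le_max_left _ _)
      calc ‖P.eval u‖ ≤ ‖u‖ / (d * e) * (1 + (‖u‖ / (m : ℝ) ^ κ) ^ m) := h1
        _ ≤ max 1 s / (d * e) * (2 * max 1 (s / (m : ℝ) ^ κ) ^ m) := by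
            refine mul_le_mul ?_ (by linarith) (by positivity) (by positivity)
            exact div_le_div_of_nonneg_right hunorm (by positivity)
        _ = _ := by ring
    rw [hF]
    simp only
    rw [norm_div, div_le_iff₀ (lt_of_lt_of_le (by positivity) hden)]
    exact hnum.trans (mul_le_mul_of_nonneg_left hden (by positivity))
  have hPL := PhragmenLindelof.right_half_plane_of_bounded_on_real hdc
    ⟨1, by norm_num, 0, by
      refine Asymptotics.IsBigO.of_bound K ?_
      refine eventually_inf_principal.2 (Eventually.of_forall fun z hz => ?_)
      simpa using hK z (le_of_lt hz)⟩
    ⟨K, by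
      rw [eventually_map]
      filter_upwards [eventually_ge_atTop (0 : ℝ)] with x hx
      exact hK x (by simpa using hx)⟩ him hv
  rw [hF] at hPL
  simp only at hPL
  have hpos : 0 < ‖(1 + v) * (1 + v / m) ^ m‖ := by
    rw [norm_mul, norm_pow]
    exact mul_pos (norm_pos_iff.2 (hne1 v hv))
      (pow_pos (norm_pos_iff.2 (hne1 _ (hdivre v hv))) m)
  rw [norm_div, div_le_iff₀ hpos] at hPL
  refine hPL.trans (mul_le_mul_of_nonneg_left ?_ (by positivity))
  rw [norm_mul, norm_pow]
  refine mul_le_mul ((norm_add_le _ _).trans (by simp)) ?_ (by positivity) (by positivity)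
  calc ‖1 + v / m‖ ^ m ≤ (1 + ‖v‖ / m) ^ m := by
        refine pow_le_pow_left₀ (norm_nonneg _) ((norm_add_le _ _).trans ?_) m
        simp
    _ ≤ Real.exp ‖v‖ := by
        have h1 : 1 + ‖v‖ / m ≤ Real.exp (‖v‖ / m) := by
          linarith [Real.add_one_le_exp (‖v‖ / m)]
        calc (1 + ‖v‖ / m) ^ m ≤ Real.exp (‖v‖ / m) ^ m := pow_le_pow_left₀ (by positivity) h1 m
          _ = _ := by rw [← Real.exp_nat_mul]; congr 1; field_simp

/-- Coefficient bounds in the half-plane case: multiplication by `1 + u` cancels the singularity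
of the bound at the point `-1` of the unit circle. -/
theorem norm_coeff_le_of_zero {m : ℕ} (P : Polynomial ℂ)
    (hP : ∀ u : ℂ, ∀ θ : ℝ, |θ| ≤ Real.pi / 2 → 0 < (u * Complex.exp (θ * Complex.I)).re →
      ‖P.eval u‖ ≤ ‖u‖ / (u * Complex.exp (θ * Complex.I)).re * (1 + ‖u‖ ^ m)) (i : ℕ) :
    ‖P.coeff i‖ ≤ 8 * (i + 1) := by
  have hπ := Real.pi_pos
  have hQ : ∀ u : ℂ, ‖u‖ = 1 → ‖((1 + Polynomial.X) * P).eval u‖ ≤ 8 := by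
    intro u hu
    have hP' : ∀ θ : ℝ, |θ| ≤ Real.pi / 2 → 0 < (u * Complex.exp (θ * Complex.I)).re →
        ‖P.eval u‖ * (u * Complex.exp (θ * Complex.I)).re ≤ 2 := by
      intro θ hθ hre
      have := hP u θ hθ hre
      rw [hu, one_pow, div_mul_eq_mul_div, le_div_iff₀ hre] at this
      linarith
    have hsq : u.re ^ 2 + u.im ^ 2 = 1 := by
      have := Complex.normSq_eq_norm_sq u
      rw [hu, Complex.normSq_apply] at this
      linarith
    have h1 : ‖1 + u‖ ^ 2 = 2 + 2 * u.re := by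
      rw [← Complex.normSq_eq_norm_sq, Complex.normSq_apply]
      simp only [Complex.add_re, Complex.one_re, Complex.add_im, Complex.one_im]
      linarith
    rw [Polynomial.eval_mul, norm_mul]
    simp only [Polynomial.eval_add, Polynomial.eval_one, Polynomial.eval_X]
    have hn := norm_nonneg (P.eval u)
    rcases le_or_gt (1 / 2) u.re with hre | hre
    · have h2 := hP' 0 (by rw [abs_zero]; positivity) (by simp; linarith)
      simp only [Complex.ofReal_zero, zero_mul, Complex.exp_zero, mul_one] at h2
      have h3 : ‖1 + u‖ ≤ 2 := by
        refine (norm_add_le _ _).trans ?_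
        rw [hu, norm_one]; norm_num
      have h4 : ‖P.eval u‖ ≤ 4 := by nlinarith
      have := mul_le_mul h3 h4 hn (by norm_num)
      linarith
    · have h3 : ‖1 + u‖ ≤ 2 * |u.im| := by
        refine le_of_sq_le_sq ?_ (by positivity)
        rw [h1, mul_pow, sq_abs]
        nlinarith
      have h4 : ‖P.eval u‖ * |u.im| ≤ 2 := by
        rcases lt_trichotomy u.im 0 with him | him | him
        · have hval : (u * Complex.exp ((Real.pi / 2 : ℝ) * Complex.I)).re = -u.im := by
            rw [Complex.ofReal_div, Complex.ofReal_ofNat, Complex.exp_pi_div_two_mul_I]; simp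
          have h5 := hP' (Real.pi / 2) (abs_of_pos (by positivity)).le (by rw [hval]; linarith)
          rwa [hval, ← abs_of_neg him] at h5
        · rw [him]; simp
        · have hval : (u * Complex.exp ((-(Real.pi / 2) : ℝ) * Complex.I)).re = u.im := by
            rw [Complex.ofReal_neg, neg_mul, Complex.exp_neg, Complex.ofReal_div,
              Complex.ofReal_ofNat, Complex.exp_pi_div_two_mul_I]; simp
          have h5 := hP' (-(Real.pi / 2)) (by rw [abs_neg, abs_of_pos (by positivity)])
            (by rw [hval]; exact him)
          rwa [hval, ← abs_of_pos him] at h5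
      calc ‖1 + u‖ * ‖P.eval u‖ ≤ 2 * |u.im| * ‖P.eval u‖ := mul_le_mul_of_nonneg_right h3 hn
        _ ≤ 8 := by linarith
  have hQc : ∀ n, ‖((1 + Polynomial.X) * P).coeff n‖ ≤ 8 := fun n => by
    simpa using norm_coeff_le_div_pow _ one_pos hQ n
  induction i with
  | zero =>
    have := hQc 0
    simpa [add_mul] using this
  | succ n ih =>
    have h1 := hQc (n + 1)
    rw [add_mul, one_mul, Polynomial.coeff_add, Polynomial.coeff_X_mul] at h1
    have h2 := norm_sub_le (P.coeff (n + 1) + P.coeff n) (P.coeff n)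
    rw [add_sub_cancel_right] at h2
    push_cast
    linarith

/-- Cauchy's estimate for the `i`-th coefficient on the circle of radius `i ^ κ`, on which the
polynomial is at most exponentially large in `i`. -/
theorem norm_coeff_le_of_pos {κ : ℝ} (hκ0 : 0 < κ) (hκ1 : κ < 1) : ∃ B : ℝ, 1 ≤ B ∧
    ∀ m : ℕ, 1 ≤ m → ∀ P : Polynomial ℂ, P.natDegree < m →
    (∀ u : ℂ, ∀ θ : ℝ, |θ| ≤ (1 - κ) * Real.pi / 2 →
      0 < (u * Complex.exp (θ * Complex.I)).re →
      ‖P.eval u‖ ≤ ‖u‖ / (u * Complex.exp (θ * Complex.I)).re *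
        (1 + (‖u‖ / (m : ℝ) ^ κ) ^ m)) →
    ∀ i : ℕ, 1 ≤ i → i < m → ‖P.coeff i‖ ≤ B ^ i / ((i : ℝ) ^ κ) ^ i := by
  have hπ := Real.pi_pos
  set d := Real.cos (κ * Real.pi / 2) with hd
  set e := Real.cos ((1 - κ) * Real.pi / 2) with he
  have hd0 : 0 < d := Real.cos_pos_of_mem_Ioo ⟨by nlinarith, by nlinarith⟩
  have hd1 : d ≤ 1 := Real.cos_le_one _
  have he0 : 0 < e := Real.cos_pos_of_mem_Ioo ⟨by nlinarith, by nlinarith⟩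
  set K := 2 / (d * e) with hK
  have hK0 : 0 < K := by positivity
  set c := 2 * (2 : ℝ) ^ (1 / κ) with hc
  have h21 : 1 ≤ (2 : ℝ) ^ (1 / κ) := Real.one_le_rpow (by norm_num) (by positivity)
  have hc1 : 1 ≤ c := by linarith
  refine ⟨max 1 K * Real.exp c, one_le_mul_of_one_le_of_one_le (le_max_left _ _)
    (Real.one_le_exp (by linarith)), fun m hm P hdeg hP i hi him => ?_⟩
  have hi' : (1 : ℝ) ≤ i := by exact_mod_cast hi
  have hi0 : (0 : ℝ) < i := by linarith
  have hr1 : 1 ≤ (i : ℝ) ^ κ := Real.one_le_rpow hi' hκ0.le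
  have hri : (i : ℝ) ^ κ ≤ i := Real.rpow_le_self_of_one_le hi' hκ1.le
  have hm0 : (0 : ℝ) < m := by exact_mod_cast hm
  refine norm_coeff_le_div_pow P (by positivity) (fun u hu => ?_) i
  have hmain : ‖P.eval u‖ ≤ K * Real.exp (c * i) := by
    set w : ℂ := d - u with hw
    have huw : u = d - w := by rw [hw]; ring
    have hwn : ‖w‖ ≤ 2 * (i : ℝ) ^ κ := by
      refine (norm_sub_le _ _).trans ?_
      rw [hu, Complex.norm_real, Real.norm_of_nonneg hd0.le]
      linarith
    rcases le_or_gt |w.arg| (κ * Real.pi / 2) with harg | harg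
    · -- inside the cone the bound comes from the Phragmén–Lindelöf estimate at `w ^ (1 / κ)`
      obtain ⟨ha1, ha2⟩ := abs_le.1 harg
      have hb1 : -(Real.pi / 2) ≤ κ⁻¹ * w.arg := by
        rw [← mul_le_mul_iff_right₀ hκ0, mul_inv_cancel_left₀ hκ0.ne']; linarith
      have hb2 : κ⁻¹ * w.arg ≤ Real.pi / 2 := by
        rw [← mul_le_mul_iff_right₀ hκ0, mul_inv_cancel_left₀ hκ0.ne']; linarith
      set v := w ^ ((κ⁻¹ : ℝ) : ℂ) with hv
      have hvre : 0 ≤ v.re := by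
        have h1 := re_cpow_mul_exp w κ⁻¹ 0
        simp only [Complex.ofReal_zero, zero_mul, Complex.exp_zero, mul_one, add_zero] at h1
        rw [hv, h1]
        exact mul_nonneg (by positivity) (Real.cos_nonneg_of_mem_Icc ⟨hb1, hb2⟩)
      have him1 : (Complex.log w * ((κ⁻¹ : ℝ) : ℂ)).im = κ⁻¹ * w.arg := by
        rw [Complex.im_mul_ofReal, Complex.log_im, mul_comm]
      have hvκ : v ^ (κ : ℂ) = w := by
        rw [hv, ← Complex.cpow_mul _ (by rw [him1]; linarith) (by rw [him1]; linarith),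
          ← Complex.ofReal_mul, inv_mul_cancel₀ hκ0.ne', Complex.ofReal_one, Complex.cpow_one]
      have hvn : ‖v‖ ≤ (2 : ℝ) ^ (1 / κ) * i := by
        rw [hv, Complex.norm_cpow_real]
        refine (Real.rpow_le_rpow (norm_nonneg _) hwn (by positivity)).trans (le_of_eq ?_)
        rw [Real.mul_rpow (by norm_num) (by positivity), Real.rpow_rpow_inv hi0.le hκ0.ne',
          one_div]
      have h1 := norm_eval_sub_cpow_le hκ0 hκ1 hm P hdeg hP hvre
      rw [hvκ, ← huw] at h1
      refine h1.trans (mul_le_mul_of_nonneg_left ?_ hK0.le)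
      calc (1 + ‖v‖) * Real.exp ‖v‖ ≤ Real.exp ‖v‖ * Real.exp ‖v‖ := by
            refine mul_le_mul_of_nonneg_right ?_ (Real.exp_pos _).le
            linarith [Real.add_one_le_exp ‖v‖]
        _ = Real.exp (2 * ‖v‖) := by rw [← Real.exp_add]; ring_nf
        _ ≤ _ := Real.exp_le_exp.2 (by rw [hc]; linarith)
    · -- outside the cone the hypothesis applies with a direction on the boundary of the sector
      obtain ⟨θ, hθ, hθre⟩ : ∃ θ : ℝ, |θ| ≤ (1 - κ) * Real.pi / 2 ∧
          d * e ≤ (u * Complex.exp (θ * Complex.I)).re := by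
        have habs : |(1 - κ) * Real.pi / 2| = (1 - κ) * Real.pi / 2 :=
          abs_of_nonneg (by nlinarith)
        have hgen : ∀ θ : ℝ, (u * Complex.exp (θ * Complex.I)).re =
            d * Real.cos θ - ‖w‖ * Real.cos (w.arg + θ) := by
          intro θ
          rw [huw, sub_mul, Complex.sub_re, re_mul_exp w, Complex.re_ofReal_mul,
            Complex.exp_ofReal_mul_I_re]
        have hpi := Complex.arg_le_pi w
        have hpi' := Complex.neg_pi_lt_arg w
        rcases lt_abs.1 harg with h | h
        · refine ⟨(1 - κ) * Real.pi / 2, habs.le, ?_⟩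
          rw [hgen, ← he]
          have := Real.cos_nonpos_of_pi_div_two_le_of_le
            (show Real.pi / 2 ≤ w.arg + (1 - κ) * Real.pi / 2 by linarith) (by nlinarith)
          nlinarith [norm_nonneg w]
        · refine ⟨-((1 - κ) * Real.pi / 2), by rw [abs_neg, habs], ?_⟩
          rw [hgen, Real.cos_neg, ← he, ← Real.cos_neg (w.arg + _)]
          have := Real.cos_nonpos_of_pi_div_two_le_of_le
            (show Real.pi / 2 ≤ -(w.arg + -((1 - κ) * Real.pi / 2)) by linarith) (by nlinarith)
          nlinarith [norm_nonneg w]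
      have hde : 0 < d * e := by positivity
      have h1 := hP u θ hθ (hde.trans_le hθre)
      have h2 : (‖u‖ / (m : ℝ) ^ κ) ^ m ≤ 1 := by
        refine pow_le_one₀ (by positivity) ((div_le_one (by positivity)).2 ?_)
        rw [hu]
        exact Real.rpow_le_rpow hi0.le (by exact_mod_cast him.le) hκ0.le
      calc ‖P.eval u‖ ≤ ‖u‖ / (u * Complex.exp (θ * Complex.I)).re *
            (1 + (‖u‖ / (m : ℝ) ^ κ) ^ m) := h1
        _ ≤ ‖u‖ / (d * e) * 2 := by
            refine mul_le_mul (div_le_div_of_nonneg_left (norm_nonneg _) hde hθre)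
              (by linarith) (by positivity) (by positivity)
        _ = K * (i : ℝ) ^ κ := by rw [hu, hK]; ring
        _ ≤ K * Real.exp (c * i) := by
            refine mul_le_mul_of_nonneg_left ?_ hK0.le
            have := Real.add_one_le_exp (c * i)
            nlinarith
  refine hmain.trans ?_
  rw [mul_pow, ← Real.exp_nat_mul, mul_comm (i : ℝ) c]
  refine mul_le_mul_of_nonneg_right ?_ (Real.exp_pos _).le
  exact (le_max_right 1 K).trans (le_self_pow₀ (le_max_left _ _) (by omega))

/-- Coefficient bounds for a polynomial of degree less than `m` whose size at `u` is controlled by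
the distance of `u` from the cone opposite to the sector of opening `(1 - κ) π`. The base `B` does
not depend on the degree. -/
theorem exists_norm_coeff_le {κ : ℝ} (hκ0 : 0 ≤ κ) (hκ1 : κ < 1) : ∃ B : ℝ, 1 ≤ B ∧
    ∀ m : ℕ, 1 ≤ m → ∀ P : Polynomial ℂ, P.natDegree < m →
    (∀ u : ℂ, ∀ θ : ℝ, |θ| ≤ (1 - κ) * Real.pi / 2 →
      0 < (u * Complex.exp (θ * Complex.I)).re →
      ‖P.eval u‖ ≤ ‖u‖ / (u * Complex.exp (θ * Complex.I)).re *
        (1 + (‖u‖ / (m : ℝ) ^ κ) ^ m)) →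
    ∀ i : ℕ, 1 ≤ i → i < m → ‖P.coeff i‖ ≤ B ^ i / ((i : ℝ) ^ κ) ^ i := by
  rcases hκ0.eq_or_lt with rfl | hκ0
  · refine ⟨16, by norm_num, fun m _ P _ hP i hi _ => ?_⟩
    simp only [sub_zero, one_mul, Real.rpow_zero, div_one, one_pow] at hP ⊢
    refine (norm_coeff_le_of_zero P hP i).trans ?_
    have h1 : ((i : ℝ) + 1) ≤ 2 ^ i := by exact_mod_cast i.lt_two_pow_self
    have h2 : (8 : ℝ) ≤ 8 ^ i := le_self_pow₀ (by norm_num) (by omega)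
    calc 8 * ((i : ℝ) + 1) ≤ 8 ^ i * 2 ^ i := mul_le_mul h2 h1 (by positivity) (by positivity)
      _ = _ := by rw [← mul_pow]; norm_num
  · exact norm_coeff_le_of_pos hκ0 hκ1

/-! ### Geometry of sectors -/

section Sector

variable {α : ℝ}

theorem mem_sector_iff (hα0 : 0 < α) (hα1 : α ≤ 1) {z : ℂ} : z ∈ sector α ↔
    0 < (z * Complex.exp (((1 - α) * Real.pi / 2 : ℝ) * Complex.I)).re ∧
    0 < (z * Complex.exp ((-((1 - α) * Real.pi / 2) : ℝ) * Complex.I)).re := by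
  have hπ := Real.pi_pos
  rw [re_mul_exp, re_mul_exp]
  constructor
  · rintro ⟨hz, harg⟩
    obtain ⟨h1, h2⟩ := abs_lt.1 harg
    have hz' := norm_pos_iff.2 hz
    exact ⟨mul_pos hz' (Real.cos_pos_of_mem_Ioo ⟨by nlinarith, by nlinarith⟩),
      mul_pos hz' (Real.cos_pos_of_mem_Ioo ⟨by nlinarith, by nlinarith⟩)⟩
  · rintro ⟨h1, h2⟩
    have hz : z ≠ 0 := by rintro rfl; simp at h1
    refine ⟨hz, ?_⟩
    have hz' := norm_pos_iff.2 hz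
    have hc1 := (mul_pos_iff_of_pos_left hz').1 h1
    have hc2 := (mul_pos_iff_of_pos_left hz').1 h2
    have hpi := Complex.arg_le_pi z
    have hpi' := Complex.neg_pi_lt_arg z
    rw [abs_lt]
    constructor <;> by_contra! h
    · rw [← Real.cos_neg] at hc2
      have := Real.cos_nonpos_of_pi_div_two_le_of_le
        (show Real.pi / 2 ≤ -(z.arg + -((1 - α) * Real.pi / 2)) by linarith) (by nlinarith)
      linarith
    · have := Real.cos_nonpos_of_pi_div_two_le_of_le
        (show Real.pi / 2 ≤ z.arg + (1 - α) * Real.pi / 2 by linarith) (by nlinarith)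
      linarith

theorem sector_eq (hα0 : 0 < α) (hα1 : α ≤ 1) : sector α =
    {z : ℂ | 0 < (z * Complex.exp (((1 - α) * Real.pi / 2 : ℝ) * Complex.I)).re} ∩
    {z : ℂ | 0 < (z * Complex.exp ((-((1 - α) * Real.pi / 2) : ℝ) * Complex.I)).re} :=
  Set.ext fun _ => mem_sector_iff hα0 hα1

theorem isOpen_sector (hα0 : 0 < α) (hα1 : α ≤ 1) : IsOpen (sector α) := by
  rw [sector_eq hα0 hα1]
  exact (isOpen_lt continuous_const (by fun_prop)).inter (isOpen_lt continuous_const (by fun_prop))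

theorem convex_sector (hα0 : 0 < α) (hα1 : α ≤ 1) : Convex ℝ (sector α) := by
  have h : ∀ w : ℂ, Convex ℝ {z : ℂ | 0 < (z * w).re} := by
    intro w
    refine convex_halfSpace_gt (f := fun z : ℂ => (z * w).re) ⟨fun x y => ?_, fun c x => ?_⟩ 0
    · rw [add_mul, Complex.add_re]
    · rw [smul_mul_assoc, Complex.smul_re]
  rw [sector_eq hα0 hα1]
  exact (h _).inter (h _)

theorem ofReal_mem_sector (hα0 : 0 < α) {x : ℝ} (hx : 0 < x) : (x : ℂ) ∈ sector α := by
  refine ⟨by exact_mod_cast hx.ne', ?_⟩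
  rw [Complex.arg_ofReal_of_nonneg hx.le, abs_zero]
  have := Real.pi_pos
  positivity

theorem ofReal_mul_mem_sector {x : ℝ} (hx : 0 < x) {z : ℂ} (hz : z ∈ sector α) :
    (x : ℂ) * z ∈ sector α := by
  refine ⟨mul_ne_zero (by exact_mod_cast hx.ne') hz.1, ?_⟩
  rw [Complex.arg_real_mul _ hx]
  exact hz.2

/-- The sector is stable under addition of vectors in its closure. -/
theorem add_mul_exp_mem_sector (hα0 : 0 < α) (hα1 : α ≤ 1) {z : ℂ} (hz : z ∈ sector α) {θ : ℝ}
    (hθ : |θ| ≤ α * Real.pi / 2) {t : ℝ} (ht : 0 ≤ t) :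
    z + t * Complex.exp (θ * Complex.I) ∈ sector α := by
  have hπ := Real.pi_pos
  obtain ⟨h1, h2⟩ := abs_le.1 hθ
  rw [mem_sector_iff hα0 hα1] at hz ⊢
  have h : ∀ ψ : ℝ, |θ + ψ| ≤ Real.pi / 2 →
      0 ≤ (t * Complex.exp (θ * Complex.I) * Complex.exp (ψ * Complex.I)).re := by
    intro ψ hψ
    rw [mul_assoc, ← Complex.exp_add, ← add_mul, ← Complex.ofReal_add, Complex.re_ofReal_mul,
      Complex.exp_ofReal_mul_I_re]
    exact mul_nonneg ht (Real.cos_nonneg_of_mem_Icc (abs_le.1 hψ))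
  constructor
  · rw [add_mul, Complex.add_re]
    refine add_pos_of_pos_of_nonneg hz.1 (h _ (abs_le.2 ⟨by nlinarith, by nlinarith⟩))
  · rw [add_mul, Complex.add_re]
    refine add_pos_of_pos_of_nonneg hz.2 (h _ (abs_le.2 ⟨by nlinarith, by nlinarith⟩))

end Sector

/-! ### Interpolation of derivatives on sectors -/

theorem hasDerivAt_iteratedDeriv {f : ℂ → ℂ} {S : Set ℂ} (hS : IsOpen S)
    (hf : DifferentiableOn ℂ f S) (n : ℕ) {z : ℂ} (hz : z ∈ S) :
    HasDerivAt (iteratedDeriv n f) (iteratedDeriv (n + 1) f z) z := by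
  rw [iteratedDeriv_succ]
  have h : AnalyticAt ℂ (iteratedDeriv n f) z := by
    rw [iteratedDeriv_eq_iterate]
    exact (hf.analyticAt (hS.mem_nhds hz)).iterated_deriv n
  exact h.differentiableAt.hasDerivAt

open MeasureTheory in
/-- The sum `∑ f^(p+i)(z₀) u ^ i` over `i < m` is controlled by two derivatives of `f`: it is the
difference of the Laplace integrals of `f^(p)` and of `u ^ m f^(p+m)` along the translate to `z₀` of
a ray in the closed sector. -/
theorem norm_sum_iteratedDeriv_le {α : ℝ} (hα0 : 0 < α) (hα1 : α ≤ 1) {f : ℂ → ℂ}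
    (hf : DifferentiableOn ℂ f (sector α))
    (hbd : ∀ n, ∃ A : ℝ, ∀ z ∈ sector α, ‖iteratedDeriv n f z‖ ≤ A) {p m : ℕ} {a b : ℝ}
    (ha : ∀ z ∈ sector α, ‖iteratedDeriv p f z‖ ≤ a)
    (hb : ∀ z ∈ sector α, ‖iteratedDeriv (p + m) f z‖ ≤ b) {z₀ : ℂ} (hz₀ : z₀ ∈ sector α)
    {u : ℂ} {θ : ℝ} (hθ : |θ| ≤ α * Real.pi / 2)
    (hre : 0 < (u * Complex.exp (θ * Complex.I)).re) :
    ‖∑ i ∈ Finset.range m, iteratedDeriv (p + i) f z₀ * u ^ i‖ ≤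
      ‖u‖ / (u * Complex.exp (θ * Complex.I)).re * (a + ‖u‖ ^ m * b) := by
  have hu0 : u ≠ 0 := by rintro rfl; simp at hre
  have hun : 0 < ‖u‖ := norm_pos_iff.2 hu0
  set R := (u * Complex.exp (θ * Complex.I)).re with hR
  -- the integration path is `t ↦ z₀ + ζ t`, the kernel is `η exp (-η t)` with `ζ = u η`
  set ζ := Complex.exp ((-θ : ℝ) * Complex.I) with hζ
  have hζn : ‖ζ‖ = 1 := Complex.norm_exp_ofReal_mul_I _
  set η := ζ / u with hη
  have hζη : ζ = u * η := by rw [hη]; field_simp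
  have hηn : ‖η‖ = 1 / ‖u‖ := by rw [hη, norm_div, hζn]
  set ρ := η.re with hρ
  have hρR : ρ = R / ‖u‖ ^ 2 := by
    have h1 : ζ = (starRingEnd ℂ) (Complex.exp (θ * Complex.I)) := by
      rw [hζ, ← Complex.exp_conj, map_mul, Complex.conj_I, Complex.conj_ofReal]
      push_cast; ring_nf
    rw [hρ, hη, Complex.div_re, Complex.normSq_eq_norm_sq, h1, hR, Complex.mul_re,
      Complex.conj_re, Complex.conj_im]
    ring
  have hρ0 : 0 < ρ := by rw [hρR]; positivity
  have hmem : ∀ t : ℝ, 0 ≤ t → z₀ + ζ * t ∈ sector α := by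
    intro t ht
    rw [mul_comm ζ]
    exact add_mul_exp_mem_sector hα0 hα1 hz₀ (by rwa [abs_neg]) ht
  have hS := isOpen_sector hα0 hα1
  have hexp : ∀ t : ℝ, ‖Complex.exp (-η * t)‖ = Real.exp (-ρ * t) := by
    intro t
    rw [Complex.norm_exp]
    congr 1
    rw [Complex.mul_re]; simp [hρ]
  have hder : ∀ n : ℕ, ∀ t : ℝ, 0 ≤ t → HasDerivAt (fun t : ℝ => iteratedDeriv n f (z₀ + ζ * t))
      (iteratedDeriv (n + 1) f (z₀ + ζ * t) * ζ) t := by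
    intro n t ht
    have h1 := hasDerivAt_iteratedDeriv hS hf n (hmem t ht)
    have h2 : HasDerivAt (fun t : ℝ => z₀ + ζ * (t : ℂ)) ζ t := by
      have := ((Complex.ofRealCLM.hasDerivAt (x := t)).const_mul ζ).const_add z₀
      simpa using this
    exact h1.comp t h2
  set I : ℕ → ℝ → ℂ := fun n t => η * Complex.exp (-η * t) * iteratedDeriv n f (z₀ + ζ * t)
    with hI
  have hexpint : IntegrableOn (fun t => Real.exp (-ρ * t)) (Set.Ioi 0) :=
    exp_neg_integrableOn_Ioi 0 hρ0
  have hnormI : ∀ n A, (∀ z ∈ sector α, ‖iteratedDeriv n f z‖ ≤ A) → ∀ t : ℝ, 0 ≤ t →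
      ‖I n t‖ ≤ ‖η‖ * A * Real.exp (-ρ * t) := by
    intro n A hA t ht
    rw [hI]
    simp only
    rw [norm_mul, norm_mul, hexp]
    have := mul_le_mul_of_nonneg_left (hA _ (hmem t ht))
      (mul_nonneg (norm_nonneg η) (Real.exp_pos (-ρ * t)).le)
    linarith
  have hint : ∀ n, IntegrableOn (I n) (Set.Ioi 0) := by
    intro n
    obtain ⟨A, hA⟩ := hbd n
    refine Integrable.mono' (hexpint.const_mul (‖η‖ * A)) ?_ ?_
    · refine ContinuousOn.aestronglyMeasurable (fun t ht => ?_) measurableSet_Ioi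
      refine ContinuousAt.continuousWithinAt (ContinuousAt.mul (by fun_prop) ?_)
      exact (hder n t (le_of_lt ht)).continuousAt
    · refine (ae_restrict_iff' measurableSet_Ioi).2 (Eventually.of_forall fun t ht => ?_)
      exact hnormI n A hA t (le_of_lt ht)
  set B : ℕ → ℂ := fun n => ∫ t in Set.Ioi (0 : ℝ), I n t with hB
  have hBn : ∀ n A, (∀ z ∈ sector α, ‖iteratedDeriv n f z‖ ≤ A) → ‖B n‖ ≤ ‖u‖ / R * A := by
    intro n A hA
    have h1 : ‖B n‖ ≤ ∫ t in Set.Ioi (0 : ℝ), ‖η‖ * A * Real.exp (-ρ * t) := by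
      refine norm_integral_le_of_norm_le (hexpint.const_mul _) ?_
      refine (ae_restrict_iff' measurableSet_Ioi).2 (Eventually.of_forall fun t ht => ?_)
      exact hnormI n A hA t (le_of_lt ht)
    refine h1.trans (le_of_eq ?_)
    rw [integral_const_mul, integral_exp_mul_Ioi (by linarith), hηn, hρR]
    simp
    field_simp
  -- integration by parts
  have hstep : ∀ n, B n = iteratedDeriv n f z₀ + u * B (n + 1) := by
    intro n
    obtain ⟨A, hA⟩ := hbd n
    have hcont : ∀ t : ℝ, 0 ≤ t → HasDerivAt
        (fun t : ℝ => Complex.exp (-η * t) * iteratedDeriv n f (z₀ + ζ * t))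
        (-I n t + u * I (n + 1) t) t := by
      intro t ht
      have h1 : HasDerivAt (fun t : ℝ => Complex.exp (-η * (t : ℂ)))
          (Complex.exp (-η * t) * -η) t := by
        have := ((Complex.ofRealCLM.hasDerivAt (x := t)).const_mul (-η)).cexp
        simpa using this
      convert! h1.mul (hder n t ht) using 1
      rw [hI]
      simp only
      rw [hζη]
      ring
    have h := integral_Ioi_of_hasDerivAt_of_tendsto (a := 0) (m := 0)
      (f := fun t : ℝ => Complex.exp (-η * t) * iteratedDeriv n f (z₀ + ζ * t))
      (f' := fun t => -I n t + u * I (n + 1) t)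
      (hcont 0 le_rfl).continuousAt.continuousWithinAt (fun t ht => hcont t (le_of_lt ht))
      ((hint n).neg.add ((hint (n + 1)).const_mul u)) (by
        have hlim : Tendsto (fun t : ℝ => Real.exp (-ρ * t) * A) atTop (nhds 0) := by
          have h1 : Tendsto (fun t : ℝ => -ρ * t) atTop atBot :=
            tendsto_id.const_mul_atTop_of_neg (by linarith)
          simpa using (Real.tendsto_exp_atBot.comp h1).mul_const A
        refine squeeze_zero_norm' ?_ hlim
        filter_upwards [eventually_ge_atTop (0 : ℝ)] with t ht
        rw [norm_mul, hexp]
        exact mul_le_mul_of_nonneg_left (hA _ (hmem t ht)) (Real.exp_pos _).le)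
    have hneg : IntegrableOn (fun t => -I n t) (Set.Ioi 0) := (hint n).neg
    rw [integral_add hneg ((hint (n + 1)).const_mul u), integral_neg,
      integral_const_mul] at h
    simp only [Complex.ofReal_zero, mul_zero, Complex.exp_zero, add_zero, one_mul, zero_sub] at h
    have h' : -B n + u * B (n + 1) = -iteratedDeriv n f z₀ := h
    linear_combination -h'
  have hsum : ∀ k, ∑ i ∈ Finset.range k, iteratedDeriv (p + i) f z₀ * u ^ i =
      B p - u ^ k * B (p + k) := by
    intro k
    induction k with
    | zero => simp
    | succ k ih =>
      rw [Finset.sum_range_succ, ih, hstep (p + k), ← add_assoc]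
      ring
  rw [hsum]
  have h1 := hBn p a ha
  have h2 := mul_le_mul_of_nonneg_left (hBn (p + m) b hb) (pow_nonneg hun.le m)
  refine (norm_sub_le _ _).trans ?_
  rw [norm_mul, norm_pow]
  linarith

/-- Gorny–Cartan type inequality on a sector: an intermediate derivative is controlled by the
derivatives of orders `p` and `q`, with a constant that is geometric in the order and does not
depend on `q`. The sector enters through the factor `((q - p) / (j - p)) ^ ((1 - α) (j - p))`. -/
theorem exists_norm_iteratedDeriv_le {α : ℝ} (hα0 : 0 < α) (hα1 : α ≤ 1) : ∃ B : ℝ, 1 ≤ B ∧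
    ∀ f : ℂ → ℂ, DifferentiableOn ℂ f (sector α) →
    (∀ n, ∃ A : ℝ, ∀ z ∈ sector α, ‖iteratedDeriv n f z‖ ≤ A) →
    ∀ p j q : ℕ, p < j → j < q → ∀ a b : ℝ, 0 < a → 0 < b →
    (∀ z ∈ sector α, ‖iteratedDeriv p f z‖ ≤ a) → (∀ z ∈ sector α, ‖iteratedDeriv q f z‖ ≤ b) →
    ∀ z ∈ sector α, ‖iteratedDeriv j f z‖ ≤ Real.exp
      ((q - j : ℝ) / (q - p) * Real.log a + (j - p : ℝ) / (q - p) * Real.log b +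
        (j - p) * Real.log B - (1 - α) * ((j - p) * Real.log ((j - p : ℝ) / (q - p)))) := by
  obtain ⟨B, hB1, hB⟩ := exists_norm_coeff_le (κ := 1 - α) (by linarith) (by linarith)
  refine ⟨B, hB1, fun f hf hbd p j q hpj hjq a b ha hb hfa hfb z hz => ?_⟩
  obtain ⟨m, rfl⟩ : ∃ m, q = p + m := ⟨q - p, by omega⟩
  obtain ⟨i, rfl⟩ : ∃ i, j = p + i := ⟨j - p, by omega⟩
  have hi1 : 1 ≤ i := by omega
  have him : i < m := by omega
  have hi0 : (0 : ℝ) < i := by exact_mod_cast hi1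
  have hm0 : (0 : ℝ) < m := by exact_mod_cast (by omega : 0 < m)
  -- the scale at which the two bounds balance
  set τ : ℝ := (a / b) ^ ((m : ℝ)⁻¹) / (m : ℝ) ^ (1 - α) with hτ
  have hmκ : 0 < (m : ℝ) ^ (1 - α) := by positivity
  have hτ0 : 0 < τ := by positivity
  have hτm : (τ * (m : ℝ) ^ (1 - α)) ^ m = a / b := by
    rw [hτ, div_mul_cancel₀ _ hmκ.ne', Real.rpow_inv_natCast_pow (by positivity) (by omega)]
  set P : Polynomial ℂ := ∑ n ∈ Finset.range m,
    Polynomial.monomial n (iteratedDeriv (p + n) f z * τ ^ n / a) with hP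
  have hdeg : P.natDegree < m := by
    have : P.natDegree ≤ m - 1 := by
      refine Polynomial.natDegree_sum_le_of_forall_le _ _ fun n hn => ?_
      refine (Polynomial.natDegree_monomial_le _).trans ?_
      have := Finset.mem_range.1 hn
      omega
    omega
  have hcoeff : P.coeff i = iteratedDeriv (p + i) f z * τ ^ i / a := by
    rw [hP, Polynomial.finsetSum_coeff]
    simp only [Polynomial.coeff_monomial]
    rw [Finset.sum_ite_eq' , if_pos (Finset.mem_range.2 him)]
  have hbound := hB m (by omega) P hdeg (fun u θ hθ hre => by
    rw [sub_sub_cancel] at hθ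
    have hval : P.eval u = (∑ n ∈ Finset.range m, iteratedDeriv (p + n) f z * (τ * u) ^ n) / a := by
      rw [hP, Polynomial.eval_finsetSum, Finset.sum_div]
      refine Finset.sum_congr rfl fun n _ => ?_
      rw [Polynomial.eval_monomial]; ring
    have hre' : ((τ : ℂ) * u * Complex.exp (θ * Complex.I)).re =
        τ * (u * Complex.exp (θ * Complex.I)).re := by
      rw [mul_assoc, Complex.re_ofReal_mul]
    have h1 := norm_sum_iteratedDeriv_le hα0 hα1 hf hbd hfa hfb hz hθ
      (u := τ * u) (by rw [hre']; positivity)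
    rw [hval, norm_div, Complex.norm_real, Real.norm_of_nonneg ha.le, div_le_iff₀ ha]
    refine h1.trans (le_of_eq ?_)
    rw [hre', norm_mul, Complex.norm_real, Real.norm_of_nonneg hτ0.le]
    have h2 : (τ * ‖u‖) ^ m = (‖u‖ / (m : ℝ) ^ (1 - α)) ^ m * (a / b) := by
      rw [← hτm, ← mul_pow]; congr 1; field_simp
    rw [h2]
    field_simp) i hi1 him
  rw [hcoeff, norm_div, norm_mul, norm_pow, Complex.norm_real, Complex.norm_real,
    Real.norm_of_nonneg hτ0.le, Real.norm_of_nonneg ha.le, div_le_iff₀ ha,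
    ← le_div_iff₀ (by positivity)] at hbound
  refine hbound.trans (le_of_eq ?_)
  have hB0 : 0 < B := by linarith
  rw [← Real.exp_log (show 0 < B ^ i / ((i : ℝ) ^ (1 - α)) ^ i * a / τ ^ i by positivity)]
  congr 1
  rw [Real.log_div (by positivity) (by positivity), Real.log_mul (by positivity) ha.ne',
    Real.log_div (by positivity) (by positivity), Real.log_pow, Real.log_pow, Real.log_pow,
    Real.log_rpow hi0, hτ, Real.log_div (by positivity) (by positivity),
    Real.log_rpow (by positivity), Real.log_rpow hm0, Real.log_div ha.ne' hb.ne']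
  push_cast
  rw [show (p : ℝ) + i - p = i by ring, show (p : ℝ) + m - p = m by ring,
    show (p : ℝ) + m - (p + i) = m - i by ring, Real.log_div hi0.ne' hm0.ne']
  field_simp
  ring

theorem mem_roumieuClass_of_le {M N : ℕ → ℝ} {S : Set ℂ} (hM : ∀ j, 0 < M j)
    (hle : ∀ j, M j ≤ N j) {f : ℂ → ℂ} (hf : f ∈ roumieuClass M S) : f ∈ roumieuClass N S := by
  obtain ⟨hd, h, hh, C, hC⟩ := hf
  refine ⟨hd, h, hh, max C 0, fun z hz j => (hC z hz j).trans ?_⟩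
  have h1 := hM j
  exact mul_le_mul (le_max_left _ _) (mul_le_mul_of_nonneg_left (hle j) (by positivity))
    (by positivity) (le_max_right _ _)

/-- Passing to the regularized sequence does not change the class. At an index where the minorant
does not touch, interpolation between the adjacent touching indices `p` and `q` gives the bound,
and `mul_log_half_le` compares the Gevrey factors. -/
theorem roumieuClass_regularized {M : ℕ → ℝ} (hpos : ∀ j, 0 < M j) {α : ℝ} (hα0 : 0 < α)
    (hα1 : α ≤ 1) (hlim : RootsTendToInfinity (fun j => gevrey (1 - α) j * M j)) :
    roumieuClass (regularized α M) (sector α) = roumieuClass M (sector α) := by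
  refine Set.Subset.antisymm (fun f hf => mem_roumieuClass_of_le (regularized_pos hpos hlim)
    (regularized_le hpos hlim) hf) ?_
  rintro f ⟨hd, h, hh, C, hC⟩
  obtain ⟨B, hB1, hB⟩ := exists_norm_iteratedDeriv_le hα0 hα1
  have hB0 : 0 < B := by linarith
  set K := max C 1 with hK
  have hK0 : 0 < K := lt_max_of_lt_right one_pos
  have hKC : ∀ z ∈ sector α, ∀ j, ‖iteratedDeriv j f z‖ ≤ K * (h ^ j * M j) := fun z hz j =>
    (hC z hz j).trans (mul_le_mul_of_nonneg_right (le_max_left _ _)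
      (by have := hpos j; positivity))
  -- `t = 2 ^ (1 - α)` makes up for the `j / 2` in the entropy estimate
  set t := Real.exp ((1 - α) * Real.log 2) with ht
  have ht0 : 0 < t := Real.exp_pos _
  have ht1 : 1 ≤ t := Real.one_le_exp (mul_nonneg (by linarith) (Real.log_nonneg (by norm_num)))
  have hGpos := gevrey_mul_pos (α := α) hpos
  have hlogG : ∀ n, Real.log (M n) =
      Real.log (gevrey (1 - α) n * M n) - (1 - α) * (n * Real.log n) := by
    intro n
    rw [Real.log_mul (gevrey_pos _ _).ne' (hpos n).ne', log_gevrey]; ring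
  refine ⟨hd, h * B * t, by positivity, K, fun z hz j => ?_⟩
  rcases exists_logAffine_lcMinorant hGpos hlim j with hj | ⟨p, q, hpj, hjq, δ, hj, hq⟩
  · have hreg : regularized α M j = M j := by
      rw [regularized, hj, ← mul_assoc]
      have := gevrey_neg_mul (1 - α) j
      rw [neg_sub] at this
      rw [this, one_mul]
    rw [hreg]
    refine (hKC z hz j).trans (mul_le_mul_of_nonneg_left (mul_le_mul_of_nonneg_right ?_
      (hpos j).le) hK0.le)
    refine pow_le_pow_left₀ hh.le ?_ j
    rw [mul_assoc]
    exact le_mul_of_one_le_right hh.le (one_le_mul_of_one_le_of_one_le hB1 ht1)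
  have hab : ∀ n, 0 < K * (h ^ n * M n) := fun n => by have := hpos n; positivity
  have hmain := hB f hd (fun n => ⟨_, fun z hz => hKC z hz n⟩) p j q hpj hjq _ _ (hab p) (hab q)
    (fun z hz => hKC z hz p) (fun z hz => hKC z hz q) z hz
  refine hmain.trans ?_
  have hreg := regularized_pos hpos hlim j
  rw [← Real.exp_log (show 0 < K * ((h * B * t) ^ j * regularized α M j) by positivity),
    Real.exp_le_exp]
  have hpj' : (p : ℝ) < j := by exact_mod_cast hpj
  have hjq' : (j : ℝ) < q := by exact_mod_cast hjq
  have hp0 : (0 : ℝ) ≤ p := p.cast_nonneg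
  have hj0 : (0 : ℝ) < j := by linarith
  have hlogab : ∀ n, Real.log (K * (h ^ n * M n)) = Real.log K + n * Real.log h +
      (Real.log (gevrey (1 - α) n * M n) - (1 - α) * (n * Real.log n)) := by
    intro n
    rw [Real.log_mul hK0.ne' (by have := hpos n; positivity),
      Real.log_mul (by positivity) (hpos n).ne', Real.log_pow, hlogG]
    ring
  rw [hlogab, hlogab, hq, Real.log_mul hK0.ne' (by positivity),
    Real.log_mul (by positivity) hreg.ne', Real.log_pow, Real.log_mul (by positivity) ht0.ne',
    Real.log_mul hh.ne' hB0.ne', ht,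
    Real.log_exp, regularized, Real.log_mul (gevrey_pos _ _).ne'
      (lcMinorant_pos hGpos hlim j).ne', log_gevrey, hj]
  have hent := mul_log_half_le hp0 hpj' hjq'
  rw [Real.log_div hj0.ne' (by norm_num)] at hent
  have hent' := mul_le_mul_of_nonneg_left hent (by linarith : 0 ≤ 1 - α)
  have hqp : (0 : ℝ) < q - p := by linarith
  have hs : (q - j : ℝ) / (q - p) = 1 - (j - p) / (q - p) := by field_simp; ring
  have hsδ : ((j : ℝ) - p) / (q - p) * ((q - p) * δ) = (j - p) * δ := by field_simp
  have hsj : ((j : ℝ) - p) / (q - p) * (q - p) = j - p := by field_simp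
  rw [hs] at hent' ⊢
  generalize ((j : ℝ) - p) / (q - p) = s at *
  have hBlog : 0 ≤ p * Real.log B := mul_nonneg hp0 (Real.log_nonneg hB1)
  have hlin : (1 - s) * (p * Real.log h) + s * (q * Real.log h) = j * Real.log h := by
    linear_combination Real.log h * hsj
  linarith [hlin, hsδ]

/-! ### Inversion of the Laplace transform of a power -/

open MeasureTheory in
/-- Both sides are holomorphic in `r`, and they agree for positive `r`. -/
theorem integral_rpow_mul_cexp_neg_mul_Ioi {a : ℝ} (ha : 1 ≤ a) {r : ℂ} (hr : 0 < r.re) :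
    ∫ t in Set.Ioi (0 : ℝ), ((t ^ (a - 1) : ℝ) : ℂ) * Complex.exp (-(r * t)) =
      Real.Gamma a * r ^ (-a : ℂ) := by
  set J : ℂ → ℂ := fun r =>
    ∫ t in Set.Ioi (0 : ℝ), ((t ^ (a - 1) : ℝ) : ℂ) * Complex.exp (-(r * t)) with hJ
  have hnexp : ∀ (r : ℂ) (t : ℝ), ‖Complex.exp (-(r * t))‖ = Real.exp (-r.re * t) := by
    intro r t
    rw [Complex.norm_exp]; simp
  have hintb : ∀ s b : ℝ, -1 < s → 0 < b →
      IntegrableOn (fun t : ℝ => t ^ s * Real.exp (-b * t)) (Set.Ioi 0) := by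
    intro s b hs hb
    have := integrableOn_rpow_mul_exp_neg_mul_rpow (s := s) (p := 1) (b := b) hs one_pos hb
    simpa using this
  have hmeas : ∀ (s : ℝ) (r : ℂ), AEStronglyMeasurable
      (fun t : ℝ => ((t ^ s : ℝ) : ℂ) * Complex.exp (-(r * t))) (volume.restrict (Set.Ioi 0)) := by
    intro s r
    have : Measurable (fun t : ℝ => ((t ^ s : ℝ) : ℂ)) := by fun_prop
    exact (this.mul (by fun_prop)).aestronglyMeasurable
  have hdiff : ∀ r : ℂ, 0 < r.re → DifferentiableAt ℂ J r := by
    intro r hr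
    have hs : Metric.ball r (r.re / 2) ∈ nhds r := Metric.ball_mem_nhds r (by positivity)
    refine (hasDerivAt_integral_of_dominated_loc_of_deriv_le
      (F' := fun r t => ((t ^ a : ℝ) : ℂ) * Complex.exp (-(r * t)) * (-1))
      (bound := fun t => t ^ a * Real.exp (-(r.re / 2) * t)) hs
      (Eventually.of_forall fun r => hmeas _ r) ?_ ((hmeas a r).mul_const _)
      ?_ (hintb a _ (by linarith) (by positivity)) ?_).2.differentiableAt
    · refine Integrable.mono' (hintb (a - 1) r.re (by linarith) hr) (hmeas _ r) ?_
      refine (ae_restrict_iff' measurableSet_Ioi).2 (Eventually.of_forall fun t ht => ?_)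
      rw [norm_mul, hnexp, Complex.norm_real,
        Real.norm_of_nonneg (Real.rpow_nonneg (le_of_lt ht) _)]
    · refine (ae_restrict_iff' measurableSet_Ioi).2 (Eventually.of_forall fun t ht x hx => ?_)
      have ht : 0 < t := ht
      rw [norm_mul, norm_mul, hnexp, Complex.norm_real,
        Real.norm_of_nonneg (Real.rpow_nonneg ht.le _), norm_neg, norm_one, mul_one]
      refine mul_le_mul_of_nonneg_left (Real.exp_le_exp.2 ?_) (Real.rpow_nonneg ht.le _)
      have h1 : |(x - r).re| < r.re / 2 :=
        (Complex.abs_re_le_norm _).trans_lt (by simpa [dist_eq_norm] using hx)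
      have h2 := (abs_lt.1 h1).1
      rw [Complex.sub_re] at h2
      nlinarith
    · refine (ae_restrict_iff' measurableSet_Ioi).2 (Eventually.of_forall fun t ht x hx => ?_)
      have ht : 0 < t := ht
      have h1 : HasDerivAt (fun x : ℂ => Complex.exp (-(x * t)))
          (Complex.exp (-(x * t)) * (-(1 * t))) x := ((hasDerivAt_id x).mul_const (t : ℂ)).neg.cexp
      convert! h1.const_mul ((t ^ (a - 1) : ℝ) : ℂ) using 1
      rw [show t ^ a = t ^ (a - 1) * t by
        rw [← Real.rpow_add_one ht.ne']; ring_nf]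
      push_cast
      ring
  set U : Set ℂ := {r | 0 < r.re} with hU
  have hUo : IsOpen U := isOpen_lt continuous_const Complex.continuous_re
  have hUc : Convex ℝ U := convex_halfSpace_re_gt 0
  have hJa : AnalyticOnNhd ℂ J U :=
    DifferentiableOn.analyticOnNhd (fun r hr => (hdiff r hr).differentiableWithinAt) hUo
  have hGa : AnalyticOnNhd ℂ (fun r : ℂ => Real.Gamma a * r ^ (-a : ℂ)) U := by
    refine DifferentiableOn.analyticOnNhd (fun r hr => ?_) hUo
    refine DifferentiableAt.differentiableWithinAt ?_
    exact (differentiableAt_id.cpow_const (Or.inl hr)).const_mul _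
  have hreal : ∀ x : ℝ, 0 < x → J x = Real.Gamma a * (x : ℂ) ^ (-a : ℂ) := by
    intro x hx
    have h1 := Real.integral_rpow_mul_exp_neg_mul_Ioi (a := a) (r := x) (by linarith) hx
    have h2 : J x = ((∫ t in Set.Ioi (0 : ℝ), t ^ (a - 1) * Real.exp (-(x * t)) : ℝ) : ℂ) := by
      rw [hJ]
      simp only
      rw [← integral_complex_ofReal]
      congr 1
      funext t
      push_cast
      rfl
    rw [h2, h1, ← Complex.ofReal_neg, ← Complex.ofReal_cpow hx.le, one_div,
      Real.inv_rpow hx.le, Real.rpow_neg hx.le]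
    push_cast
    ring
  refine hJa.eqOn_of_preconnected_of_frequently_eq hGa hUc.isPreconnected
    (z₀ := 1) (by simp [hU]) ?_ hr
  have hlim : Tendsto (fun n : ℕ => ((1 + 1 / ((n : ℝ) + 1) : ℝ) : ℂ)) atTop
      (nhdsWithin 1 {1}ᶜ) := by
    refine tendsto_nhdsWithin_iff.2 ⟨?_, Eventually.of_forall fun n => ?_⟩
    · have := (tendsto_one_div_add_atTop_nhds_zero_nat (𝕜 := ℝ)).const_add 1
      rw [add_zero] at this
      exact_mod_cast (Complex.continuous_ofReal.tendsto _).comp this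
    · have : (0 : ℝ) < 1 / ((n : ℝ) + 1) := by positivity
      simp only [Set.mem_compl_iff, Set.mem_singleton_iff]
      intro h
      have h' : 1 + 1 / ((n : ℝ) + 1) = 1 := by exact_mod_cast h
      linarith
  exact hlim.frequently (Eventually.of_forall fun n => hreal _ (by positivity)).frequently

/-- The points of the vertical line through `σ`, parametrized so that Fourier inversion carries no
constants. -/
def vline (σ ξ : ℝ) : ℂ := σ + 2 * Real.pi * ξ * Complex.I

@[simp] theorem vline_re (σ ξ : ℝ) : (vline σ ξ).re = σ := by simp [vline]

@[simp] theorem vline_im (σ ξ : ℝ) : (vline σ ξ).im = 2 * Real.pi * ξ := by simp [vline]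

theorem continuous_vline (σ : ℝ) : Continuous (vline σ) := by
  unfold vline; fun_prop

theorem one_add_sq_le_norm_vline_sq {σ : ℝ} (hσ : 1 ≤ σ) (ξ : ℝ) :
    1 + ξ ^ 2 ≤ ‖vline σ ξ‖ ^ 2 := by
  rw [← Complex.normSq_eq_norm_sq, Complex.normSq_apply, vline_re, vline_im]
  have h1 : 1 ≤ 2 * Real.pi := by linarith [Real.pi_gt_three]
  have h2 : ξ * ξ ≤ (2 * Real.pi) * (2 * Real.pi) * (ξ * ξ) :=
    le_mul_of_one_le_left (mul_self_nonneg ξ) (by nlinarith)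
  nlinarith

theorem le_norm_vline {σ : ℝ} (ξ : ℝ) : σ ≤ ‖vline σ ξ‖ := by
  simpa using Complex.re_le_norm (vline σ ξ)

theorem vline_ne_zero {σ : ℝ} (hσ : 1 ≤ σ) (ξ : ℝ) : vline σ ξ ≠ 0 := by
  intro h
  have := le_norm_vline (σ := σ) ξ
  rw [h, norm_zero] at this
  linarith

theorem rpow_norm_vline_le {σ : ℝ} (hσ : 1 ≤ σ) (ξ : ℝ) {a : ℝ} (ha : 2 ≤ a) :
    ‖vline σ ξ‖ ^ (-a) ≤ (1 + ξ ^ 2)⁻¹ := by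
  have h1 : 1 ≤ ‖vline σ ξ‖ := hσ.trans (le_norm_vline ξ)
  calc ‖vline σ ξ‖ ^ (-a) ≤ ‖vline σ ξ‖ ^ (-2 : ℝ) :=
        Real.rpow_le_rpow_of_exponent_le h1 (by linarith)
    _ = (‖vline σ ξ‖ ^ 2)⁻¹ := by
        rw [Real.rpow_neg (by linarith)]; norm_cast
    _ ≤ _ := inv_anti₀ (by positivity) (one_add_sq_le_norm_vline_sq hσ ξ)

theorem continuous_vline_cpow {σ : ℝ} (hσ : 1 ≤ σ) (c : ℂ) :
    Continuous fun ξ => vline σ ξ ^ c := by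
  rw [continuous_iff_continuousAt]
  intro ξ
  exact ContinuousAt.comp (g := fun z : ℂ => z ^ c)
    (continuousAt_cpow_const (Or.inl (by rw [vline_re]; linarith)))
    (continuous_vline σ).continuousAt

theorem norm_exp_vline (σ ξ : ℝ) : ‖Complex.exp (vline σ ξ)‖ = Real.exp σ := by
  rw [Complex.norm_exp, vline_re]

open MeasureTheory in
theorem integrable_exp_mul_vline_cpow {σ : ℝ} (hσ : 1 ≤ σ) {a : ℝ} (ha : 2 ≤ a) :
    Integrable fun ξ => Complex.exp (vline σ ξ) * vline σ ξ ^ (-a : ℂ) := by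
  refine Integrable.mono' (integrable_inv_one_add_sq.const_mul (Real.exp σ)) ?_
    (Eventually.of_forall fun ξ => ?_)
  · exact ((Complex.continuous_exp.comp (continuous_vline σ)).mul
      (continuous_vline_cpow hσ _)).aestronglyMeasurable
  · rw [norm_mul, norm_exp_vline, ← Complex.ofReal_neg, Complex.norm_cpow_real]
    exact mul_le_mul_of_nonneg_left (rpow_norm_vline_le hσ ξ ha) (Real.exp_pos _).le

open MeasureTheory FourierTransform in
/-- Hankel's formula for the reciprocal Gamma function on a vertical line. -/
theorem integral_exp_mul_vline_cpow {σ : ℝ} (hσ : 1 ≤ σ) {a : ℝ} (ha : 2 ≤ a) :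
    ∫ ξ, Complex.exp (vline σ ξ) * vline σ ξ ^ (-a : ℂ) = ((Real.Gamma a)⁻¹ : ℝ) := by
  have hσ0 : 0 < σ := by linarith
  have hΓ : 0 < Real.Gamma a := Real.Gamma_pos_of_pos (by linarith)
  set g : ℝ → ℂ := fun t => ((t ^ (a - 1) : ℝ) : ℂ) * Complex.exp (-(σ * t)) with hg
  set f : ℝ → ℂ := (Set.Ioi (0 : ℝ)).indicator g with hf
  have hgint : IntegrableOn g (Set.Ioi 0) := by
    have h1 := integrableOn_rpow_mul_exp_neg_mul_rpow (s := a - 1) (p := 1) (b := σ) (by linarith)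
      one_pos hσ0
    have h2 := h1.ofReal (𝕜 := ℂ)
    refine h2.congr (Eventually.of_forall fun t => ?_)
    simp [hg]
  have hfint : Integrable f := (integrable_indicator_iff measurableSet_Ioi).2 hgint
  have hF : ∀ ξ, 𝓕 f ξ = Real.Gamma a * vline σ ξ ^ (-a : ℂ) := by
    intro ξ
    rw [Real.fourier_real_eq_integral_exp_smul,
      ← integral_rpow_mul_cexp_neg_mul_Ioi (by linarith : 1 ≤ a)
        (show 0 < (vline σ ξ).re by rwa [vline_re]), ← integral_indicator measurableSet_Ioi]
    congr 1
    funext t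
    rw [hf]
    by_cases ht : t ∈ Set.Ioi (0 : ℝ)
    · rw [Set.indicator_of_mem ht, Set.indicator_of_mem ht, hg, smul_eq_mul]
      simp only
      rw [mul_left_comm, ← Complex.exp_add]
      congr 2
      rw [vline]
      push_cast
      ring
    · rw [Set.indicator_of_notMem ht, Set.indicator_of_notMem ht, smul_zero]
  have hFint : Integrable (𝓕 f) := by
    have h1 := (integrable_inv_one_add_sq).const_mul (Real.Gamma a)
    refine Integrable.mono' h1 ?_ (Eventually.of_forall fun ξ => ?_)
    · have : 𝓕 f = fun ξ => Real.Gamma a * vline σ ξ ^ (-a : ℂ) := funext hF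
      rw [this]
      exact (continuous_const.mul (continuous_vline_cpow hσ _)).aestronglyMeasurable
    · rw [hF, norm_mul, Complex.norm_real, Real.norm_of_nonneg hΓ.le, ← Complex.ofReal_neg,
        Complex.norm_cpow_real]
      exact mul_le_mul_of_nonneg_left (rpow_norm_vline_le hσ ξ ha) hΓ.le
  have hcont : ContinuousAt f 1 := by
    have h1 : f =ᶠ[nhds 1] g := by
      filter_upwards [lt_mem_nhds (one_pos (α := ℝ))] with t ht
      exact Set.indicator_of_mem (Set.mem_Ioi.2 ht) g
    refine ContinuousAt.congr ?_ h1.symm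
    refine ContinuousAt.mul ?_ (by fun_prop)
    exact Complex.continuous_ofReal.continuousAt.comp
      (Real.continuousAt_rpow_const 1 (a - 1) (Or.inl one_ne_zero))
  have hinv := hfint.fourierInv_fourier_eq hFint hcont
  rw [Real.fourierInv_eq'] at hinv
  have hf1 : f 1 = Complex.exp (-σ) := by
    rw [hf, Set.indicator_of_mem (Set.mem_Ioi.2 one_pos), hg]
    simp
  rw [hf1] at hinv
  have hmul : ∫ ξ, Complex.exp (vline σ ξ) * vline σ ξ ^ (-a : ℂ) =
      ((Real.Gamma a)⁻¹ : ℝ) * Complex.exp σ *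
        ∫ v : ℝ, Complex.exp (((2 * Real.pi * inner ℝ v 1 : ℝ) : ℂ) * Complex.I) • 𝓕 f v := by
    rw [← integral_const_mul]
    congr 1
    funext ξ
    have hΓ' : (Real.Gamma a : ℂ) ≠ 0 := by exact_mod_cast hΓ.ne'
    rw [hF, smul_eq_mul, show vline σ ξ = (σ : ℂ) + 2 * Real.pi * ξ * Complex.I from rfl,
      Complex.exp_add]
    rw [RCLike.inner_apply, conj_trivial, one_mul]
    push_cast
    field_simp
  rw [hmul, hinv, mul_assoc, ← Complex.exp_add, add_neg_cancel, Complex.exp_zero, mul_one]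

/-! ### An entire function of Mittag-Leffler type -/

/-- Coefficients of `z ↦ ∑ (-z) ^ n / Γ ((1 + κ) n + 3)`. -/
def mlCoeff (κ : ℝ) (n : ℕ) : ℝ := (Real.Gamma ((1 + κ) * n + 3))⁻¹

/-- The Mittag-Leffler type function `z ↦ ∑ (-z) ^ n / Γ ((1 + κ) n + 3)`. The shift `3` makes all
integrals over vertical lines in the argument absolutely convergent. -/
def mlFun (κ : ℝ) : ℂ → ℂ :=
  (FormalMultilinearSeries.ofScalars ℂ fun n => (-1 : ℂ) ^ n * mlCoeff κ n).sum

theorem mlCoeff_pos {κ : ℝ} (hκ : 0 ≤ κ) (n : ℕ) : 0 < mlCoeff κ n :=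
  inv_pos.2 (Real.Gamma_pos_of_pos (by positivity))

theorem mlCoeff_le {κ : ℝ} (hκ : 0 ≤ κ) (n : ℕ) : mlCoeff κ n ≤ (n.factorial : ℝ)⁻¹ := by
  have hf : (0 : ℝ) < n.factorial := by exact_mod_cast n.factorial_pos
  refine inv_anti₀ hf ?_
  have h1 : (n.factorial : ℝ) ≤ (n + 2).factorial := by
    exact_mod_cast Nat.factorial_le (by omega)
  have h2 : Real.Gamma ((n + 2 : ℕ) + 1) ≤ Real.Gamma ((1 + κ) * n + 3) := by
    have hn : (0 : ℝ) ≤ n := n.cast_nonneg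
    have h3 : 0 ≤ κ * n := by positivity
    refine Real.Gamma_strictMonoOn_Ici.monotoneOn ?_ ?_ ?_
    · rw [Set.mem_Ici]; push_cast; linarith
    · rw [Set.mem_Ici]; nlinarith
    · push_cast; nlinarith
  rw [Real.Gamma_nat_eq_factorial] at h2
  exact h1.trans h2

/-- A lower bound of `Γ ((1 + κ) n + 3)⁻¹`, by log-convexity of the Gamma function between `n + 3`
and `2 n + 3`, where it is a factorial. -/
theorem gevrey_neg_le_mlCoeff {κ : ℝ} (hκ0 : 0 ≤ κ) (hκ1 : κ < 1) {n : ℕ} (hn : 1 ≤ n) :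
    gevrey (-κ) n ≤ 96 ^ n * (n.factorial * mlCoeff κ n) := by
  have hf : (0 : ℝ) < n.factorial := by exact_mod_cast n.factorial_pos
  have hn' : (0 : ℝ) < n := by exact_mod_cast hn
  have hn1 : (1 : ℝ) ≤ n := by exact_mod_cast hn
  have h96 : Real.log (96 ^ n) = n * Real.log 96 := Real.log_pow _ _
  have hpow : (n : ℝ) ≤ 2 ^ n := by exact_mod_cast n.lt_two_pow_self.le
  have hsq : (n : ℝ) ^ 2 ≤ 4 ^ n := by
    calc (n : ℝ) ^ 2 ≤ (2 ^ n) ^ 2 := pow_le_pow_left₀ hn'.le hpow 2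
      _ = 4 ^ n := by rw [← pow_mul, mul_comm, pow_mul]; norm_num
  have h12 : (12 : ℝ) * n ^ 2 ≤ 48 ^ n := by
    calc (12 : ℝ) * n ^ 2 ≤ 12 ^ n * 4 ^ n :=
          mul_le_mul (le_self_pow₀ (by norm_num) (by omega)) hsq (by positivity) (by positivity)
      _ = 48 ^ n := by rw [← mul_pow]; norm_num
  have hG1 : Real.Gamma (n + 3) = (n + 2).factorial := by
    rw [← Real.Gamma_nat_eq_factorial]; push_cast; ring_nf
  have hG2 : Real.Gamma (2 * n + 3) = (2 * n + 2).factorial := by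
    rw [← Real.Gamma_nat_eq_factorial]; push_cast; ring_nf
  have hb1 : ((n + 2).factorial : ℝ) ≤ 96 ^ n * n.factorial := by
    rw [Nat.factorial_succ, Nat.factorial_succ]
    push_cast
    rw [← mul_assoc]
    refine mul_le_mul_of_nonneg_right ?_ hf.le
    calc ((n : ℝ) + 1 + 1) * (n + 1) ≤ 12 * n ^ 2 := by nlinarith
      _ ≤ 48 ^ n := h12
      _ ≤ 96 ^ n := pow_le_pow_left₀ (by norm_num) (by norm_num) n
  have hb2 : ((2 * n + 2).factorial : ℝ) ≤ 96 ^ n * (n.factorial * n ^ n) := by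
    have h1 : ((2 * n).factorial : ℝ) ≤ n.factorial * (2 * n) ^ n := by
      have := Nat.ascFactorial_le_pow_add n n
      have h3 := Nat.factorial_mul_ascFactorial n n
      rw [← two_mul] at this h3
      rw [← h3]
      exact_mod_cast Nat.mul_le_mul_left _ this
    rw [Nat.factorial_succ, Nat.factorial_succ]
    push_cast
    calc (2 * (n : ℝ) + 1 + 1) * ((2 * n + 1) * (2 * n).factorial)
        ≤ (12 * n ^ 2) * (n.factorial * (2 * n) ^ n) := by
          rw [← mul_assoc]
          refine mul_le_mul (by nlinarith) h1 (by positivity) (by positivity)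
      _ ≤ 48 ^ n * (n.factorial * (2 * n) ^ n) :=
          mul_le_mul_of_nonneg_right h12 (by positivity)
      _ = _ := by rw [show (96 : ℝ) = 48 * 2 by norm_num, mul_pow, mul_pow]; ring
  have hconv : Real.Gamma ((1 + κ) * n + 3) ≤
      ((n + 2).factorial : ℝ) ^ (1 - κ) * ((2 * n + 2).factorial : ℝ) ^ κ := by
    rcases hκ0.eq_or_lt with rfl | hκ
    · rw [← hG1]; simp
    · have := Real.Gamma_mul_add_mul_le_rpow_Gamma_mul_rpow_Gamma (s := n + 3) (t := 2 * n + 3)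
        (a := 1 - κ) (b := κ) (by positivity) (by positivity) (by linarith) hκ (by ring)
      rwa [hG1, hG2, show (1 - κ) * ((n : ℝ) + 3) + κ * (2 * n + 3) = (1 + κ) * n + 3 by ring]
        at this
  have hΓ : 0 < Real.Gamma ((1 + κ) * n + 3) := Real.Gamma_pos_of_pos (by positivity)
  have hp1 : (0 : ℝ) < (n + 2).factorial := by exact_mod_cast (n + 2).factorial_pos
  have hp2 : (0 : ℝ) < (2 * n + 2).factorial := by exact_mod_cast (2 * n + 2).factorial_pos
  have hl1 := Real.log_le_log hp1 hb1
  have hl2 := Real.log_le_log hp2 hb2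
  have hl3 := Real.log_le_log hΓ hconv
  rw [Real.log_mul (by positivity) hf.ne', h96] at hl1
  rw [Real.log_mul (by positivity) (by positivity), Real.log_mul hf.ne' (by positivity), h96,
    Real.log_pow] at hl2
  rw [Real.log_mul (by positivity) (by positivity), Real.log_rpow hp1, Real.log_rpow hp2] at hl3
  have hc := mlCoeff_pos hκ0 n
  rw [← Real.log_le_log_iff (gevrey_pos _ _) (by positivity), log_gevrey,
    Real.log_mul (by positivity) (by positivity), Real.log_mul hf.ne' hc.ne', h96, mlCoeff,
    Real.log_inv]
  have e1 := mul_le_mul_of_nonneg_left hl1 (by linarith : 0 ≤ 1 - κ)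
  have e2 := mul_le_mul_of_nonneg_left hl2 hκ0
  linarith

theorem mlFun_hasFPowerSeriesOnBall {κ : ℝ} (hκ : 0 ≤ κ) :
    HasFPowerSeriesOnBall (mlFun κ)
      (FormalMultilinearSeries.ofScalars ℂ fun n => (-1 : ℂ) ^ n * mlCoeff κ n) 0 ⊤ := by
  have hr : (FormalMultilinearSeries.ofScalars ℂ
      fun n => (-1 : ℂ) ^ n * mlCoeff κ n).radius = ⊤ := by
    refine FormalMultilinearSeries.radius_eq_top_of_summable_norm _ fun r => ?_
    refine Summable.of_nonneg_of_le (fun n => by positivity) (fun n => ?_)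
      (Real.summable_pow_div_factorial r)
    rw [FormalMultilinearSeries.ofScalars_norm, norm_mul, norm_pow, norm_neg, norm_one, one_pow,
      one_mul, Complex.norm_real, Real.norm_of_nonneg (mlCoeff_pos hκ n).le, div_eq_inv_mul]
    exact mul_le_mul_of_nonneg_right (mlCoeff_le hκ n) (by positivity)
  have := FormalMultilinearSeries.hasFPowerSeriesOnBall
    (FormalMultilinearSeries.ofScalars ℂ fun n => (-1 : ℂ) ^ n * mlCoeff κ n) (by rw [hr]; simp)
  rwa [hr] at this

theorem differentiable_mlFun {κ : ℝ} (hκ : 0 ≤ κ) : Differentiable ℂ (mlFun κ) := fun z =>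
  ((mlFun_hasFPowerSeriesOnBall hκ).analyticAt_of_mem (by simp)).differentiableAt

theorem hasSum_mlFun {κ : ℝ} (hκ : 0 ≤ κ) (z : ℂ) :
    HasSum (fun n : ℕ => (-z) ^ n * (mlCoeff κ n : ℂ)) (mlFun κ z) := by
  have h := (mlFun_hasFPowerSeriesOnBall hκ).hasSum (y := z) (by simp)
  rw [zero_add] at h
  convert! h using 1
  funext n
  rw [FormalMultilinearSeries.ofScalars_apply_eq, smul_eq_mul, neg_pow]
  ring

theorem iteratedDeriv_mlFun_zero {κ : ℝ} (hκ : 0 ≤ κ) (n : ℕ) :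
    iteratedDeriv n (mlFun κ) 0 = (-1) ^ n * ((n.factorial * mlCoeff κ n : ℝ) : ℂ) := by
  have h := (mlFun_hasFPowerSeriesOnBall hκ).hasFPowerSeriesAt
  have h' := (h.analyticAt).hasFPowerSeriesAt
  have heq := congrArg (FormalMultilinearSeries.coeff · n) (h'.eq_formalMultilinearSeries h)
  simp only [FormalMultilinearSeries.coeff_ofScalars] at heq
  have hf : (n.factorial : ℂ) ≠ 0 := by exact_mod_cast n.factorial_ne_zero
  rw [div_eq_iff hf] at heq
  rw [heq]
  push_cast
  ring

/-- The values `s ^ (1 + κ)`, `Re s > 0`, stay away from the negative of the sector. -/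
theorem norm_rpow_mul_re_le {κ : ℝ} (hκ0 : 0 ≤ κ) {s z : ℂ} (hs : 0 < s.re)
    (hz : z ∈ sector (1 - κ)) :
    ‖s‖ ^ κ * s.re ≤ ‖s ^ ((1 + κ : ℝ) : ℂ) + z‖ := by
  have hs0 : s ≠ 0 := by rintro rfl; simp at hs
  have hφ : |s.arg| < Real.pi / 2 := Complex.abs_arg_lt_pi_div_two_iff.2 (Or.inl hs)
  obtain ⟨h1, h2⟩ := abs_lt.1 hφ
  obtain ⟨h3, h4⟩ := abs_lt.1 hz.2
  have hnorm : ‖Complex.exp ((-(κ * s.arg) : ℝ) * Complex.I)‖ = 1 :=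
    Complex.norm_exp_ofReal_mul_I _
  calc ‖s‖ ^ κ * s.re = ‖s‖ ^ (1 + κ) * Real.cos s.arg := by
        rw [Real.rpow_add (norm_pos_iff.2 hs0), Real.rpow_one, ← Complex.norm_mul_cos_arg s]; ring
    _ ≤ ‖s‖ ^ (1 + κ) * Real.cos ((1 + κ) * s.arg + -(κ * s.arg)) +
          ‖z‖ * Real.cos (z.arg + -(κ * s.arg)) := by
        rw [show (1 + κ) * s.arg + -(κ * s.arg) = s.arg by ring]
        refine le_add_of_nonneg_right (mul_nonneg (norm_nonneg _) ?_)
        exact Real.cos_nonneg_of_mem_Icc ⟨by nlinarith, by nlinarith⟩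
    _ = ((s ^ ((1 + κ : ℝ) : ℂ) + z) * Complex.exp ((-(κ * s.arg) : ℝ) * Complex.I)).re := by
        rw [add_mul (s ^ _), Complex.add_re, re_cpow_mul_exp, re_mul_exp]
    _ ≤ ‖(s ^ ((1 + κ : ℝ) : ℂ) + z) * Complex.exp ((-(κ * s.arg) : ℝ) * Complex.I)‖ :=
        Complex.re_le_norm _
    _ = _ := by rw [norm_mul, hnorm, mul_one]

/-- The integrand of the Hankel representation of `mlFun`. -/
def mlIntegrand (κ σ : ℝ) (z : ℂ) (ξ : ℝ) : ℂ :=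
  Complex.exp (vline σ ξ) * vline σ ξ ^ ((κ - 2 : ℝ) : ℂ) /
    (vline σ ξ ^ ((1 + κ : ℝ) : ℂ) + z)

section Representation

variable {κ σ : ℝ}

/-- The denominator of `mlIntegrand` is bounded below on a neighbourhood of the sector. -/
theorem norm_rpow_mul_half_le (hκ0 : 0 ≤ κ) (hσ : 1 ≤ σ) {z : ℂ}
    (hz : z ∈ Metric.thickening (σ ^ (1 + κ) / 2) (sector (1 - κ))) (ξ : ℝ) :
    ‖vline σ ξ‖ ^ κ * σ / 2 ≤ ‖vline σ ξ ^ ((1 + κ : ℝ) : ℂ) + z‖ := by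
  obtain ⟨w, hw, hzw⟩ := Metric.mem_thickening_iff.1 hz
  have h1 := norm_rpow_mul_re_le hκ0 (s := vline σ ξ) (by rw [vline_re]; linarith) hw
  rw [vline_re] at h1
  have h2 : σ ^ (1 + κ) ≤ ‖vline σ ξ‖ ^ κ * σ := by
    rw [Real.rpow_add (by linarith), Real.rpow_one, mul_comm]
    exact mul_le_mul_of_nonneg_right
      (Real.rpow_le_rpow (by linarith) (le_norm_vline ξ) hκ0) (by linarith)
  have h3 : ‖vline σ ξ ^ ((1 + κ : ℝ) : ℂ) + w‖ ≤
      ‖vline σ ξ ^ ((1 + κ : ℝ) : ℂ) + z‖ + dist z w := by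
    rw [dist_eq_norm, ← norm_neg (z - w)]
    refine le_trans (le_of_eq ?_) (norm_add_le _ _)
    congr 1; ring
  linarith

theorem norm_exp_mul_vline_cpow (c ξ : ℝ) :
    ‖Complex.exp (vline σ ξ) * vline σ ξ ^ (c : ℂ)‖ = Real.exp σ * ‖vline σ ξ‖ ^ c := by
  rw [norm_mul, norm_exp_vline, Complex.norm_cpow_real]

theorem norm_mlIntegrand_le (hκ0 : 0 ≤ κ) (hσ : 1 ≤ σ) {z : ℂ}
    (hz : z ∈ Metric.thickening (σ ^ (1 + κ) / 2) (sector (1 - κ))) (ξ : ℝ) :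
    ‖mlIntegrand κ σ z ξ‖ ≤ 2 * Real.exp σ * (1 + ξ ^ 2)⁻¹ := by
  have hs : 0 < ‖vline σ ξ‖ := norm_pos_iff.2 (vline_ne_zero hσ ξ)
  have hden := norm_rpow_mul_half_le hκ0 hσ hz ξ
  have hd0 : 0 < ‖vline σ ξ‖ ^ κ * σ / 2 := by positivity
  rw [mlIntegrand, norm_div, norm_exp_mul_vline_cpow]
  calc Real.exp σ * ‖vline σ ξ‖ ^ (κ - 2) / ‖vline σ ξ ^ ((1 + κ : ℝ) : ℂ) + z‖
      ≤ Real.exp σ * ‖vline σ ξ‖ ^ (κ - 2) / (‖vline σ ξ‖ ^ κ * σ / 2) :=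
        div_le_div_of_nonneg_left (by positivity) hd0 hden
    _ = 2 * Real.exp σ * ‖vline σ ξ‖ ^ (-2 : ℝ) / σ := by
        rw [show κ - 2 = κ + -2 by ring, Real.rpow_add hs]; field_simp
    _ ≤ 2 * Real.exp σ * ‖vline σ ξ‖ ^ (-2 : ℝ) := div_le_self (by positivity) hσ
    _ ≤ _ := mul_le_mul_of_nonneg_left (rpow_norm_vline_le hσ ξ le_rfl) (by positivity)

/-- Continuity of `mlIntegrand` (`k = 1`) and of its derivative in `z` (`k = 2`) along the line. -/
theorem continuous_mlIntegrand (hκ0 : 0 ≤ κ) (hσ : 1 ≤ σ) {z : ℂ}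
    (hz : z ∈ Metric.thickening (σ ^ (1 + κ) / 2) (sector (1 - κ))) (k : ℕ) :
    Continuous fun ξ => Complex.exp (vline σ ξ) * vline σ ξ ^ ((κ - 2 : ℝ) : ℂ) /
      (vline σ ξ ^ ((1 + κ : ℝ) : ℂ) + z) ^ k := by
  refine Continuous.div ((Complex.continuous_exp.comp (continuous_vline σ)).mul
    (continuous_vline_cpow hσ _)) (((continuous_vline_cpow hσ _).add continuous_const).pow k)
    fun ξ => ?_
  have hs : 0 < ‖vline σ ξ‖ := norm_pos_iff.2 (vline_ne_zero hσ ξ)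
  have hden := norm_rpow_mul_half_le hκ0 hσ hz ξ
  have hd0 : 0 < ‖vline σ ξ‖ ^ κ * σ / 2 := by positivity
  exact pow_ne_zero _ (norm_pos_iff.1 (hd0.trans_le hden))

open MeasureTheory in
theorem integrable_mlIntegrand (hκ0 : 0 ≤ κ) (hσ : 1 ≤ σ) {z : ℂ}
    (hz : z ∈ Metric.thickening (σ ^ (1 + κ) / 2) (sector (1 - κ))) :
    Integrable (mlIntegrand κ σ z) := by
  refine Integrable.mono' (integrable_inv_one_add_sq.const_mul (2 * Real.exp σ)) ?_
    (Eventually.of_forall (norm_mlIntegrand_le hκ0 hσ hz))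
  have := continuous_mlIntegrand hκ0 hσ hz 1
  simp only [pow_one] at this
  exact this.aestronglyMeasurable

open MeasureTheory in
theorem differentiableOn_integral_mlIntegrand (hκ0 : 0 ≤ κ) (hσ : 1 ≤ σ) :
    DifferentiableOn ℂ (fun z => ∫ ξ, mlIntegrand κ σ z ξ)
      (Metric.thickening (σ ^ (1 + κ) / 2) (sector (1 - κ))) := by
  intro z hz
  refine DifferentiableAt.differentiableWithinAt ?_
  have hnhds := Metric.isOpen_thickening.mem_nhds hz
  have hne : ∀ x ∈ Metric.thickening (σ ^ (1 + κ) / 2) (sector (1 - κ)), ∀ ξ,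
      0 < ‖vline σ ξ‖ ^ κ * σ / 2 := fun x hx ξ => by
    have hs : 0 < ‖vline σ ξ‖ := norm_pos_iff.2 (vline_ne_zero hσ ξ)
    positivity
  refine (hasDerivAt_integral_of_dominated_loc_of_deriv_le
    (F' := fun z ξ => -(Complex.exp (vline σ ξ) * vline σ ξ ^ ((κ - 2 : ℝ) : ℂ) /
      (vline σ ξ ^ ((1 + κ : ℝ) : ℂ) + z) ^ 2))
    (bound := fun ξ => 4 * Real.exp σ * (1 + ξ ^ 2)⁻¹) hnhds ?_
    (integrable_mlIntegrand hκ0 hσ hz)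
    (continuous_mlIntegrand hκ0 hσ hz 2).neg.aestronglyMeasurable
    (Eventually.of_forall fun ξ x hx => ?_)
    (integrable_inv_one_add_sq.const_mul _)
    (Eventually.of_forall fun ξ x hx => ?_)).2.differentiableAt
  · filter_upwards [hnhds] with x hx
    exact (integrable_mlIntegrand hκ0 hσ hx).aestronglyMeasurable
  · have hs : 0 < ‖vline σ ξ‖ := norm_pos_iff.2 (vline_ne_zero hσ ξ)
    have hden := norm_rpow_mul_half_le hκ0 hσ hx ξ
    have hd0 := hne x hx ξ
    rw [norm_neg, norm_div, norm_exp_mul_vline_cpow, norm_pow]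
    calc Real.exp σ * ‖vline σ ξ‖ ^ (κ - 2) / ‖vline σ ξ ^ ((1 + κ : ℝ) : ℂ) + x‖ ^ 2
        ≤ Real.exp σ * ‖vline σ ξ‖ ^ (κ - 2) / (‖vline σ ξ‖ ^ κ * σ / 2) ^ 2 :=
          div_le_div_of_nonneg_left (by positivity) (by positivity)
            (pow_le_pow_left₀ hd0.le hden 2)
      _ = 4 * Real.exp σ * ‖vline σ ξ‖ ^ (-(2 + κ)) / σ ^ 2 := by
          have h1 : ‖vline σ ξ‖ ^ (κ - 2) = ‖vline σ ξ‖ ^ (-(2 + κ)) * (‖vline σ ξ‖ ^ κ) ^ 2 := by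
            rw [← Real.rpow_natCast, ← Real.rpow_mul hs.le, ← Real.rpow_add hs]
            congr 1; push_cast; ring
          rw [h1]; field_simp; ring
      _ ≤ 4 * Real.exp σ * ‖vline σ ξ‖ ^ (-(2 + κ)) :=
          div_le_self (by positivity) (one_le_pow₀ hσ)
      _ ≤ _ := mul_le_mul_of_nonneg_left (rpow_norm_vline_le hσ ξ (by linarith)) (by positivity)
  · have hden := norm_rpow_mul_half_le hκ0 hσ hx ξ
    have hd0 := hne x hx ξ
    have hx0 : vline σ ξ ^ ((1 + κ : ℝ) : ℂ) + x ≠ 0 := norm_pos_iff.1 (hd0.trans_le hden)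
    have h1 := ((hasDerivAt_id x).const_add (vline σ ξ ^ ((1 + κ : ℝ) : ℂ))).inv hx0
    have h2 := h1.const_mul (Complex.exp (vline σ ξ) * vline σ ξ ^ ((κ - 2 : ℝ) : ℂ))
    convert! h2 using 1
    rw [id]
    ring

open MeasureTheory in
/-- Near the origin the integrand expands into a geometric series, which Hankel's formula
integrates term by term. -/
theorem mlFun_eq_integral_of_norm_lt (hκ0 : 0 ≤ κ) (hσ : 1 ≤ σ) {z : ℂ}
    (hz : ‖z‖ < σ ^ (1 + κ) / 2) : mlFun κ z = ∫ ξ, mlIntegrand κ σ z ξ := by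
  set T : ℕ → ℝ → ℂ := fun n ξ =>
    (-z) ^ n * (Complex.exp (vline σ ξ) * vline σ ξ ^ (-(((1 + κ) * n + 3 : ℝ) : ℂ))) with hT
  have hσ0 : 0 < σ := by linarith
  have h2 : ∀ n : ℕ, 2 ≤ (1 + κ) * n + 3 := fun n => by
    have : 0 ≤ (1 + κ) * n := by positivity
    linarith
  have hTint : ∀ n, Integrable (T n) := fun n =>
    (integrable_exp_mul_vline_cpow hσ (h2 n)).const_mul _
  have hTval : ∀ n, ∫ ξ, T n ξ = (-z) ^ n * (mlCoeff κ n : ℂ) := by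
    intro n
    rw [hT]
    simp only
    rw [integral_const_mul, integral_exp_mul_vline_cpow hσ (h2 n), mlCoeff]
  have hR : 0 < σ ^ (1 + κ) := by positivity
  have hTnorm : ∀ n ξ, ‖T n ξ‖ ≤ (1 / 2) ^ n * (Real.exp σ * (1 + ξ ^ 2)⁻¹) := by
    intro n ξ
    have hs : 0 < ‖vline σ ξ‖ := norm_pos_iff.2 (vline_ne_zero hσ ξ)
    rw [hT]
    simp only
    rw [norm_mul, norm_pow, norm_neg, ← Complex.ofReal_neg, norm_exp_mul_vline_cpow]
    have h1 : ‖vline σ ξ‖ ^ (-((1 + κ) * n + 3)) ≤ ((σ ^ (1 + κ)) ^ n)⁻¹ * (1 + ξ ^ 2)⁻¹ := by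
      rw [neg_add, Real.rpow_add hs]
      refine mul_le_mul ?_ (rpow_norm_vline_le hσ ξ (by norm_num)) (by positivity) (by positivity)
      rw [Real.rpow_neg hs.le, Real.rpow_mul hs.le, Real.rpow_natCast]
      refine inv_anti₀ (by positivity) (pow_le_pow_left₀ hR.le ?_ n)
      exact Real.rpow_le_rpow hσ0.le (le_norm_vline ξ) (by linarith)
    have h3 : ‖z‖ ^ n * ((σ ^ (1 + κ)) ^ n)⁻¹ ≤ (1 / 2) ^ n := by
      rw [← div_eq_mul_inv, ← div_pow]
      refine pow_le_pow_left₀ (by positivity) ?_ n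
      rw [div_le_iff₀ hR]; linarith
    calc ‖z‖ ^ n * (Real.exp σ * ‖vline σ ξ‖ ^ (-((1 + κ) * n + 3)))
        ≤ ‖z‖ ^ n * (Real.exp σ * (((σ ^ (1 + κ)) ^ n)⁻¹ * (1 + ξ ^ 2)⁻¹)) := by gcongr
      _ = (‖z‖ ^ n * ((σ ^ (1 + κ)) ^ n)⁻¹) * (Real.exp σ * (1 + ξ ^ 2)⁻¹) := by ring
      _ ≤ _ := mul_le_mul_of_nonneg_right h3 (by positivity)
  have hsum : Summable fun n => ∫ ξ, ‖T n ξ‖ := by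
    refine Summable.of_nonneg_of_le (fun n => integral_nonneg fun ξ => norm_nonneg _)
      (fun n => ?_) ((summable_geometric_of_lt_one (by norm_num : (0 : ℝ) ≤ 1 / 2)
        (by norm_num)).mul_right (∫ ξ, Real.exp σ * (1 + ξ ^ 2)⁻¹))
    rw [← integral_const_mul]
    exact integral_mono (hTint n).norm ((integrable_inv_one_add_sq.const_mul _).const_mul _)
      (hTnorm n)
  have hpt : ∀ ξ, ∑' n, T n ξ = mlIntegrand κ σ z ξ := by
    intro ξ
    have hs0 := vline_ne_zero hσ ξ
    have hs : 0 < ‖vline σ ξ‖ := norm_pos_iff.2 hs0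
    set s := vline σ ξ with hsdef
    set W : ℂ := s ^ ((1 + κ : ℝ) : ℂ) with hW
    have hWn : σ ^ (1 + κ) ≤ ‖W‖ := by
      rw [hW, Complex.norm_cpow_real]
      exact Real.rpow_le_rpow hσ0.le (le_norm_vline ξ) (by linarith)
    have hW0 : W ≠ 0 := norm_pos_iff.1 (hR.trans_le hWn)
    have hratio : ‖-z / W‖ < 1 := by
      rw [norm_div, norm_neg, div_lt_one (hR.trans_le hWn)]
      linarith
    have hterm : ∀ n, T n ξ = Complex.exp s * s ^ (-3 : ℂ) * (-z / W) ^ n := by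
      intro n
      rw [hT]
      simp only
      have : s ^ (-(((1 + κ) * n + 3 : ℝ) : ℂ)) = (W ^ n)⁻¹ * s ^ (-3 : ℂ) := by
        rw [hW, ← Complex.cpow_mul_nat, ← Complex.cpow_neg, ← Complex.cpow_add _ _ hs0]
        congr 1; push_cast; ring
      rw [this, div_pow]
      ring
    simp_rw [hterm]
    rw [tsum_mul_left, tsum_geometric_of_norm_lt_one hratio, mlIntegrand, ← hsdef, ← hW]
    have h3 : s ^ ((κ - 2 : ℝ) : ℂ) = s ^ (-3 : ℂ) * W := by
      rw [hW, ← Complex.cpow_add _ _ hs0]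
      congr 1; push_cast; ring
    have hWz : W + z ≠ 0 := by
      intro h
      have : ‖W‖ = ‖z‖ := by rw [eq_neg_of_add_eq_zero_left h, norm_neg]
      linarith
    have h4 : 1 - -z / W ≠ 0 := by
      rw [sub_ne_zero]
      intro h
      rw [← h, norm_one] at hratio
      exact lt_irrefl _ hratio
    have h5 : 1 - -z / W = (W + z) / W := by field_simp; ring
    rw [h3, h5, inv_div]
    ring
  have h := hasSum_integral_of_summable_integral_norm hTint hsum
  simp_rw [hTval, hpt] at h
  exact (hasSum_mlFun hκ0 z).unique h

theorem zero_mem_closure_sector {α : ℝ} (hα : 0 < α) : (0 : ℂ) ∈ closure (sector α) := by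
  rw [Metric.mem_closure_iff]
  intro ε hε
  refine ⟨((ε / 2 : ℝ) : ℂ), ofReal_mem_sector hα (by positivity), ?_⟩
  rw [dist_zero_left, Complex.norm_real, Real.norm_of_nonneg (by positivity)]
  linarith

open MeasureTheory in
/-- The representation extends from a neighbourhood of the origin to a neighbourhood of the sector
of width proportional to `σ ^ (1 + κ)`, on which it yields a bound of order `exp σ`. -/
theorem norm_mlFun_le (hκ0 : 0 ≤ κ) (hκ1 : κ < 1) (hσ : 1 ≤ σ) {z : ℂ}
    (hz : z ∈ Metric.thickening (σ ^ (1 + κ) / 2) (sector (1 - κ))) :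
    ‖mlFun κ z‖ ≤ 2 * Real.pi * Real.exp σ := by
  set Ω := Metric.thickening (σ ^ (1 + κ) / 2) (sector (1 - κ)) with hΩ
  have hR : 0 < σ ^ (1 + κ) / 2 := by positivity
  have hΩc : Convex ℝ Ω := (convex_sector (by linarith) (by linarith)).thickening _
  have h0 : (0 : ℂ) ∈ Ω :=
    Metric.closure_subset_thickening hR _ (zero_mem_closure_sector (by linarith))
  have heq : Set.EqOn (mlFun κ) (fun z => ∫ ξ, mlIntegrand κ σ z ξ) Ω := by
    refine AnalyticOnNhd.eqOn_of_preconnected_of_eventuallyEq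
      ((differentiable_mlFun hκ0).differentiableOn.analyticOnNhd Metric.isOpen_thickening)
      ((differentiableOn_integral_mlIntegrand hκ0 hσ).analyticOnNhd Metric.isOpen_thickening)
      hΩc.isPreconnected h0 ?_
    filter_upwards [Metric.ball_mem_nhds (0 : ℂ) hR] with w hw
    exact mlFun_eq_integral_of_norm_lt hκ0 hσ (by simpa using hw)
  rw [heq hz]
  refine (norm_integral_le_of_norm_le (integrable_inv_one_add_sq.const_mul (2 * Real.exp σ))
    (Eventually.of_forall (norm_mlIntegrand_le hκ0 hσ hz))).trans (le_of_eq ?_)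
  rw [integral_const_mul, integral_univ_inv_one_add_sq]
  ring

end Representation

/-- The derivatives of `mlFun` on the sector; the line `Re s = n` is used for the order `n`. -/
theorem norm_iteratedDeriv_mlFun_le {κ : ℝ} (hκ0 : 0 ≤ κ) (hκ1 : κ < 1) (n : ℕ) {z : ℂ}
    (hz : z ∈ sector (1 - κ)) :
    ‖iteratedDeriv n (mlFun κ) z‖ ≤
      (8 * Real.pi * Real.exp 1) ^ (n + 1) * gevrey (-κ) n := by
  have hcauchy : ∀ σ : ℝ, 1 ≤ σ → ‖iteratedDeriv n (mlFun κ) z‖ ≤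
      n.factorial * (2 * Real.pi * Real.exp σ) / (σ ^ (1 + κ) / 4) ^ n := by
    intro σ hσ
    have hR : 0 < σ ^ (1 + κ) := by positivity
    refine Complex.norm_iteratedDeriv_le_of_forall_mem_sphere_norm_le n (by positivity)
      (differentiable_mlFun hκ0).diffContOnCl fun w hw => norm_mlFun_le hκ0 hκ1 hσ ?_
    refine Metric.mem_thickening_iff.2 ⟨z, hz, ?_⟩
    rw [Metric.mem_sphere.1 hw]
    linarith
  have hπ : 3 < Real.pi := Real.pi_gt_three
  have he : 1 < Real.exp 1 := Real.one_lt_exp_iff.2 one_pos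
  rcases Nat.eq_zero_or_pos n with rfl | hn
  · refine (hcauchy 1 le_rfl).trans ?_
    simp only [Nat.factorial_zero, Nat.cast_one, one_mul, pow_zero, div_one, zero_add, pow_one,
      gevrey_zero, mul_one]
    nlinarith
  · have hn' : (0 : ℝ) < n := by exact_mod_cast hn
    have h1 := hcauchy n (by exact_mod_cast hn)
    have hfac : (n.factorial : ℝ) ≤ (n : ℝ) ^ n := by exact_mod_cast n.factorial_le_pow
    have hgev : gevrey (-κ) n = (n : ℝ) ^ n / ((n : ℝ) ^ (1 + κ)) ^ n := by
      rw [gevrey, ← Real.rpow_natCast, ← Real.rpow_natCast, ← Real.rpow_mul hn'.le,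
        ← Real.rpow_sub hn']
      congr 1; ring
    have hP : 0 < ((n : ℝ) ^ (1 + κ)) ^ n := by positivity
    refine h1.trans ?_
    rw [hgev, div_pow, div_div_eq_mul_div, mul_div_assoc', div_le_div_iff_of_pos_right hP]
    have h4 : Real.exp n = Real.exp 1 ^ n := by rw [← Real.exp_nat_mul, mul_one]
    rw [h4]
    calc n.factorial * (2 * Real.pi * Real.exp 1 ^ n) * 4 ^ n
        = (2 * Real.pi) * (4 * Real.exp 1) ^ n * n.factorial := by rw [mul_pow]; ring
      _ ≤ (8 * Real.pi * Real.exp 1) * (8 * Real.pi * Real.exp 1) ^ n * (n : ℝ) ^ n := by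
          refine mul_le_mul (mul_le_mul (by nlinarith) ?_ (by positivity) (by positivity)) hfac
            (by positivity) (by positivity)
          exact pow_le_pow_left₀ (by positivity) (by nlinarith) n
      _ = _ := by rw [pow_succ' (8 * Real.pi * Real.exp 1) n]

/-! ### Functions in the class with large derivatives at the vertex -/

theorem LogConvex.ratio_mono {L : ℕ → ℝ} (hpos : ∀ j, 0 < L j) (hL : LogConvex L) :
    Monotone fun k => L (k + 1) / L k := by
  refine monotone_nat_of_le_succ fun k => ?_
  rw [div_le_div_iff₀ (hpos _) (hpos _)]
  have := hL k
  nlinarith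

/-- A log-convex sequence lies above its tangent geometric sequences. -/
theorem LogConvex.mul_pow_le {L : ℕ → ℝ} (hpos : ∀ j, 0 < L j) (hL : LogConvex L) (k j : ℕ) :
    L k * (L (k + 1) / L k) ^ j ≤ L j * (L (k + 1) / L k) ^ k := by
  have hmono := hL.ratio_mono hpos
  have hstep : ∀ i, L (i + 1) = L i * (L (i + 1) / L i) := fun i => by
    rw [mul_div_cancel₀ _ (hpos i).ne']
  set t := L (k + 1) / L k with ht
  have ht0 : 0 < t := div_pos (hpos _) (hpos _)
  rcases le_total k j with hkj | hjk
  · induction j, hkj using Nat.le_induction with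
    | base => rfl
    | succ j hkj ih =>
      have h1 : t ≤ L (j + 1) / L j := hmono hkj
      calc L k * t ^ (j + 1) = L k * t ^ j * t := by ring
        _ ≤ L j * t ^ k * (L (j + 1) / L j) :=
            mul_le_mul ih h1 ht0.le (mul_nonneg (hpos j).le (by positivity))
        _ = L (j + 1) * t ^ k := by rw [hstep j]; field_simp [(hpos j).ne']
  · refine Nat.decreasingInduction' (P := fun j => L k * t ^ j ≤ L j * t ^ k)
      (fun i hi _ ih => ?_) hjk le_rfl
    have h1 : L (i + 1) / L i ≤ t := hmono hi.le
    refine le_of_mul_le_mul_right ?_ ht0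
    calc L k * t ^ i * t = L k * t ^ (i + 1) := by ring
      _ ≤ L (i + 1) * t ^ k := ih
      _ = L i * t ^ k * (L (i + 1) / L i) := by rw [hstep i]; field_simp [(hpos i).ne']
      _ ≤ L i * t ^ k * t :=
          mul_le_mul_of_nonneg_left h1 (mul_nonneg (hpos i).le (by positivity))

/-- A function in the class whose derivatives at the vertex of the sector alternate in sign and are
as large as the class admits up to a geometric factor. It is a superposition of dilates of
`mlFun`, the dilation factors being the ratios of the log-convex sequence `L`. -/
theorem exists_extremal {α : ℝ} (hα0 : 0 < α) (hα1 : α ≤ 1) {L N : ℕ → ℝ} (hpos : ∀ j, 0 < L j)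
    (hL : LogConvex L) (hN : ∀ j, N j = gevrey (-(1 - α)) j * L j) :
    ∃ f ∈ roumieuClass N (sector α), ∃ x : ℕ → ℝ, (∀ j, 0 ≤ x j) ∧
      (∀ j, 1 ≤ j → N j ≤ 192 ^ j * x j) ∧
      ∀ j, Tendsto (iteratedDeriv j f) (nhdsWithin 0 (sector α))
        (nhds ((-1) ^ j * (x j : ℂ))) := by
  set κ := 1 - α with hκ
  have hκ0 : 0 ≤ κ := by linarith
  have hκ1 : κ < 1 := by linarith
  have hακ : α = 1 - κ := by rw [hκ]; ring
  set E := mlFun κ with hE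
  set S := sector α with hS
  have hSo : IsOpen S := isOpen_sector hα0 hα1
  have hSc : IsPreconnected S := (convex_sector hα0 hα1).isPreconnected
  set B := 8 * Real.pi * Real.exp 1 with hB
  have hB0 : 0 < B := by positivity
  have hEd : Differentiable ℂ E := differentiable_mlFun hκ0
  have hEderiv : ∀ j z, HasDerivAt (iteratedDeriv j E) (iteratedDeriv (j + 1) E z) z := fun j z =>
    hasDerivAt_iteratedDeriv isOpen_univ hEd.differentiableOn j (Set.mem_univ z)
  have hEcont : ∀ j, Continuous (iteratedDeriv j E) := fun j =>
    continuous_iff_continuousAt.2 fun z => (hEderiv j z).continuousAt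
  have hEbd : ∀ j, ∀ z ∈ closure S, ‖iteratedDeriv j E z‖ ≤ B ^ (j + 1) * gevrey (-κ) j := by
    intro j
    refine closure_minimal (t := {z | ‖iteratedDeriv j E z‖ ≤ B ^ (j + 1) * gevrey (-κ) j})
      (fun z hz => ?_) (isClosed_le (hEcont j).norm continuous_const)
    rw [hS, hακ] at hz
    exact norm_iteratedDeriv_mlFun_le hκ0 hκ1 j hz
  -- the function is `∑ a k * E (t k * z)`; the weight `a k * t k ^ j` is at most
  -- `2 ^ (-k) * L j`, with equality for `j = k`
  set t : ℕ → ℝ := fun k => L (k + 1) / L k with ht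
  have ht0 : ∀ k, 0 < t k := fun k => div_pos (hpos _) (hpos _)
  set a : ℕ → ℝ := fun k => (1 / 2) ^ k * (L k / t k ^ k) with ha
  have ha0 : ∀ k, 0 < a k := fun k => by
    have := hpos k
    have := ht0 k
    positivity
  have hat : ∀ k j, a k * t k ^ j ≤ (1 / 2) ^ k * L j := by
    intro k j
    rw [ha]
    simp only
    rw [mul_assoc, div_mul_eq_mul_div]
    refine mul_le_mul_of_nonneg_left ?_ (by positivity)
    rw [div_le_iff₀ (pow_pos (ht0 k) k)]
    exact hL.mul_pow_le hpos k j
  have hcl : ∀ k, ∀ z ∈ closure S, (t k : ℂ) * z ∈ closure S := by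
    intro k z hz
    have hmaps : Set.MapsTo (fun z : ℂ => (t k : ℂ) * z) S S := fun z hz =>
      ofReal_mul_mem_sector (ht0 k) hz
    exact hmaps.closure (by fun_prop) hz
  set T : ℕ → ℕ → ℂ → ℂ := fun j k z =>
    ((a k * t k ^ j : ℝ) : ℂ) * iteratedDeriv j E (t k * z) with hT
  have hTbd : ∀ j k, ∀ z ∈ closure S, ‖T j k z‖ ≤ (1 / 2) ^ k * (B ^ (j + 1) * N j) := by
    intro j k z hz
    have h0 : 0 ≤ a k * t k ^ j := mul_nonneg (ha0 k).le (pow_nonneg (ht0 k).le j)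
    rw [hT]
    simp only
    rw [norm_mul, Complex.norm_real, Real.norm_of_nonneg h0]
    calc a k * t k ^ j * ‖iteratedDeriv j E (t k * z)‖
        ≤ (1 / 2) ^ k * L j * (B ^ (j + 1) * gevrey (-κ) j) :=
          mul_le_mul (hat k j) (hEbd j _ (hcl k z hz)) (norm_nonneg _)
            (mul_nonneg (by positivity) (hpos j).le)
      _ = _ := by rw [hN]; ring
  have hsumm : ∀ j, Summable fun k : ℕ => (1 / 2 : ℝ) ^ k * (B ^ (j + 1) * N j) := fun j =>
    (summable_geometric_of_lt_one (by norm_num) (by norm_num)).mul_right _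
  set φ : ℕ → ℂ → ℂ := fun j z => ∑' k, T j k z with hφ
  have hTd : ∀ j k z, HasDerivAt (T j k) (T (j + 1) k z) z := by
    intro j k z
    have h1 : HasDerivAt (fun z : ℂ => (t k : ℂ) * z) (t k) z := by
      simpa using (hasDerivAt_id z).const_mul (t k : ℂ)
    have h2 := ((hEderiv j (t k * z)).comp z h1).const_mul ((a k * t k ^ j : ℝ) : ℂ)
    convert! h2 using 1
    rw [hT]
    simp only
    push_cast
    ring
  have hφd : ∀ j, ∀ z ∈ S, HasDerivAt (φ j) (φ (j + 1) z) z := by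
    intro j z hz
    exact hasDerivAt_tsum_of_isPreconnected (hsumm (j + 1)) hSo hSc (fun k y _ => hTd j k y)
      (fun k y hy => hTbd (j + 1) k y (subset_closure hy)) hz
      (Summable.of_norm_bounded (hsumm j) fun k => hTbd j k z (subset_closure hz)) hz
  have hiter : ∀ j, ∀ z ∈ S, iteratedDeriv j (φ 0) z = φ j z := by
    intro j
    induction j with
    | zero => intro z _; rw [iteratedDeriv_zero]
    | succ j ih =>
      intro z hz
      rw [iteratedDeriv_succ, ← (hφd j z hz).deriv]
      refine EventuallyEq.deriv_eq ?_
      filter_upwards [hSo.mem_nhds hz] with w hw using ih w hw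
  have hφbd : ∀ j, ∀ z ∈ closure S, ‖φ j z‖ ≤ 2 * (B ^ (j + 1) * N j) := by
    intro j z hz
    refine tsum_of_norm_bounded ?_ fun k => hTbd j k z hz
    have := (hasSum_geometric_of_lt_one (by norm_num : (0 : ℝ) ≤ 1 / 2) (by norm_num)).mul_right
      (B ^ (j + 1) * N j)
    rwa [show (1 - 1 / 2 : ℝ)⁻¹ = 2 by norm_num] at this
  set x : ℕ → ℝ := fun j => (j.factorial * mlCoeff κ j) * ∑' k, a k * t k ^ j with hx
  have hasum : ∀ j, Summable fun k => a k * t k ^ j := fun j =>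
    Summable.of_nonneg_of_le (fun k => mul_nonneg (ha0 k).le (pow_nonneg (ht0 k).le j))
      (fun k => hat k j) ((summable_geometric_of_lt_one (by norm_num) (by norm_num)).mul_right _)
  have hm : ∀ j : ℕ, 0 < j.factorial * mlCoeff κ j := fun j =>
    mul_pos (by exact_mod_cast j.factorial_pos) (mlCoeff_pos hκ0 j)
  refine ⟨φ 0, ⟨fun z hz => (hφd 0 z hz).differentiableAt.differentiableWithinAt, B, hB0, 2 * B,
    fun z hz j => ?_⟩, x, fun j => ?_, fun j hj => ?_, fun j => ?_⟩
  · rw [hiter j z hz]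
    refine (hφbd j z (subset_closure hz)).trans (le_of_eq ?_)
    rw [pow_succ]; ring
  · exact mul_nonneg (hm j).le
      (tsum_nonneg fun k => mul_nonneg (ha0 k).le (pow_nonneg (ht0 k).le j))
  · have h1 : a j * t j ^ j ≤ ∑' k, a k * t k ^ j :=
      (hasum j).le_tsum j fun k _ => mul_nonneg (ha0 k).le (pow_nonneg (ht0 k).le j)
    have h2 : a j * t j ^ j = (1 / 2) ^ j * L j := by
      rw [ha]
      simp only
      rw [mul_assoc, div_mul_cancel₀ _ (pow_pos (ht0 j) j).ne']
    rw [h2] at h1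
    have h3 := gevrey_neg_le_mlCoeff hκ0 hκ1 hj
    calc N j = gevrey (-κ) j * L j := hN j
      _ ≤ (96 ^ j * (j.factorial * mlCoeff κ j)) * (2 ^ j * ∑' k, a k * t k ^ j) := by
          refine mul_le_mul h3 ?_ (hpos j).le (mul_nonneg (by positivity) (hm j).le)
          calc L j = 2 ^ j * ((1 / 2) ^ j * L j) := by
                rw [← mul_assoc, ← mul_pow]; norm_num
            _ ≤ _ := mul_le_mul_of_nonneg_left h1 (by positivity)
      _ = 192 ^ j * x j := by
          rw [hx, show (192 : ℝ) = 96 * 2 by norm_num, mul_pow]; ring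
  · have h0 : (0 : ℂ) ∈ closure S := zero_mem_closure_sector hα0
    have hval : φ j 0 = (-1) ^ j * (x j : ℂ) := by
      rw [hφ, hT, hx]
      simp only [mul_zero]
      rw [tsum_mul_right, hE, iteratedDeriv_mlFun_zero hκ0, ← Complex.ofReal_tsum]
      push_cast
      ring
    have hcont : ContinuousOn (φ j) (closure S) :=
      continuousOn_tsum (fun k => (continuous_iff_continuousAt.2
        fun z => (hTd j k z).continuousAt).continuousOn) (hsumm j) fun k z hz => hTbd j k z hz
    have hlim := (hcont 0 h0).tendsto.mono_left (nhdsWithin_mono 0 (subset_closure (s := S)))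
    rw [hval] at hlim
    refine hlim.congr' ?_
    filter_upwards [self_mem_nhdsWithin] with z hz using (hiter j z hz).symm

/-! ### Inverse-closedness bounds the powers of the weights -/

theorem const_sub_mem_roumieuClass {N : ℕ → ℝ} (hN : ∀ j, 0 < N j) {S : Set ℂ} {f : ℂ → ℂ}
    (hf : f ∈ roumieuClass N S) (c : ℂ) : (fun z => c - f z) ∈ roumieuClass N S := by
  obtain ⟨hd, h, hh, C, hC⟩ := hf
  have h0 := hN 0
  refine ⟨hd.const_sub c, h, hh, C + ‖c‖ / N 0, fun z hz j => ?_⟩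
  rcases Nat.eq_zero_or_pos j with rfl | hj
  · have h1 := hC z hz 0
    simp only [iteratedDeriv_zero, pow_zero, one_mul] at h1 ⊢
    refine (norm_sub_le _ _).trans ?_
    rw [add_mul, div_mul_cancel₀ _ h0.ne']
    linarith
  · rw [iteratedDeriv_const_sub hj, iteratedDeriv_neg, norm_neg]
    refine (hC z hz j).trans (mul_le_mul_of_nonneg_right ?_ (by have := hN j; positivity))
    have : 0 ≤ ‖c‖ / N 0 := by positivity
    linarith

/-- The Leibniz recursion for the derivatives of `1 / (c - f)`. -/
theorem iteratedDeriv_succ_inv {S : Set ℂ} (hS : IsOpen S) {f : ℂ → ℂ}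
    (hf : DifferentiableOn ℂ f S) {c : ℂ} (hc : ∀ z ∈ S, c - f z ≠ 0) (k : ℕ) {z : ℂ}
    (hz : z ∈ S) :
    iteratedDeriv (k + 1) (fun z => 1 / (c - f z)) z = 1 / (c - f z) *
      ∑ i ∈ Finset.range (k + 1), ((k + 1).choose (i + 1) : ℂ) * iteratedDeriv (i + 1) f z *
        iteratedDeriv (k - i) (fun z => 1 / (c - f z)) z := by
  have hg : DifferentiableOn ℂ (fun z => c - f z) S := hf.const_sub c
  have hi : DifferentiableOn ℂ (fun z => 1 / (c - f z)) S := (differentiableOn_const 1).div hg hc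
  have h1 : ContDiffAt ℂ (k + 1 : ℕ) (fun z => c - f z) z :=
    (hg.analyticAt (hS.mem_nhds hz)).contDiffAt
  have h2 : ContDiffAt ℂ (k + 1 : ℕ) (fun z => 1 / (c - f z)) z :=
    (hi.analyticAt (hS.mem_nhds hz)).contDiffAt
  have h3 := iteratedDeriv_mul h1 h2
  have h4 : (fun z => c - f z) * (fun z => 1 / (c - f z)) =ᶠ[nhds z] fun _ => 1 := by
    filter_upwards [hS.mem_nhds hz] with w hw
    exact mul_one_div_cancel (hc w hw)
  rw [(h4.iteratedDeriv (k + 1)).eq_of_nhds, iteratedDeriv_const, if_neg (by omega),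
    Finset.sum_range_succ'] at h3
  simp only [Nat.choose_zero_right, Nat.cast_one, one_mul, iteratedDeriv_zero, Nat.sub_zero,
    Nat.add_sub_add_right] at h3
  have h5 : ∀ i, iteratedDeriv (i + 1) (fun z => c - f z) z = -iteratedDeriv (i + 1) f z := by
    intro i
    rw [iteratedDeriv_const_sub (by omega), iteratedDeriv_neg]
  simp only [h5, mul_neg, neg_mul, Finset.sum_neg_distrib] at h3
  rw [one_div, eq_comm, inv_mul_eq_iff_eq_mul₀ (hc z hz)]
  simp only [one_div] at h3 ⊢
  linear_combination h3

/-- Inversion of `c - f`, for a function `f` with large derivatives of alternating signs at the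
vertex, produces derivatives at the vertex of alternating signs, in which no cancellation occurs.
Hence products of the weights are dominated by a single weight. -/
theorem InverseClosed.pow_le {α : ℝ} (hα0 : 0 < α) (hα1 : α ≤ 1) {L N : ℕ → ℝ}
    (hpos : ∀ j, 0 < L j) (hL : LogConvex L) (hN : ∀ j, N j = gevrey (-(1 - α)) j * L j)
    (hinv : InverseClosed N (sector α)) :
    ∃ H : ℝ, 0 < H ∧
      ∀ j l : ℕ, 1 ≤ j → 1 ≤ l → check N j ^ l ≤ H ^ (j * l) * check N (j * l) := by
  have hNpos : ∀ j, 0 < N j := fun j => by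
    rw [hN]; exact mul_pos (gevrey_pos _ _) (hpos _)
  obtain ⟨f, hf, x, hx0, hNx, hlim⟩ := exists_extremal hα0 hα1 hpos hL hN
  set S := sector α with hS
  have hSo : IsOpen S := isOpen_sector hα0 hα1
  have hne : (nhdsWithin (0 : ℂ) S).NeBot :=
    mem_closure_iff_nhdsWithin_neBot.1 (zero_mem_closure_sector hα0)
  obtain ⟨A, hA⟩ : ∃ A : ℝ, ∀ z ∈ S, ‖f z‖ ≤ A := by
    obtain ⟨-, h, -, C, hC⟩ := hf
    exact ⟨_, fun z hz => by simpa using hC z hz 0⟩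
  have hxA : x 0 ≤ A := by
    have h1 := hlim 0
    simp only [iteratedDeriv_zero, pow_zero, one_mul] at h1
    have h2 : ‖(x 0 : ℂ)‖ ≤ A :=
      le_of_tendsto h1.norm (eventually_nhdsWithin_of_forall hA)
    rwa [Complex.norm_real, Real.norm_of_nonneg (hx0 0)] at h2
  set c : ℝ := A + 1 with hc
  set μ : ℝ := 1 / (c - x 0) with hμ
  have hcx : 0 < c - x 0 := by linarith
  have hμ0 : 0 < μ := by positivity
  have hcf : ∀ z ∈ S, 1 ≤ ‖(c : ℂ) - f z‖ := by
    intro z hz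
    have h1 := norm_sub_norm_le (c : ℂ) (f z)
    have h2 : c ≤ ‖(c : ℂ)‖ := by
      rw [Complex.norm_real]; exact le_abs_self c
    linarith [hA z hz]
  have hcf0 : ∀ z ∈ S, (c : ℂ) - f z ≠ 0 := fun z hz h => by
    have := hcf z hz
    rw [h, norm_zero] at this
    linarith
  set u : ℂ → ℂ := fun z => 1 / ((c : ℂ) - f z) with hu
  have hucl : u ∈ roumieuClass N S :=
    hinv _ (const_sub_mem_roumieuClass hNpos hf c) ⟨1, one_pos, hcf⟩
  obtain ⟨-, h, hh, C, hC⟩ := hucl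
  have hu0 : Tendsto u (nhdsWithin 0 S) (nhds (μ : ℂ)) := by
    have h1 := hlim 0
    simp only [iteratedDeriv_zero, pow_zero, one_mul] at h1
    have h2 := (h1.const_sub (c : ℂ)).inv₀ (by
      rw [← Complex.ofReal_sub]; exact_mod_cast hcx.ne')
    rw [hμ, hu]
    simpa [one_div] using h2
  -- the recursion passes to the limit at the vertex
  have hstep : ∀ (k : ℕ) (y : ℕ → ℝ),
      (∀ i ≤ k, Tendsto (iteratedDeriv i u) (nhdsWithin 0 S) (nhds ((-1) ^ i * (y i : ℂ)))) →
      Tendsto (iteratedDeriv (k + 1) u) (nhdsWithin 0 S) (nhds ((-1) ^ (k + 1) *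
        ((μ * ∑ i ∈ Finset.range (k + 1),
          ((k + 1).choose (i + 1) : ℝ) * x (i + 1) * y (k - i) : ℝ) : ℂ))) := by
    intro k y hy
    have h1 : Tendsto (fun z => u z * ∑ i ∈ Finset.range (k + 1), ((k + 1).choose (i + 1) : ℂ) *
        iteratedDeriv (i + 1) f z * iteratedDeriv (k - i) u z) (nhdsWithin 0 S)
        (nhds (μ * ∑ i ∈ Finset.range (k + 1), ((k + 1).choose (i + 1) : ℂ) *
          ((-1) ^ (i + 1) * (x (i + 1) : ℂ)) * ((-1) ^ (k - i) * (y (k - i) : ℂ)))) := by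
      refine hu0.mul (tendsto_finsetSum _ fun i _ => ?_)
      exact ((hlim (i + 1)).const_mul _).mul (hy (k - i) (Nat.sub_le _ _))
    have h2 : (μ : ℂ) * ∑ i ∈ Finset.range (k + 1), ((k + 1).choose (i + 1) : ℂ) *
          ((-1) ^ (i + 1) * (x (i + 1) : ℂ)) * ((-1) ^ (k - i) * (y (k - i) : ℂ)) =
        (-1) ^ (k + 1) * ((μ * ∑ i ∈ Finset.range (k + 1),
          ((k + 1).choose (i + 1) : ℝ) * x (i + 1) * y (k - i) : ℝ) : ℂ) := by
      push_cast
      rw [mul_left_comm, Finset.mul_sum (Finset.range (k + 1)) _ ((-1 : ℂ) ^ (k + 1))]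
      congr 1
      refine Finset.sum_congr rfl fun i hi => ?_
      have hik : i + 1 + (k - i) = k + 1 := by have := Finset.mem_range.1 hi; omega
      rw [← hik, pow_add (-1 : ℂ) (i + 1) (k - i)]
      ring
    rw [h2] at h1
    refine h1.congr' ?_
    filter_upwards [self_mem_nhdsWithin] with z hz
    exact (iteratedDeriv_succ_inv hSo hf.1 hcf0 k hz).symm
  have hex : ∀ k, ∃ y : ℝ,
      Tendsto (iteratedDeriv k u) (nhdsWithin 0 S) (nhds ((-1) ^ k * (y : ℂ))) := by
    intro k
    induction k using Nat.strong_induction_on with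
    | _ k ih =>
      rcases k with _ | k
      · exact ⟨μ, by simpa using hu0⟩
      · choose! y hy using ih
        exact ⟨_, hstep k y fun i hi => hy i (Nat.lt_succ_of_le hi)⟩
  choose y hy using hex
  have hsign : ∀ (k : ℕ) (a b : ℝ), ((-1) ^ k * (a : ℂ)) = (-1) ^ k * (b : ℂ) → a = b := by
    intro k a b hab
    have := mul_left_cancel₀ (pow_ne_zero k (by norm_num : (-1 : ℂ) ≠ 0)) hab
    exact_mod_cast this
  have hy0 : y 0 = μ := hsign 0 _ _ (tendsto_nhds_unique (hy 0) (by simpa using hu0))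
  have hyrec : ∀ k, y (k + 1) = μ * ∑ i ∈ Finset.range (k + 1),
      ((k + 1).choose (i + 1) : ℝ) * x (i + 1) * y (k - i) := fun k =>
    hsign (k + 1) _ _ (tendsto_nhds_unique (hy (k + 1)) (hstep k y fun i _ => hy i))
  have hynn : ∀ k, 0 ≤ y k := by
    intro k
    induction k using Nat.strong_induction_on with
    | _ k ih =>
      rcases k with _ | k
      · rw [hy0]; exact hμ0.le
      · rw [hyrec]
        refine mul_nonneg hμ0.le (Finset.sum_nonneg fun i _ => ?_)
        exact mul_nonneg (mul_nonneg (by positivity) (hx0 _)) (ih _ (by omega))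
  have hfac : ∀ n : ℕ, (0 : ℝ) < n.factorial := fun n => by exact_mod_cast n.factorial_pos
  -- one term of the recursion, all others being nonnegative
  have hmul : ∀ n j, 1 ≤ j → μ * check x j * check y n ≤ check y (n + j) := by
    intro n j hj
    obtain ⟨i, rfl⟩ : ∃ i, j = i + 1 := ⟨j - 1, by omega⟩
    have h1 : μ * (((n + i + 1).choose (i + 1) : ℝ) * x (i + 1) * y n) ≤ y (n + i + 1) := by
      rw [hyrec]
      refine mul_le_mul_of_nonneg_left ?_ hμ0.le
      have := Finset.single_le_sum (f := fun i' => ((n + i + 1).choose (i' + 1) : ℝ) * x (i' + 1) *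
        y (n + i - i')) (s := Finset.range (n + i + 1))
        (fun i' _ => mul_nonneg (mul_nonneg (by positivity) (hx0 _)) (hynn _))
        (Finset.mem_range.2 (by omega : i < n + i + 1))
      simpa using this
    have h2 : ((n + i + 1).choose (i + 1) : ℝ) = (n + i + 1).factorial /
        ((i + 1).factorial * n.factorial) := by
      rw [Nat.cast_choose ℝ (by omega), show n + i + 1 - (i + 1) = n by omega]
    rw [h2] at h1
    rw [← add_assoc, check, check, check, le_div_iff₀ (hfac _)]
    refine le_trans (le_of_eq ?_) h1
    field_simp
  have hpow : ∀ j l : ℕ, 1 ≤ j → μ * (μ * check x j) ^ l ≤ check y (j * l) := by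
    intro j l hj
    induction l with
    | zero => simp [check, hy0]
    | succ l ih =>
      have h1 : 0 ≤ μ * check x j := mul_nonneg hμ0.le (div_nonneg (hx0 j) (hfac j).le)
      calc μ * (μ * check x j) ^ (l + 1) = μ * check x j * (μ * (μ * check x j) ^ l) := by ring
        _ ≤ μ * check x j * check y (j * l) := mul_le_mul_of_nonneg_left ih h1
        _ ≤ check y (j * l + j) := hmul _ _ hj
        _ = _ := by rw [Nat.mul_succ]
  have hupper : ∀ k, check y k ≤ max C 1 * (h ^ k * check N k) := by
    intro k
    have h1 : ‖(-1) ^ k * (y k : ℂ)‖ ≤ C * (h ^ k * N k) :=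
      le_of_tendsto (hy k).norm (eventually_nhdsWithin_of_forall fun z hz => hC z hz k)
    rw [norm_mul, norm_pow, norm_neg, norm_one, one_pow, one_mul, Complex.norm_real,
      Real.norm_of_nonneg (hynn k)] at h1
    rw [check, check, div_le_iff₀ (hfac k), mul_assoc, mul_assoc, div_mul_cancel₀ _ (hfac k).ne']
    exact h1.trans (mul_le_mul_of_nonneg_right (le_max_left _ _)
      (by have := hNpos k; positivity))
  set m := max 1 μ⁻¹ with hm
  have hm1 : 1 ≤ m := le_max_left _ _
  have hK1 : 1 ≤ max C 1 := le_max_right _ _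
  refine ⟨192 * (m * m) * max C 1 * h, by positivity, fun j l hj hl => ?_⟩
  have hjl : 1 ≤ j * l := Nat.mul_pos hj hl
  have e1 : check N j ≤ 192 ^ j * check x j := by
    rw [check, check, mul_div_assoc']
    exact div_le_div_of_nonneg_right (hNx j hj) (hfac j).le
  have e2 : check N j ≤ 192 ^ j * m * (μ * check x j) := by
    refine e1.trans ?_
    have h0 : 0 ≤ check x j := div_nonneg (hx0 j) (hfac j).le
    rw [mul_assoc]
    refine mul_le_mul_of_nonneg_left ?_ (by positivity)
    rw [← mul_assoc]
    refine le_mul_of_one_le_left h0 ?_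
    calc (1 : ℝ) = μ⁻¹ * μ := (inv_mul_cancel₀ hμ0.ne').symm
      _ ≤ m * μ := mul_le_mul_of_nonneg_right (le_max_right _ _) hμ0.le
  have e3 : (μ * check x j) ^ l ≤ m * check y (j * l) := by
    have h1 := hpow j l hj
    have h2 : (μ * check x j) ^ l ≤ μ⁻¹ * check y (j * l) := by
      rw [inv_mul_eq_div, le_div_iff₀ hμ0]; linarith
    exact h2.trans (mul_le_mul_of_nonneg_right (le_max_right _ _)
      (div_nonneg (hynn _) (hfac _).le))
  have hm0 : 0 < m := by linarith
  have hNk := check_pos hNpos (j * l)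
  calc check N j ^ l ≤ (192 ^ j * m * (μ * check x j)) ^ l :=
        pow_le_pow_left₀ (check_pos hNpos j).le e2 l
    _ = 192 ^ (j * l) * m ^ l * (μ * check x j) ^ l := by
        rw [mul_pow, mul_pow, ← pow_mul]
    _ ≤ 192 ^ (j * l) * m ^ l * (m * (max C 1 * (h ^ (j * l) * check N (j * l)))) := by
        refine mul_le_mul_of_nonneg_left (e3.trans ?_) (by positivity)
        exact mul_le_mul_of_nonneg_left (hupper _) hm0.le
    _ = (192 ^ (j * l) * (m ^ l * m) * max C 1 * h ^ (j * l)) * check N (j * l) := by ring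
    _ ≤ (192 ^ (j * l) * (m ^ (j * l) * m ^ (j * l)) * max C 1 ^ (j * l) * h ^ (j * l)) *
          check N (j * l) := by
        have h1 : m ^ l ≤ m ^ (j * l) := pow_le_pow_right₀ hm1 (Nat.le_mul_of_pos_left l hj)
        have h2 : m ≤ m ^ (j * l) := le_self_pow₀ hm1 (by omega)
        have h3 : max C 1 ≤ max C 1 ^ (j * l) := le_self_pow₀ hK1 (by omega)
        gcongr
    _ = _ := by rw [mul_pow, mul_pow, mul_pow, mul_pow]

/-! ### Composition with holomorphic functions -/

/-- The derivatives up to order `k` of a composition `g ∘ f` depend only on `g` and on the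
derivatives of `f` up to order `k`. -/
theorem iteratedDeriv_comp_congr {f₁ f₂ : ℂ → ℂ} {z₁ z₂ : ℂ} (hf₁ : AnalyticAt ℂ f₁ z₁)
    (hf₂ : AnalyticAt ℂ f₂ z₂) (k : ℕ) {g : ℂ → ℂ} (hg : AnalyticAt ℂ g (f₁ z₁))
    (h : ∀ i ≤ k, iteratedDeriv i f₁ z₁ = iteratedDeriv i f₂ z₂) :
    iteratedDeriv k (g ∘ f₁) z₁ = iteratedDeriv k (g ∘ f₂) z₂ := by
  have h0 : f₁ z₁ = f₂ z₂ := by simpa using h 0 (Nat.zero_le k)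
  induction k using Nat.strong_induction_on generalizing g with
  | _ k ih =>
    rcases k with _ | k
    · simp [h0]
    · have key : ∀ {f : ℂ → ℂ} {z : ℂ}, AnalyticAt ℂ f z → AnalyticAt ℂ g (f z) →
          iteratedDeriv (k + 1) (g ∘ f) z = ∑ i ∈ Finset.range (k + 1), (k.choose i : ℂ) *
            iteratedDeriv i (deriv g ∘ f) z * iteratedDeriv (k - i + 1) f z := by
        intro f z hf hg
        have h1 : deriv (g ∘ f) =ᶠ[nhds z] (deriv g ∘ f) * deriv f := by
          filter_upwards [hf.eventually_analyticAt,
            hf.continuousAt.eventually hg.eventually_analyticAt] with w hw hgw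
          exact deriv_comp w hgw.differentiableAt hw.differentiableAt
        rw [iteratedDeriv_succ', (h1.iteratedDeriv k).eq_of_nhds,
          iteratedDeriv_mul (hg.deriv.comp hf).contDiffAt hf.deriv.contDiffAt]
        simp only [iteratedDeriv_succ']
      rw [key hf₁ hg, key hf₂ (h0 ▸ hg)]
      refine Finset.sum_congr rfl fun i hi => ?_
      have hi' := Finset.mem_range.1 hi
      rw [ih i hi' hg.deriv fun j hj => h j (by omega), h (k - i + 1) (by omega)]

theorem iteratedDeriv_sum_mul_pow_zero (a : ℕ → ℂ) {i k : ℕ} (hi : i ≤ k) :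
    iteratedDeriv i (fun w : ℂ => ∑ j ∈ Finset.range (k + 1), a j * w ^ j) 0 =
      i.factorial * a i := by
  rw [iteratedDeriv_fun_sum fun j _ => by fun_prop,
    Finset.sum_eq_single_of_mem i (Finset.mem_range.2 (by omega))]
  · rw [iteratedDeriv_const_mul_field, iteratedDeriv_fun_pow_zero]
    simp [mul_comm]
  · intro j _ hj
    rw [iteratedDeriv_const_mul_field, iteratedDeriv_fun_pow_zero]
    simp [hj.symm]

/-- A holomorphic function is bounded on a closed neighbourhood of a compact set. -/
theorem exists_norm_le_on_cthickening {g : ℂ → ℂ} {U K : Set ℂ} (hU : IsOpen U)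
    (hg : DifferentiableOn ℂ g U) (hK : IsCompact K) (hKU : K ⊆ U) :
    ∃ ε : ℝ, 0 < ε ∧ ∃ G : ℝ, 0 ≤ G ∧ ∀ z ∈ K, ∀ w, ‖w - z‖ ≤ ε → w ∈ U ∧ ‖g w‖ ≤ G := by
  obtain ⟨ε, hε, hεU⟩ := hK.exists_cthickening_subset_open hU hKU
  obtain ⟨G, hG⟩ := (hK.cthickening (r := ε)).exists_bound_of_continuousOn
    (hg.continuousOn.mono hεU)
  refine ⟨ε, hε, max G 0, le_max_right _ _, fun z hz w hw => ?_⟩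
  have hmem : w ∈ Metric.cthickening ε K :=
    Metric.mem_cthickening_of_dist_le w z ε K hz (by rwa [dist_eq_norm])
  exact ⟨hεU hmem, (hG w hmem).trans (le_max_left _ _)⟩

/-- By the Cauchy estimates, holomorphic functions belong to every local class whose weights
dominate `c ^ j j!` for some `c > 0`. -/
theorem mem_localRoumieuClass {M : ℕ → ℝ} {c₀ c : ℝ} (hc₀ : 0 < c₀) (hc : 0 < c)
    (hlow : ∀ j, c₀ * c ^ j ≤ check M j) {U : Set ℂ} (hU : IsOpen U) {g : ℂ → ℂ}
    (hg : DifferentiableOn ℂ g U) : g ∈ localRoumieuClass M U := by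
  refine ⟨hg, fun K hK hKU => ?_⟩
  obtain ⟨ε, hε, G, hG0, hG⟩ := exists_norm_le_on_cthickening hU hg hK hKU
  refine ⟨1 / (ε * c), by positivity, G / c₀, fun z hz j => ?_⟩
  have h1 : DiffContOnCl ℂ g (Metric.ball z ε) := hg.diffContOnCl_ball fun w hw =>
    (hG z hz w (by rwa [← dist_eq_norm])).1
  refine (Complex.norm_iteratedDeriv_le_of_forall_mem_sphere_norm_le j hε h1 fun w hw =>
    (hG z hz w (by rw [← dist_eq_norm]; exact (Metric.mem_sphere.1 hw).le)).2).trans ?_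
  have h2 := hlow j
  rw [check, le_div_iff₀ (by exact_mod_cast j.factorial_pos)] at h2
  calc (j.factorial : ℝ) * G / ε ^ j
      = G / c₀ * ((1 / (ε * c)) ^ j * (c₀ * c ^ j * j.factorial)) := by
        rw [div_pow, mul_pow]; field_simp; simp
    _ ≤ _ := by gcongr

/-- At each point of `S` and for each order `k`, replace `f` by its Taylor polynomial of degree
`k`. Root almost increasing weights make the polynomial close to its value at the centre on a disc
whose radius to the power `-k` is comparable to `check N k`, and the Cauchy estimate on this disc
bounds the `k`-th derivative of the composition. -/
theorem RootAlmostIncreasing.comp_mem_roumieuClass {N : ℕ → ℝ} (hpos : ∀ j, 0 < N j)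
    (h0 : N 0 = 1) (hN : RootAlmostIncreasing N) {S : Set ℂ} (hS : IsOpen S) {f : ℂ → ℂ}
    (hf : f ∈ roumieuClass N S) {U : Set ℂ} (hU : IsOpen U) (hfU : closure (f '' S) ⊆ U)
    {g : ℂ → ℂ} (hg : DifferentiableOn ℂ g U) : g ∘ f ∈ roumieuClass N S := by
  obtain ⟨hd, h, hh, C₀, hC₀⟩ := hf
  obtain ⟨C, hC1, hX⟩ := hN.exists_pow hpos h0
  have hmem : ∀ z ∈ S, f z ∈ closure (f '' S) := fun z hz =>
    subset_closure (Set.mem_image_of_mem f hz)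
  have hK : IsCompact (closure (f '' S)) := by
    refine Metric.isCompact_of_isClosed_isBounded isClosed_closure
      (Bornology.IsBounded.closure ?_)
    refine isBounded_iff_forall_norm_le.2 ⟨C₀, ?_⟩
    rintro _ ⟨z, hz, rfl⟩
    simpa [h0] using hC₀ z hz 0
  obtain ⟨ε, hε, G, hG0, hG⟩ := exists_norm_le_on_cthickening hU hg hK hfU
  -- `θ` is so small that the Taylor polynomials deviate by at most `ε` from their constant terms
  set A := max C₀ 1 with hA
  have hA1 : 1 ≤ A := le_max_right _ _
  obtain ⟨θ, hθ0, hθ1, hθ⟩ : ∃ θ : ℝ, 0 < θ ∧ θ ≤ 1 / 2 ∧ A * (θ * 2) ≤ ε := by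
    refine ⟨min (1 / 2) (ε / (2 * A)), by positivity, min_le_left _ _, ?_⟩
    calc A * (min (1 / 2) (ε / (2 * A)) * 2) ≤ A * (ε / (2 * A) * 2) := by
          gcongr; exact min_le_right _ _
      _ = ε := by field_simp
  refine ⟨hg.comp hd fun z hz => hfU (hmem z hz), h * C / θ, by positivity, G, fun z hz k => ?_⟩
  obtain ⟨X, hX0, hXk, hXm⟩ := hX k
  set a : ℕ → ℂ := fun j => iteratedDeriv j f z / j.factorial with ha
  set P : ℂ → ℂ := fun w => ∑ j ∈ Finset.range (k + 1), a j * w ^ j with hP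
  have hfac : ∀ n : ℕ, (n.factorial : ℂ) ≠ 0 := fun n => by exact_mod_cast n.factorial_ne_zero
  have hfac' : ∀ n : ℕ, (0 : ℝ) < n.factorial := fun n => by exact_mod_cast n.factorial_pos
  have hPd : Differentiable ℂ P := by fun_prop
  have hP0 : P 0 = f z := by
    rw [hP]
    simp [Finset.sum_range_succ', ha]
  have haX : ∀ j ≤ k, ‖a j‖ ≤ A * (h * X) ^ j := by
    intro j hj
    rw [ha]
    simp only [norm_div, Complex.norm_natCast]
    rw [div_le_iff₀ (hfac' j)]
    have h1 := hXm j hj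
    rw [check, div_le_iff₀ (hfac' j)] at h1
    have := hpos j
    calc ‖iteratedDeriv j f z‖ ≤ C₀ * (h ^ j * N j) := hC₀ z hz j
      _ ≤ A * (h ^ j * (X ^ j * j.factorial)) := by
          gcongr; exact le_max_left _ _
      _ = _ := by rw [mul_pow]; ring
  set R := θ / (h * X) with hR
  have hR0 : 0 < R := by positivity
  have hPb : ∀ w : ℂ, ‖w‖ ≤ R → ‖P w - f z‖ ≤ ε := by
    intro w hw
    have h1 : P w - f z = ∑ j ∈ Finset.range k, a (j + 1) * w ^ (j + 1) := by
      rw [← hP0, hP]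
      simp [Finset.sum_range_succ']
    rw [h1]
    calc ‖∑ j ∈ Finset.range k, a (j + 1) * w ^ (j + 1)‖
        ≤ ∑ j ∈ Finset.range k, A * (θ * (1 / 2) ^ j) := by
          refine norm_sum_le_of_le _ fun j hj => ?_
          rw [norm_mul, norm_pow]
          calc ‖a (j + 1)‖ * ‖w‖ ^ (j + 1) ≤ A * (h * X) ^ (j + 1) * R ^ (j + 1) := by
                gcongr
                exact haX (j + 1) (Finset.mem_range.1 hj)
            _ = A * θ ^ (j + 1) := by
                rw [mul_assoc, ← mul_pow, hR, mul_div_cancel₀ _ (by positivity)]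
            _ ≤ A * (θ * (1 / 2) ^ j) := by
                rw [pow_succ' θ]; gcongr
      _ = A * (θ * ∑ j ∈ Finset.range k, (1 / 2 : ℝ) ^ j) := by
          rw [Finset.mul_sum, Finset.mul_sum]
      _ ≤ A * (θ * 2) := by gcongr; exact sum_geometric_two_le k
      _ ≤ ε := hθ
  have hfan : AnalyticAt ℂ f z := hd.analyticAt (hS.mem_nhds hz)
  have hgan : AnalyticAt ℂ g (f z) := hg.analyticAt (hU.mem_nhds (hfU (hmem z hz)))
  rw [iteratedDeriv_comp_congr hfan (hPd.analyticAt 0) k hgan fun i hi => by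
    rw [hP, iteratedDeriv_sum_mul_pow_zero a hi, ha]
    simp only
    rw [mul_div_cancel₀ _ (hfac i)]]
  have hPG : ∀ w ∈ Metric.closedBall (0 : ℂ) R, P w ∈ U ∧ ‖g (P w)‖ ≤ G := fun w hw =>
    hG _ (hmem z hz) _ (hPb w (by simpa using hw))
  have hcl : DiffContOnCl ℂ (g ∘ P) (Metric.ball 0 R) := by
    have h1 : DifferentiableOn ℂ (g ∘ P) (P ⁻¹' U) := hg.comp hPd.differentiableOn fun w hw => hw
    exact h1.diffContOnCl_ball fun w hw => (hPG w hw).1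
  refine (Complex.norm_iteratedDeriv_le_of_forall_mem_sphere_norm_le k hR0 hcl fun w hw =>
    (hPG w (Metric.sphere_subset_closedBall hw)).2).trans (le_of_eq ?_)
  have h2 : X ^ k * k.factorial = C ^ k * N k := by
    rw [hXk, check, mul_assoc, div_mul_cancel₀ _ (hfac' k).ne']
  rw [hR, div_pow, div_pow, mul_pow, mul_pow, div_div_eq_mul_div]
  linear_combination G * h ^ k / θ ^ k * h2

/-! ### The equivalences -/

theorem HolomorphicallyClosed.inverseClosed {M : ℕ → ℝ} {S : Set ℂ}
    (h : HolomorphicallyClosed M S) : InverseClosed M S := by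
  rintro f hf ⟨δ, hδ, hfδ⟩
  have h1 : closure (f '' S) ⊆ {0}ᶜ := by
    have h2 : closure (f '' S) ⊆ {w | δ ≤ ‖w‖} := by
      refine closure_minimal ?_ (isClosed_le continuous_const continuous_norm)
      rintro _ ⟨z, hz, rfl⟩
      exact hfδ z hz
    rintro w hw rfl
    have h3 : δ ≤ ‖(0 : ℂ)‖ := h2 hw
    rw [norm_zero] at h3
    linarith
  exact h f hf {0}ᶜ isOpen_compl_singleton h1 (fun w => 1 / w)
    ((differentiableOn_const 1).div differentiableOn_id fun w hw => hw)

theorem HolomorphicallyClosed.compositionClosed {M : ℕ → ℝ} {S : Set ℂ}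
    (h : HolomorphicallyClosed M S) : CompositionClosed M S :=
  fun f hf U hU hfU g hg => h f hf U hU hfU g hg.1

theorem CompositionClosed.holomorphicallyClosed {M : ℕ → ℝ} (hpos : ∀ j, 0 < M j)
    (hlow : PositiveCheckLiminf M) {S : Set ℂ} (h : CompositionClosed M S) :
    HolomorphicallyClosed M S := by
  obtain ⟨c₀, c, hc₀, hc, hle⟩ := hlow.exists_le hpos
  exact fun f hf U hU hfU g hg => h f hf U hU hfU g (mem_localRoumieuClass hc₀ hc hle hU hg)

section Sector

variable {M : ℕ → ℝ} {α : ℝ}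

/-- If single regularized weights dominate products, then the regularized weights are root almost
increasing. -/
theorem rootAlmostIncreasing_regularized (hpos : ∀ j, 0 < M j) (hM0 : M 0 = 1) (hα1 : α ≤ 1)
    (hlim : RootsTendToInfinity fun j => gevrey (1 - α) j * M j)
    (h : ∃ H : ℝ, 0 < H ∧ ∀ j l : ℕ, 1 ≤ j → 1 ≤ l →
      check (regularized α M) j ^ l ≤ H ^ (j * l) * check (regularized α M) (j * l)) :
    RootAlmostIncreasing (regularized α M) := by
  obtain ⟨H, hH, hpow⟩ := h
  have hG := gevrey_mul_pos (α := α) hpos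
  refine rootAlmostIncreasing_of_pow_le (κ := 1 - α) (by linarith) (lcMinorant_pos hG hlim)
    (lcMinorant_logConvex hG hlim) ?_ (fun j => by rw [neg_sub]; rfl) hH hpow
  have := regularized_zero hpos hM0 hlim
  rwa [regularized, gevrey_zero, one_mul] at this

theorem RootAlmostIncreasing.holomorphicallyClosed (hpos : ∀ j, 0 < M j) (hM0 : M 0 = 1)
    (hα0 : 0 < α) (hα1 : α ≤ 1) (hlim : RootsTendToInfinity fun j => gevrey (1 - α) j * M j)
    (h : RootAlmostIncreasing (regularized α M)) : HolomorphicallyClosed M (sector α) := by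
  intro f hf U hU hfU g hg
  rw [← roumieuClass_regularized hpos hα0 hα1 hlim] at hf ⊢
  exact h.comp_mem_roumieuClass (regularized_pos hpos hlim) (regularized_zero hpos hM0 hlim)
    (isOpen_sector hα0 hα1) hf hU hfU hg

theorem InverseClosed.rootAlmostIncreasing (hpos : ∀ j, 0 < M j) (hM0 : M 0 = 1)
    (hα0 : 0 < α) (hα1 : α ≤ 1) (hlim : RootsTendToInfinity fun j => gevrey (1 - α) j * M j)
    (h : InverseClosed M (sector α)) : RootAlmostIncreasing (regularized α M) := by
  have hG := gevrey_mul_pos (α := α) hpos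
  refine rootAlmostIncreasing_regularized hpos hM0 hα1 hlim
    (InverseClosed.pow_le hα0 hα1 (lcMinorant_pos hG hlim) (lcMinorant_logConvex hG hlim)
      (fun j => by rw [neg_sub]; rfl) ?_)
  rwa [InverseClosed, roumieuClass_regularized hpos hα0 hα1 hlim]

theorem FaaDiBruno.rootAlmostIncreasing (hpos : ∀ j, 0 < M j) (hM0 : M 0 = 1)
    (hα1 : α ≤ 1) (hlim : RootsTendToInfinity fun j => gevrey (1 - α) j * M j)
    (hlow : PositiveCheckLiminf M) (h : FaaDiBruno (regularized α M)) :
    RootAlmostIncreasing (regularized α M) := by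
  obtain ⟨c₀, c, hc₀, hc, hle⟩ := hlow.exists_le hpos
  exact rootAlmostIncreasing_regularized hpos hM0 hα1 hlim
    (h.pow_le (regularized_pos hpos hlim) hc₀ hc
      (le_check_regularized hpos hα1 hlim hc₀ hc hle))

end Sector

end Ultrahol

end

theorem mainTheorem6 (M : ℕ → ℝ) (hpos : ∀ j, 0 < M j) (hM0 : M 0 = 1)
    (α : ℝ) (hα0 : 0 < α) (hα1 : α ≤ 1)
    (hlim : Ultrahol.RootsTendToInfinity (fun j => Ultrahol.gevrey (1 - α) j * M j)) :
    List.TFAE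
      [Ultrahol.RootAlmostIncreasing (Ultrahol.regularized α M),
       Ultrahol.HolomorphicallyClosed M (Ultrahol.sector α),
       Ultrahol.InverseClosed M (Ultrahol.sector α)] ∧
    (Ultrahol.PositiveCheckLiminf M →
      Ultrahol.DerivationClosed (Ultrahol.regularized α M) →
      List.TFAE
        [Ultrahol.RootAlmostIncreasing (Ultrahol.regularized α M),
         Ultrahol.HolomorphicallyClosed M (Ultrahol.sector α),
         Ultrahol.InverseClosed M (Ultrahol.sector α),
         Ultrahol.CompositionClosed M (Ultrahol.sector α),
         Ultrahol.FaaDiBruno (Ultrahol.regularized α M)]) := by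
  have hab := Ultrahol.RootAlmostIncreasing.holomorphicallyClosed hpos hM0 hα0 hα1 hlim
  have hbc := Ultrahol.HolomorphicallyClosed.inverseClosed (M := M) (S := Ultrahol.sector α)
  have hca := Ultrahol.InverseClosed.rootAlmostIncreasing hpos hM0 hα0 hα1 hlim
  refine ⟨?_, fun hlow hdc => ?_⟩
  · tfae_have 1 → 2 := hab
    tfae_have 2 → 3 := hbc
    tfae_have 3 → 1 := hca
    tfae_finish
  · tfae_have 1 → 2 := hab
    tfae_have 2 → 3 := hbc
    tfae_have 3 → 1 := hca
    tfae_have 2 → 4 := Ultrahol.HolomorphicallyClosed.compositionClosed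
    tfae_have 4 → 2 := Ultrahol.CompositionClosed.holomorphicallyClosed hpos hlow
    tfae_have 1 → 5 := fun h => h.faaDiBruno (Ultrahol.regularized_pos hpos hlim)
      (Ultrahol.regularized_zero hpos hM0 hlim) hdc
    tfae_have 5 → 1 := Ultrahol.FaaDiBruno.rootAlmostIncreasing hpos hM0 hα1 hlim hlow
    tfae_finish
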